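/- Let $k$ be an algebraically closed field of arbitrary characteristic, let $N$ be a lattice of finite rank with dual lattice $M=\operatorname{Hom}(N,\mathbb Z)$, let $\Sigma$ be a smooth fan in $N_{\mathbb R}$, and let $X=X_\Sigma$ be the associated smooth toric variety over $k$. For a ray $\rho\in\Sigma(1)$ let $u_\rho\in N$ be its primitive generator and $D_\rho\subset X$ the corresponding torus-invariant prime divisor. Let $\ell\ge 1$ be an integer and let $F_\ell:X\to X$ be the toric Frobenius morphism, i.e. the toric morphism over $k$ induced by multiplication by $\ell$ on $N$. For a divisor $D$ on $X$ let $\mathcal O_X(D)$ be the sheaf of rational functions $f$ with $\operatorname{div}(f)+D\ge 0$. Then: 1. $\mathcal O_X(E)$ is a line bundle for every divisor $E$ on $X$, and for every divisor $D$ on $X$ the sheaf $(F_\ell)_*\mathcal O_X(D)$ is isomorphic to a finite direct sum of line bundles of the form $\mathcal O_X(E)$. 2. If the rays of $\Sigma$ span $N_{\mathbb R}$ (i.e. $X$ has no torus factor), then for every divisor $D$ on $X$ $$(F_\ell)_*\mathcal O_X(D)\;\cong\;\bigoplus_{[E]\in\operatorname{Pic}(X)}\mathcal O_X(E)^{\oplus\mu(E,D)},$$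 where $\operatorname{Pic}(X)$ is the group of divisors modulo linear equivalence, one representative $E$ is chosen in each class, and $\mu(E,D)$ is the number of torus-invariant divisors $\sum_\rho c_\rho D_\rho$ that are linearly equivalent to $D-\ell E$ and satisfy $0\le c_\rho<\ell$ for all $\rho$. 3. For every torus-invariant divisor $D=\sum_{\rho}a_\rho D_\rho$, without the assumption on the rays, $$(F_\ell)_*\mathcal O_X(D)\;\cong\;\bigoplus_{[m]\in M/\ell M}\mathcal O_X\Bigl(\sum_{\rho\in\Sigma(1)}\Bigl\lfloor\frac{a_\rho-\langle m,u_\rho\rangle}{\ell}\Bigr\rfloor D_\rho\Bigr),$$ for any choice of representatives $m\in M$ of the classes in $M/\ell M$. -/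

import Mathlib

open CategoryTheory CategoryTheory.Limits AlgebraicGeometry
open scoped TensorProduct

universe u

/-! ## Weil divisors and their sheaves -/

/-- An integral scheme is regular in codimension one if its local ring at every point of
codimension one (in the specialization order, coheight is codimension) is a discrete valuation
ring. -/
class RegularInCodimOne (X : Scheme.{u}) [IsIntegral X] : Prop where
  isDVR : ∀ x : X, Order.coheight x = 1 → IsDiscreteValuationRing (X.presheaf.stalk x)

/-- Weil divisors on a Noetherian scheme: finite formal sums of prime divisors, a prime divisor being
given by its generic point, a point of codimension one. -/
abbrev WeilDivisor (X : Scheme.{u}) : Type u :=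
  {x : X // Order.coheight x = 1} →₀ ℤ

namespace WeilDivisor

section Principal

variable (X : Scheme.{u}) [IsIntegral X] [IsLocallyNoetherian X]

/-- The subgroup of principal divisors `div f`, `f` a nonzero rational function. -/
def principal : AddSubgroup (WeilDivisor X) where
  carrier := {D | ∃ f : X.functionField, f ≠ 0 ∧
    ∀ x : {x : X // Order.coheight x = 1}, D x = Scheme.ord f x.1}
  zero_mem' := ⟨1, one_ne_zero, fun x => by
    have h := Scheme.ord_mul (x := x.1) (one_ne_zero (α := X.functionField)) one_ne_zero
    rw [mul_one] at h
    change (0 : ℤ) = _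
    omega⟩
  add_mem' := by
    rintro D E ⟨f, hf, hD⟩ ⟨g, hg, hE⟩
    exact ⟨f * g, mul_ne_zero hf hg, fun x => by
      rw [Finsupp.add_apply, hD, hE, Scheme.ord_mul hf hg]⟩
  neg_mem' := by
    rintro D ⟨f, hf, hD⟩
    refine ⟨f⁻¹, inv_ne_zero hf, fun x => ?_⟩
    have h := Scheme.ord_mul (x := x.1) (one_ne_zero (α := X.functionField)) one_ne_zero
    have h' := Scheme.ord_mul (x := x.1) hf (inv_ne_zero hf)
    rw [mul_inv_cancel₀ hf] at h'
    rw [mul_one] at h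
    rw [Finsupp.neg_apply, hD]
    omega

/-- The divisor class group, divisors modulo linear equivalence. On a smooth variety it is the
Picard group, the class of `E` corresponding to the line bundle `𝒪(E)`. -/
abbrev ClassGroup : Type u := WeilDivisor X ⧸ principal X

end Principal

/-- Linear equivalence of divisors. -/
def LinEquiv {X : Scheme.{u}} [IsIntegral X] [IsLocallyNoetherian X] (D E : WeilDivisor X) : Prop :=
  D - E ∈ principal X

theorem ord_smul_ge {X : Scheme.{u}} [IsIntegral X] [IsLocallyNoetherian X]
    (D : WeilDivisor X) (x : {x : X // Order.coheight x = 1})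
    (a : X.presheaf.stalk x.1) {f : X.functionField} (hf : f = 0 ∨ -D x ≤ Scheme.ord f x.1) :
    a • f = 0 ∨ -D x ≤ Scheme.ord (a • f) x.1 := by
  by_cases h : a • f = 0
  · exact Or.inl h
  have hf0 : f ≠ 0 := fun h' => h (by simp [h'])
  have ha : a ≠ 0 := fun h' => h (by simp [h'])
  refine Or.inr ((hf.resolve_left hf0).trans ?_)
  rw [Scheme.ord_le_ord_iff x.2 x.2 hf0 h]
  have := krullDimLE_of_coheight_le x.2.le
  exact Ring.ordFrac_le_smul _
    (by simpa using (IsFractionRing.injective (X.presheaf.stalk x.1) X.functionField).ne ha) f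

theorem germ_smul_eq {X : Scheme.{u}} [IsIntegral X] {U : X.Opens} (r : Γ(X, U)) (x y : U) (f : X.functionField) :
    X.presheaf.germ U x.1 x.2 r • f = X.presheaf.germ U y.1 y.2 r • f := by
  have : Nonempty U := ⟨x⟩
  rw [Algebra.smul_def, Algebra.smul_def, Scheme.algebraMap_germ_eq_germToFunctionField X x.2 r,
    Scheme.algebraMap_germ_eq_germToFunctionField X y.2 r]

variable {X : Scheme.{u}} [IsIntegral X] [IsLocallyNoetherian X] [RegularInCodimOne X]

theorem ord_add_ge (D : WeilDivisor X) (x : {x : X // Order.coheight x = 1})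
    {f g : X.functionField} (hf : f = 0 ∨ -D x ≤ Scheme.ord f x.1)
    (hg : g = 0 ∨ -D x ≤ Scheme.ord g x.1) :
    f + g = 0 ∨ -D x ≤ Scheme.ord (f + g) x.1 := by
  by_cases h : f + g = 0
  · exact Or.inl h
  rcases hf with rfl | hf
  · simpa using hg
  rcases hg with rfl | hg
  · simpa using Or.inr hf
  have := RegularInCodimOne.isDVR x.1 x.2
  exact Or.inr ((le_min hf hg).trans (Scheme.ord_add h))

/-- The sections of `𝒪(D)` over `U`: rational functions `f` with `f = 0` or `ord_x f ≥ - D(x)` for all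
points `x ∈ U` of codimension one. The function `f` is recorded as a constant map `U → K(X)`, so that
there is exactly one section over the empty set. -/
def sections (D : WeilDivisor X) (U : X.Opens) : AddSubgroup (U → X.functionField) where
  carrier := {s | (∀ x y : U, s x = s y) ∧ ∀ (x : U) (hx : Order.coheight x.1 = 1),
    s x = 0 ∨ -D ⟨x.1, hx⟩ ≤ Scheme.ord (s x) x.1}
  zero_mem' := ⟨fun _ _ => rfl, fun _ _ => Or.inl rfl⟩
  add_mem' := fun {s t} hs ht =>
    ⟨fun x y => congrArg₂ (· + ·) (hs.1 x y) (ht.1 x y), fun x hx =>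
      D.ord_add_ge ⟨x.1, hx⟩ (hs.2 x hx) (ht.2 x hx)⟩
  neg_mem' := fun {s} hs => ⟨fun x y => congrArg Neg.neg (hs.1 x y), fun x hx => by
    have := D.ord_smul_ge ⟨x.1, hx⟩ (-1) (hs.2 x hx)
    rwa [neg_smul, one_smul] at this⟩

/-- A regular function acts on sections of `𝒪(D)` by multiplication in the function field. -/
noncomputable instance (D : WeilDivisor X) (U : X.Opens) : Module Γ(X, U) (D.sections U) where
  smul r s := ⟨fun x => X.presheaf.germ U x.1 x.2 r • s.1 x, fun x y =>
      (germ_smul_eq r x y _).trans (congrArg _ (s.2.1 x y)),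
    fun x hx => D.ord_smul_ge ⟨x.1, hx⟩ _ (s.2.2 x hx)⟩
  one_smul s := Subtype.ext (funext fun x => by
    change X.presheaf.germ U x.1 x.2 1 • s.1 x = s.1 x
    rw [map_one, one_smul])
  mul_smul a b s := Subtype.ext (funext fun x => by
    change X.presheaf.germ U x.1 x.2 (a * b) • s.1 x = X.presheaf.germ U x.1 x.2 a • X.presheaf.germ U x.1 x.2 b • s.1 x
    rw [map_mul, mul_smul])
  smul_zero a := Subtype.ext (funext fun x => smul_zero _)
  smul_add a s t := Subtype.ext (funext fun x => smul_add _ _ _)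
  add_smul a b s := Subtype.ext (funext fun x => by
    change X.presheaf.germ U x.1 x.2 (a + b) • s.1 x = X.presheaf.germ U x.1 x.2 a • s.1 x + X.presheaf.germ U x.1 x.2 b • s.1 x
    rw [map_add, add_smul])
  zero_smul s := Subtype.ext (funext fun x => by
    change X.presheaf.germ U x.1 x.2 0 • s.1 x = 0
    rw [map_zero, zero_smul])

@[simp] theorem smul_coe_apply (D : WeilDivisor X) (U : X.Opens) (r : Γ(X, U)) (s : D.sections U)
    (x : U) : (r • s).1 x = X.presheaf.germ U x.1 x.2 r • s.1 x := rfl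

/-- Restriction of sections of `𝒪(D)`. -/
def restr (D : WeilDivisor X) {U V : X.Opens} (h : V ≤ U) : D.sections U →+ D.sections V where
  toFun s := ⟨fun x => s.1 ⟨x.1, h x.2⟩, fun _ _ => s.2.1 _ _, fun _ hx => s.2.2 _ hx⟩
  map_zero' := rfl
  map_add' _ _ := rfl

/-- `𝒪(D)` as a presheaf of abelian groups. -/
noncomputable def presheafAb (D : WeilDivisor X) : TopCat.Presheaf Ab.{u} X where
  obj U := AddCommGrpCat.of (D.sections U.unop)
  map i := AddCommGrpCat.ofHom (D.restr i.unop.le)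
  map_id _ := rfl
  map_comp _ _ := rfl

theorem presheafAb_isSheaf (D : WeilDivisor X) : D.presheafAb.IsSheaf := by
  rw [TopCat.Presheaf.isSheaf_iff_isSheaf_comp (forget Ab.{u})]
  apply TopCat.Presheaf.isSheaf_of_isSheafUniqueGluing_types
  intro ι U sf hsf
  have key : ∀ (i j : ι) (x : X) (hi : x ∈ U i) (hj : x ∈ U j),
      (sf i).1 ⟨x, hi⟩ = (sf j).1 ⟨x, hj⟩ := fun i j x hi hj =>
    congrFun (congrArg Subtype.val (hsf i j)) (⟨x, hi, hj⟩ : (U i ⊓ U j : X.Opens))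
  choose idx hidx using fun x : (iSup U : X.Opens) => TopologicalSpace.Opens.mem_iSup.mp x.2
  refine ⟨⟨fun x => (sf (idx x)).1 ⟨x.1, hidx x⟩, fun x y => ?_, fun x hx =>
    (sf (idx x)).2.2 ⟨x.1, hidx x⟩ hx⟩, fun i => ?_, fun t ht => ?_⟩
  · obtain ⟨z, hz⟩ := nonempty_preirreducible_inter (U (idx x)).isOpen (U (idx y)).isOpen
      ⟨x.1, hidx x⟩ ⟨y.1, hidx y⟩
    exact ((sf (idx x)).2.1 _ ⟨z, hz.1⟩).trans
      ((key _ _ z hz.1 hz.2).trans ((sf (idx y)).2.1 _ _))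
  · exact Subtype.ext (funext fun x => key _ _ _ _ _)
  · refine Subtype.ext (funext fun x => ?_)
    exact congrFun (congrArg Subtype.val (ht (idx x))) ⟨x.1, hidx x⟩

noncomputable instance (D : WeilDivisor X) (U : (TopologicalSpace.Opens X)ᵒᵖ) :
    Module (X.ringCatSheaf.obj.obj U) (D.presheafAb.obj U) :=
  inferInstanceAs (Module Γ(X, U.unop) (D.sections U.unop))

/-- The sheaf of modules `𝒪(D)` of a Weil divisor `D`. -/
noncomputable def sheaf (D : WeilDivisor X) : X.Modules where
  val := PresheafOfModules.ofPresheaf D.presheafAb fun _ _ i r s => Subtype.ext (funext fun x =>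
    congrArg (fun a : X.presheaf.stalk x.1 => a • s.1 ⟨x.1, i.unop.le x.2⟩)
      (X.presheaf.germ_res_apply i.unop x.1 x.2 r).symm)
  isSheaf := D.presheafAb_isSheaf

end WeilDivisor

/-- A line bundle: a sheaf of modules that is locally isomorphic to the structure sheaf. -/
def IsLineBundle {X : Scheme.{u}} (L : X.Modules) : Prop :=
  ∀ x : X, ∃ U : X.Opens, x ∈ U ∧
    Nonempty (L.restrict U.ι ≅ (SheafOfModules.unit U.toScheme.ringCatSheaf : U.toScheme.Modules))

/-! ## Smooth fans -/

/-- The cone in `N_ℝ = ℝ ⊗ N` generated by a set of vectors of `N`. -/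
noncomputable def realCone {N : Type u} [AddCommGroup N] (S : Set N) :
    PointedCone ℝ (ℝ ⊗[ℤ] N) :=
  PointedCone.hull ℝ ((fun v : N => (1 : ℝ) ⊗ₜ[ℤ] v) '' S)

/-- A smooth fan in the lattice `N`. A smooth cone (one that is generated by part of a `ℤ`-basis
of `N`) is recorded by the finite set of its primitive generators, so that its faces are the cones
generated by the subsets. A fan is a finite nonempty set of cones which contains the faces of its
cones, and in which any two cones intersect in a common face. -/
structure SmoothFan (N : Type u) [AddCommGroup N] [Module.Free ℤ N] [Module.Finite ℤ N] where
  cones : Finset (Finset N)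
  empty_mem : ∅ ∈ cones
  face_mem : ∀ σ ∈ cones, ∀ τ ⊆ σ, τ ∈ cones
  smooth : ∀ σ ∈ cones, ∃ (ι : Type u) (b : Module.Basis ι ℤ N), (σ : Set N) ⊆ Set.range b
  inter : ∀ σ ∈ cones, ∀ τ ∈ cones,
    realCone (σ : Set N) ⊓ realCone (τ : Set N) = realCone ((σ : Set N) ∩ (τ : Set N))

/-- The monoid `S_σ = σ^∨ ∩ M`, `M = Hom(N, ℤ)`, of the cone generated by `σ`. -/
def dualMonoid {N : Type u} [AddCommGroup N] (σ : Set N) : AddSubmonoid (Module.Dual ℤ N) where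
  carrier := {m | ∀ u ∈ σ, 0 ≤ m u}
  zero_mem' := fun _ _ => le_rfl
  add_mem' := fun ha hb u hu => add_nonneg (ha u hu) (hb u hu)

theorem dualMonoid_anti {N : Type u} [AddCommGroup N] {σ τ : Set N} (h : τ ⊆ σ) :
    dualMonoid σ ≤ dualMonoid τ := fun _ hm u hu => hm u (h hu)

/-- The coordinate ring `k[S_σ]` of the affine toric variety `U_σ`. -/
abbrev coneRing (k : Type u) [Field k] {N : Type u} [AddCommGroup N] (σ : Set N) : Type u :=
  AddMonoidAlgebra k (dualMonoid σ)

/-- The inclusion `k[S_σ] → k[S_τ]` for a face `τ` of `σ`. -/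
noncomputable def coneRingMap (k : Type u) [Field k] {N : Type u} [AddCommGroup N] {σ τ : Set N}
    (h : τ ⊆ σ) : coneRing k σ →+* coneRing k τ :=
  AddMonoidAlgebra.mapDomainRingHom k (AddSubmonoid.inclusion (dualMonoid_anti h))

section
variable {k : Type u} [Field k] {N : Type u} [AddCommGroup N]

theorem coneRingMap_injective {σ τ : Set N} (h : τ ⊆ σ) :
    Function.Injective (coneRingMap k h) :=
  AddMonoidAlgebra.mapDomain_injective (AddSubmonoid.inclusion_injective (dualMonoid_anti h))

theorem coneRingMap_comp {σ τ ρ : Set N} (h : τ ⊆ σ) (h' : ρ ⊆ τ) :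
    (coneRingMap k h').comp (coneRingMap k h) = coneRingMap k (h'.trans h) :=
  (AddMonoidAlgebra.mapDomainRingHom_comp (R := k) (AddSubmonoid.inclusion (dualMonoid_anti h'))
    (AddSubmonoid.inclusion (dualMonoid_anti h))).symm

theorem coneRingMap_single {σ τ : Set N} (h : τ ⊆ σ) (m : dualMonoid σ) (a : k) :
    coneRingMap k h (AddMonoidAlgebra.single m a) =
      AddMonoidAlgebra.single (AddSubmonoid.inclusion (dualMonoid_anti h) m) a := by
  simp [coneRingMap]

/-- For a face `τ` of a smooth cone `σ`, the ring `k[S_τ]` is the localization of `k[S_σ]` at a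
monomial. -/
theorem exists_isLocalizationAway {ι : Type u} (b : Module.Basis ι ℤ N) [Finite ι] {σ τ : Set N}
    (h : τ ⊆ σ) (hσ : σ ⊆ Set.range b) :
    ∃ m : dualMonoid σ, (∀ u ∈ τ, m.1 u = 0) ∧ (∀ u ∈ σ, u ∉ τ → m.1 u = 1) ∧
     @IsLocalization.Away _ _ (AddMonoidAlgebra.single m (1 : k) : coneRing k σ)
      (coneRing k τ) _ (coneRingMap k h).toAlgebra := by
  classical
  have := Fintype.ofFinite ι
  let m0 : Module.Dual ℤ N := b.constr ℤ (fun i => if b i ∈ τ then (0:ℤ) else 1)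
  have hm0 : ∀ i, m0 (b i) = if b i ∈ τ then (0:ℤ) else 1 := fun i => by
    rw [Module.Basis.constr_basis]
  have hτ : ∀ u ∈ τ, m0 u = 0 := fun u hu => by
    obtain ⟨i, rfl⟩ := hσ (h hu); rw [hm0, if_pos hu]
  have hστ : ∀ u ∈ σ, u ∉ τ → m0 u = 1 := fun u hu hu' => by
    obtain ⟨i, rfl⟩ := hσ hu; rw [hm0, if_neg hu']
  let m : dualMonoid σ := ⟨m0, fun u hu => by
    by_cases hu' : u ∈ τ
    · exact (hτ u hu').ge
    · rw [hστ u hu hu']; exact zero_le_one⟩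
  refine ⟨m, hτ, hστ, ?_⟩
  let := (coneRingMap k h).toAlgebra
  have halg : ∀ x, algebraMap (coneRing k σ) (coneRing k τ) x = coneRingMap k h x := fun _ => rfl
  have hpow : ∀ n : ℕ, (AddMonoidAlgebra.single m (1 : k) : coneRing k σ) ^ n =
      AddMonoidAlgebra.single (n • m) 1 := fun n => by
    rw [AddMonoidAlgebra.single_pow, one_pow]
  refine IsLocalization.Away.mk _ ?_ ?_ ?_
  · rw [halg, coneRingMap_single]
    refine IsUnit.of_mul_eq_one (AddMonoidAlgebra.single
      (⟨-m0, fun u hu => by simp [hτ u hu]⟩ : dualMonoid τ) 1) ?_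
    rw [AddMonoidAlgebra.single_mul_single, AddMonoidAlgebra.one_def]
    congr 1
    · exact Subtype.ext (add_neg_cancel m0)
    · simp
  · intro f
    suffices ∃ n : ℕ, ∃ a : coneRing k σ,
        f * coneRingMap k h (AddMonoidAlgebra.single m 1) ^ n = coneRingMap k h a from this
    induction f using AddMonoidAlgebra.induction_linear with
    | zero => exact ⟨0, 0, by simp⟩
    | add x y hx hy =>
      obtain ⟨n, a, ha⟩ := hx
      obtain ⟨n', a', ha'⟩ := hy
      refine ⟨n + n', a * (AddMonoidAlgebra.single m 1) ^ n' + a' * (AddMonoidAlgebra.single m 1) ^ n, ?_⟩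
      rw [map_add, map_mul, map_mul, map_pow, map_pow, ← ha, ← ha']
      ring
    | single s r =>
      refine ⟨∑ i, (s.1 (b i)).natAbs, AddMonoidAlgebra.single
        ⟨s.1 + (∑ i, (s.1 (b i)).natAbs) • m0, fun u hu => ?_⟩ r, ?_⟩
      · by_cases hu' : u ∈ τ
        · simpa [hτ u hu'] using s.2 u hu'
        · obtain ⟨i, rfl⟩ := hσ hu
          have h1 : (s.1 (b i)).natAbs ≤ ∑ i, (s.1 (b i)).natAbs :=
            Finset.single_le_sum (f := fun i => (s.1 (b i)).natAbs) (fun _ _ => Nat.zero_le _)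
              (Finset.mem_univ i)
          have h2 := hστ _ hu hu'
          simp only [LinearMap.add_apply, LinearMap.smul_apply, h2]
          rw [nsmul_eq_mul, mul_one]
          omega
      · rw [← map_pow, hpow, coneRingMap_single, coneRingMap_single,
          AddMonoidAlgebra.single_mul_single, mul_one]
        rfl
  · intro x y hxy
    exact ⟨0, by rw [coneRingMap_injective h hxy]⟩

instance [Module.Free ℤ N] : IsDomain (AddMonoidAlgebra k (Module.Dual ℤ N)) := by
  let b := Module.Free.chooseBasis ℤ N
  let f : Module.Dual ℤ N →+ (Module.Free.ChooseBasisIndex ℤ N → ℤ) :=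
    { toFun := fun m i => m (b i), map_zero' := rfl, map_add' := fun _ _ => rfl }
  have : TwoUniqueSums (Module.Dual ℤ N) := TwoUniqueSums.of_injective_addHom f.toAddHom
    (fun _ _ h => b.ext fun i => congrFun h i) inferInstance
  exact NoZeroDivisors.to_isDomain _

instance [Module.Free ℤ N] (σ : Set N) : IsDomain (coneRing k σ) :=
  Function.Injective.isDomain (AddMonoidAlgebra.mapDomainRingHom k (dualMonoid σ).subtype)
    (AddMonoidAlgebra.mapDomain_injective Subtype.val_injective)

/-- For the cone of a full basis the monoid is free. -/
noncomputable def dualMonoidEquiv {ι : Type u} (b : Module.Basis ι ℤ N) [Finite ι] :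
    dualMonoid (Set.range b) ≃+ (ι →₀ ℕ) where
  toFun m := Finsupp.equivFunOnFinite.symm fun i => (m.1 (b i)).toNat
  invFun c := ⟨b.constr ℤ fun i => (c i : ℤ), by rintro _ ⟨i, rfl⟩; simp [Module.Basis.constr_basis]⟩
  left_inv m := Subtype.ext (b.ext fun i => by
    have := m.2 (b i) ⟨i, rfl⟩
    simp [Module.Basis.constr_basis, this])
  right_inv c := by ext i; simp [Module.Basis.constr_basis]
  map_add' m m' := by
    ext i
    have := m.2 (b i) ⟨i, rfl⟩
    have := m'.2 (b i) ⟨i, rfl⟩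
    simp; omega

theorem coneRing_range_noeth {ι : Type u} (b : Module.Basis ι ℤ N) [Finite ι] :
    IsNoetherianRing (coneRing k (Set.range b)) ∧ IsIntegrallyClosed (coneRing k (Set.range b)) := by
  have : Module.Free ℤ N := .of_basis b
  let e : MvPolynomial ι k ≃+* coneRing k (Set.range b) :=
    (AddMonoidAlgebra.mapDomainRingEquiv k (dualMonoidEquiv b)).symm
  have := e.toMulEquiv.uniqueFactorizationMonoid inferInstance
  exact ⟨isNoetherianRing_of_ringEquiv _ e, inferInstance⟩

theorem coneRing_noeth {ι : Type u} (b : Module.Basis ι ℤ N) [Finite ι] {τ : Set N} (hτ : τ ⊆ Set.range b) :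
    IsNoetherianRing (coneRing k τ) ∧ IsIntegrallyClosed (coneRing k τ) := by
  have : Module.Free ℤ N := .of_basis b
  obtain ⟨m, -, -, hm⟩ := exists_isLocalizationAway (k := k) b hτ le_rfl
  let := (coneRingMap k hτ).toAlgebra
  obtain ⟨h1, h2⟩ := coneRing_range_noeth (k := k) b
  refine ⟨IsLocalization.isNoetherianRing (.powers (AddMonoidAlgebra.single m (1 : k) : coneRing k (Set.range b))) _ h1,
    isIntegrallyClosed_of_isLocalization _ (.powers (AddMonoidAlgebra.single m (1 : k) : coneRing k (Set.range b))) (powers_le_nonZeroDivisors_of_noZeroDivisors ?_)⟩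
  simp [AddMonoidAlgebra.single_eq_zero]

theorem isOpenImmersion_coneRingMap {ι : Type u} (b : Module.Basis ι ℤ N) [Finite ι] {σ τ : Set N}
    (h : τ ⊆ σ) (hσ : σ ⊆ Set.range b) :
    IsOpenImmersion (Spec.map (CommRingCat.ofHom (coneRingMap k h))) := by
  obtain ⟨m, -, -, hm⟩ := exists_isLocalizationAway (k := k) b h hσ
  let := (coneRingMap k h).toAlgebra
  exact IsOpenImmersion.of_isLocalization (AddMonoidAlgebra.single m (1 : k) : coneRing k σ)

theorem exists_comap_eq {ι : Type u} (b : Module.Basis ι ℤ N) [Finite ι] {σ τ τ' ρ : Set N}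
    (hρ : ρ = τ ∩ τ') (h'' : ρ ⊆ σ) (h : τ ⊆ σ) (h' : τ' ⊆ σ) (hσ : σ ⊆ Set.range b) (p : PrimeSpectrum (coneRing k τ))
    (p' : PrimeSpectrum (coneRing k τ'))
    (hp : PrimeSpectrum.comap (coneRingMap k h) p = PrimeSpectrum.comap (coneRingMap k h') p') :
    ∃ q : PrimeSpectrum (coneRing k ρ),
      PrimeSpectrum.comap (coneRingMap k h'') q =
        PrimeSpectrum.comap (coneRingMap k h) p := by
  subst hρ
  obtain ⟨m, hm0, hm1, hm⟩ := exists_isLocalizationAway (k := k) b h hσ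
  obtain ⟨m', hm0', hm1', hm'⟩ := exists_isLocalizationAway (k := k) b h' hσ
  obtain ⟨n, hn0, hn1, hn⟩ := exists_isLocalizationAway (k := k) b
    h'' hσ
  have r1 := @PrimeSpectrum.localization_away_comap_range _ _ (coneRing k τ) _ (coneRingMap k h).toAlgebra _ hm
  have r2 := @PrimeSpectrum.localization_away_comap_range _ _ (coneRing k τ') _ (coneRingMap k h').toAlgebra _ hm'
  have r3 := @PrimeSpectrum.localization_away_comap_range _ _ (coneRing k _) _ (coneRingMap k _).toAlgebra _ hn
  have e1 : PrimeSpectrum.comap (coneRingMap k h) p ∈ PrimeSpectrum.basicOpen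
      (AddMonoidAlgebra.single m (1 : k) : coneRing k σ) := r1.le ⟨p, rfl⟩
  have e2 : PrimeSpectrum.comap (coneRingMap k h) p ∈ PrimeSpectrum.basicOpen
      (AddMonoidAlgebra.single m' (1 : k) : coneRing k σ) := hp ▸ r2.le ⟨p', rfl⟩
  suffices PrimeSpectrum.comap (coneRingMap k h) p ∈ PrimeSpectrum.basicOpen
      (AddMonoidAlgebra.single n (1 : k) : coneRing k σ) from r3.ge this
  intro hcon
  refine (PrimeSpectrum.comap (coneRingMap k h) p).2.mul_notMem e1 e2 ?_
  have hmem : m.1 + m'.1 - n.1 ∈ dualMonoid σ := fun u hu => by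
    have a1 := m.2 u hu
    have a2 := m'.2 u hu
    simp only [LinearMap.sub_apply, LinearMap.add_apply]
    by_cases h1 : u ∈ τ <;> by_cases h2 : u ∈ τ'
    · rw [hn0 u ⟨h1, h2⟩]; omega
    · rw [hn1 u hu (fun h => h2 h.2), hm1' u hu h2]; omega
    · rw [hn1 u hu (fun h => h1 h.1), hm1 u hu h1]; omega
    · rw [hn1 u hu (fun h => h1 h.1), hm1 u hu h1]; omega
  have : (AddMonoidAlgebra.single m (1 : k) : coneRing k σ) * AddMonoidAlgebra.single m' 1 =
      AddMonoidAlgebra.single ⟨m.1 + m'.1 - n.1, hmem⟩ 1 * AddMonoidAlgebra.single n 1 := by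
    rw [AddMonoidAlgebra.single_mul_single, AddMonoidAlgebra.single_mul_single]
    congr 1
    exact Subtype.ext (sub_add_cancel _ _).symm
  rw [this]
  exact Ideal.mul_mem_left _ _ hcon

end

open Classical in
/-- For a cone `σ` and a ray `ρ` of `σ` generated by `v`, the ring homomorphism `k[S_σ] → k[M]` which
sends `χ^m` to `χ^m` if `⟨m, v⟩ = 0` and to `0` otherwise. Its kernel is the ideal in `U_σ` of the
closure of the codimension one orbit `O(ρ)`. For `σ = ρ` its image is `k[ρ^⊥ ∩ M]`, the coordinate
ring of `O(ρ)`. -/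
noncomputable def orbitHom (k : Type u) [Field k] {N : Type u} [AddCommGroup N] {σ : Set N} {v : N}
    (hv : v ∈ σ) : coneRing k σ →ₐ[k] AddMonoidAlgebra k (Module.Dual ℤ N) :=
  AddMonoidAlgebra.lift k (AddMonoidAlgebra k (Module.Dual ℤ N)) (dualMonoid σ)
    { toFun := fun m => if m.toAdd.1 v = 0 then AddMonoidAlgebra.single m.toAdd.1 1 else 0
      map_one' := by
        rw [if_pos (by exact rfl)]
        rfl
      map_mul' := fun m m' => by
        have h := m.toAdd.2 v hv
        have h' := m'.toAdd.2 v hv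
        have e : (m * m').toAdd.1 v = m.toAdd.1 v + m'.toAdd.1 v := rfl
        rw [e]
        by_cases h1 : m.toAdd.1 v = 0
        · by_cases h2 : m'.toAdd.1 v = 0
          · rw [if_pos (by omega), if_pos h1, if_pos h2, AddMonoidAlgebra.single_mul_single, one_mul]
            rfl
          · rw [if_neg (by omega), if_neg h2, mul_zero]
        · rw [if_neg (by omega), if_neg h1, zero_mul] }

open Classical in
theorem orbitHom_single {k : Type u} [Field k] {N : Type u} [AddCommGroup N] {σ : Set N} {v : N}
    (hv : v ∈ σ) (m : dualMonoid σ) (a : k) :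
    orbitHom k hv (AddMonoidAlgebra.single m a) =
      if m.1 v = 0 then AddMonoidAlgebra.single m.1 a else 0 := by
  rw [orbitHom, AddMonoidAlgebra.lift_single]
  change a • (if m.1 v = 0 then (AddMonoidAlgebra.single m.1 1 :
    AddMonoidAlgebra k (Module.Dual ℤ N)) else 0) = _
  by_cases h : m.1 v = 0
  · rw [if_pos h, if_pos h, AddMonoidAlgebra.smul_single, smul_eq_mul, mul_one]
  · rw [if_neg h, if_neg h, smul_zero]

theorem orbitHom_coeff {k : Type u} [Field k] {N : Type u} [AddCommGroup N] {σ : Set N} {v : N}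
    (hv : v ∈ σ) (f : coneRing k σ) (m : dualMonoid σ) (hm : m.1 v = 0) :
    (orbitHom k hv f).coeff m.1 = f.coeff m := by
  classical
  induction f using AddMonoidAlgebra.induction_linear with
  | zero => simp
  | add x y hx hy => simp [hx, hy]
  | single s r =>
    rw [orbitHom_single]
    by_cases h : s = m
    · subst h
      simp [hm]
    · have h' : s.1 ≠ m.1 := fun e => h (Subtype.ext e)
      by_cases hs : s.1 v = 0
      · simp [hs, AddMonoidAlgebra.coeff_single, h, h']
      · simp [hs, AddMonoidAlgebra.coeff_single, h]

/-- The ideal of a codimension one orbit has height one. -/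
theorem height_ker_orbitHom {k : Type u} [Field k] {N : Type u} [AddCommGroup N]
    {σ : Set N} {v : N} (hv : v ∈ σ) {ι : Type u} (b : Module.Basis ι ℤ N) [Finite ι]
    (hσ : σ ⊆ Set.range b) : (RingHom.ker (orbitHom k hv)).height = 1 := by
  classical
  obtain ⟨i, rfl⟩ := hσ hv
  have : Module.Free ℤ N := .of_basis b
  have := (coneRing_noeth (k := k) b hσ).1
  have hcoord : ∀ j, b.coord i (b j) = if j = i then 1 else 0 := fun j => by
    simp [Finsupp.single_apply]
  let n : dualMonoid σ := ⟨b.coord i, fun u hu => by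
    obtain ⟨j, rfl⟩ := hσ hu
    rw [hcoord]
    split_ifs <;> omega⟩
  let z : coneRing k σ := AddMonoidAlgebra.single n 1
  have hn : n.1 (b i) = 1 := (hcoord i).trans (if_pos rfl)
  have hz : z ∈ RingHom.ker (orbitHom k hv) := by
    rw [RingHom.mem_ker, orbitHom_single, if_neg (by rw [hn]; exact one_ne_zero)]
  have hz0 : z ≠ 0 := by simp [z, AddMonoidAlgebra.single_eq_zero]
  have hdvd : ∀ f ∈ RingHom.ker (orbitHom k hv), z ∣ f := by
    intro f hf
    rw [← AddMonoidAlgebra.sum_coeff_single f]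
    refine Finset.dvd_sum fun m hm => ?_
    have hm0 : m.1 (b i) ≠ 0 := fun h => by
      have := orbitHom_coeff hv f m h
      rw [RingHom.mem_ker] at hf
      rw [hf] at this
      exact (Finsupp.mem_support_iff.mp hm) this.symm
    have hmem : m.1 - n.1 ∈ dualMonoid σ := fun u hu => by
      have h1 := m.2 u hu
      obtain ⟨j, rfl⟩ := hσ hu
      rw [LinearMap.sub_apply]
      have h2 : n.1 (b j) = if j = i then 1 else 0 := hcoord j
      by_cases h3 : j = i
      · subst h3
        rw [h2, if_pos rfl]
        omega
      · rw [h2, if_neg h3]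
        omega
    refine ⟨AddMonoidAlgebra.single ⟨m.1 - n.1, hmem⟩ (f.coeff m), ?_⟩
    rw [AddMonoidAlgebra.single_mul_single, one_mul]
    congr 1
    exact Subtype.ext (add_sub_cancel _ _).symm
  have hprime : (RingHom.ker (orbitHom k hv)).IsPrime := RingHom.ker_isPrime _
  refine le_antisymm ?_ ?_
  · refine Ideal.height_le_one_of_isPrincipal_of_mem_minimalPrimes (Ideal.span {z}) _
      ⟨⟨hprime, (Ideal.span_singleton_le_iff_mem _).mpr hz⟩, fun q hq _ f hf => ?_⟩
    exact q.mem_of_dvd (hdvd f hf) (hq.2 (Ideal.mem_span_singleton_self z))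
  · rw [Order.one_le_iff_ne_zero, Ne, Ideal.height_eq_zero_iff_eq_bot]
    exact fun h => hz0 (by simpa [h] using hz)

namespace SmoothFan

variable {N : Type u} [AddCommGroup N] [Module.Free ℤ N] [Module.Finite ℤ N]

theorem exists_basis (Δ : SmoothFan N) {σ : Finset N} (hσ : σ ∈ Δ.cones) :
    ∃ (ι : Type u) (b : Module.Basis ι ℤ N), Finite ι ∧ (σ : Set N) ⊆ Set.range b := by
  obtain ⟨ι, b, h⟩ := Δ.smooth σ hσ
  exact ⟨ι, b, Module.Finite.finite_basis b, h⟩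

/-- The set of cones of the fan, ordered by inclusion of faces. -/
abbrev Cone (Δ : SmoothFan N) : Type u := {σ : Finset N // σ ∈ Δ.cones}

/-- The affine toric varieties `U_σ = Spec k[S_σ]` and the inclusions `U_τ ⊆ U_σ` for `τ ⊆ σ`. -/
noncomputable def diagram (Δ : SmoothFan N) (k : Type u) [Field k] : Δ.Cone ⥤ Scheme.{u} where
  obj σ := Spec (CommRingCat.of (coneRing k (σ.1 : Set N)))
  map f := Spec.map (CommRingCat.ofHom (coneRingMap k (Finset.coe_subset.mpr (leOfHom f))))
  map_id σ := by
    rw [← Spec.map_id]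
    congr 1
    ext1
    exact AddMonoidAlgebra.mapDomainRingHom_id
  map_comp f g := by
    rw [← Spec.map_comp]
    congr 1
    ext1
    exact (coneRingMap_comp (k := k) (Finset.coe_subset.mpr (leOfHom g))
      (Finset.coe_subset.mpr (leOfHom f))).symm

instance (Δ : SmoothFan N) (k : Type u) [Field k] {σ τ : Δ.Cone} (f : σ ⟶ τ) :
    IsOpenImmersion ((Δ.diagram k).map f) := by
  obtain ⟨ι, b, _, h⟩ := Δ.exists_basis τ.2
  exact isOpenImmersion_coneRingMap b _ h

instance (Δ : SmoothFan N) (k : Type u) [Field k] :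
    (Δ.diagram k ⋙ Scheme.forget).IsLocallyDirected where
  cond := by
    classical
    intro σ τ κ f g x y h
    obtain ⟨ι, b, _, hκ⟩ := Δ.exists_basis κ.2
    let ρ : Δ.Cone := ⟨σ.1 ∩ τ.1, Δ.face_mem _ σ.2 _ Finset.inter_subset_left⟩
    let fl : ρ ⟶ σ := homOfLE (Finset.inter_subset_left : σ.1 ∩ τ.1 ⊆ σ.1)
    let gl : ρ ⟶ τ := homOfLE (Finset.inter_subset_right : σ.1 ∩ τ.1 ⊆ τ.1)
    obtain ⟨z, hz⟩ : ∃ z : (Δ.diagram k).obj ρ,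
        (Δ.diagram k).map (fl ≫ f) z = (Δ.diagram k).map f x :=
      exists_comap_eq b (Finset.coe_inter _ _) (Finset.coe_subset.mpr (leOfHom (fl ≫ f)))
        (Finset.coe_subset.mpr (leOfHom f)) (Finset.coe_subset.mpr (leOfHom g)) hκ x y h
    have hz' : (Δ.diagram k).map (gl ≫ g) z = (Δ.diagram k).map g y :=
      (congrArg (fun i => (Δ.diagram k).map i z) (Subsingleton.elim _ _)).trans (hz.trans h)
    refine ⟨ρ, fl, gl, z, ?_, ?_⟩
    · apply ((Δ.diagram k).map f).isOpenEmbedding.injective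
      rw [← hz, Functor.map_comp]
      rfl
    · apply ((Δ.diagram k).map g).isOpenEmbedding.injective
      rw [← hz', Functor.map_comp]
      rfl

/-- The toric variety `X_Δ` of the fan: the gluing of the affine schemes `U_σ`, `σ ∈ Δ`, along the
open subschemes `U_{σ ∩ τ}`, that is, the colimit of the diagram of the `U_σ`. -/
noncomputable def toricVariety (Δ : SmoothFan N) (k : Type u) [Field k] : Scheme.{u} :=
  colimit (Δ.diagram k)

/-- The open immersion `U_σ → X_Δ`. -/
noncomputable def chart (Δ : SmoothFan N) (k : Type u) [Field k] (σ : Δ.Cone) :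
    (Δ.diagram k).obj σ ⟶ Δ.toricVariety k :=
  colimit.ι (Δ.diagram k) σ

instance (Δ : SmoothFan N) (k : Type u) [Field k] (σ : Δ.Cone) : IsOpenImmersion (Δ.chart k σ) :=
  inferInstanceAs (IsOpenImmersion (colimit.ι (Δ.diagram k) σ))

theorem exists_chart (Δ : SmoothFan N) (k : Type u) [Field k] (x : Δ.toricVariety k) :
    ∃ σ y, Δ.chart k σ y = x := Scheme.IsLocallyDirected.ι_jointly_surjective _ x

instance (Δ : SmoothFan N) (k : Type u) [Field k] (σ : Δ.Cone) :
    IsIntegral ((Δ.diagram k).obj σ) :=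
  inferInstanceAs (IsIntegral (Spec (CommRingCat.of (coneRing k (σ.1 : Set N)))))

instance (Δ : SmoothFan N) (k : Type u) [Field k] : IsLocallyNoetherian (Δ.toricVariety k) := by
  refine (isLocallyNoetherian_iff_openCover (Scheme.IsLocallyDirected.openCover (Δ.diagram k))).mpr
    fun σ => ?_
  obtain ⟨ι, b, _, h⟩ := Δ.exists_basis σ.2
  have := (coneRing_noeth (k := k) b h).1
  exact inferInstanceAs (IsLocallyNoetherian (Spec (CommRingCat.of (coneRing k (σ.1 : Set N)))))

instance (Δ : SmoothFan N) (k : Type u) [Field k] : IsIntegral (Δ.toricVariety k) := by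
  have hred : IsReduced (Δ.toricVariety k) := by
    have : ∀ σ, IsReduced ((Scheme.IsLocallyDirected.openCover (Δ.diagram k)).X σ) := fun (σ : Δ.Cone) =>
      @isReduced_of_isIntegral _ (inferInstanceAs (IsIntegral ((Δ.diagram k).obj σ)))
    exact IsReduced.of_openCover _ (Scheme.IsLocallyDirected.openCover (Δ.diagram k))
  let o : Δ.Cone := ⟨∅, Δ.empty_mem⟩
  let η : Δ.toricVariety k := Δ.chart k o (genericPoint _)
  have hη : ∀ x, η ⤳ x := fun x => by
    obtain ⟨σ, y, rfl⟩ := Δ.exists_chart k x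
    let i : o ⟶ σ := homOfLE (Finset.empty_subset σ.1)
    have e : η = Δ.chart k σ ((Δ.diagram k).map i (genericPoint ((Δ.diagram k).obj o))) := by
      rw [← Scheme.Hom.comp_apply]
      exact congrArg (fun f : (Δ.diagram k).obj o ⟶ Δ.toricVariety k => f (genericPoint _))
        (colimit.w (Δ.diagram k) i).symm
    rw [e, genericPoint_eq_of_isOpenImmersion ((Δ.diagram k).map i)]
    exact (genericPoint_specializes y).map (Δ.chart k σ).continuous
  have : IrreducibleSpace (Δ.toricVariety k) := by
    have h : IsGenericPoint η Set.univ := isGenericPoint_iff_specializes.mpr fun x => by simp [hη]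
    exact (irreducibleSpace_def _).mpr h.isIrreducible
  exact isIntegral_of_irreducibleSpace_of_isReduced _

instance (Δ : SmoothFan N) (k : Type u) [Field k] : RegularInCodimOne (Δ.toricVariety k) where
  isDVR x hx := by
    obtain ⟨σ, y, rfl⟩ := Δ.exists_chart k x
    obtain ⟨ι, b, _, h⟩ := Δ.exists_basis σ.2
    obtain ⟨h1, h2⟩ := coneRing_noeth (k := k) b h
    let R := CommRingCat.of (coneRing k (σ.1 : Set N))
    let z : Spec R := y
    have hp : z.asIdeal.IsPrime := PrimeSpectrum.isPrime (R := coneRing k (σ.1 : Set N)) y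
    let A := (Spec R).presheaf.stalk z
    have hz : ringKrullDim A = 1 := by
      rw [ringKrullDim_stalk_eq_coheight z]
      have := coheight_eq_of_isOpenImmersion (x := y) (Δ.chart k σ)
      exact congrArg _ (this.symm.trans hx)
    let : Algebra R A := StructureSheaf.stalkAlgebra R z
    have : IsLocalization.AtPrime A z.asIdeal := StructureSheaf.IsLocalization.to_stalk R z
    have hIC : IsIntegrallyClosed R := h2
    have hN : IsNoetherianRing R := h1
    have hA : IsIntegrallyClosed A := isIntegrallyClosed_of_isLocalization _ z.asIdeal.primeCompl
      (Ideal.primeCompl_le_nonZeroDivisors _)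
    have hAN : IsNoetherianRing A := IsLocalization.isNoetherianRing z.asIdeal.primeCompl A hN
    have hfield : ¬ IsField A := fun hf => by
      rw [ringKrullDim_eq_zero_of_isField hf] at hz
      exact zero_ne_one hz
    have hdim : Ring.KrullDimLE 1 A := Ring.krullDimLE_iff.mpr (by rw [hz]; rfl)
    have hmax := Ring.krullDimLE_one_iff_of_noZeroDivisors.mp hdim
    have key : IsIntegrallyClosed A ∧ ∃! P : Ideal A, P ≠ ⊥ ∧ P.IsPrime :=
      ⟨hA, IsLocalRing.maximalIdeal A,
        ⟨IsLocalRing.isField_iff_maximalIdeal_eq.not.mp hfield, inferInstance⟩,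
        fun P hP => IsLocalRing.eq_maximalIdeal (hmax P hP.1 hP.2)⟩
    have hdvr : IsDiscreteValuationRing A :=
      ((IsDiscreteValuationRing.TFAE A hfield).out 0 3).mpr key
    have : IsDiscreteValuationRing (((Δ.diagram k).obj σ).presheaf.stalk y) := hdvr
    exact IsDiscreteValuationRing.RingEquivClass.isDiscreteValuationRing
      (asIso ((Δ.chart k σ).stalkMap y)).commRingCatIsoToRingEquiv.symm

/-- The rays of the fan, each given by its primitive generator `u_ρ`. -/
abbrev Ray (Δ : SmoothFan N) : Type u := {v : N // {v} ∈ Δ.cones}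

noncomputable instance (Δ : SmoothFan N) : Fintype Δ.Ray :=
  Fintype.ofInjective (fun ρ : Δ.Ray => (⟨{ρ.1}, ρ.2⟩ : Δ.cones)) fun _ _ h =>
    Subtype.ext (Finset.singleton_injective (congrArg Subtype.val h))

/-- The cone of a ray. -/
def rayCone (Δ : SmoothFan N) (ρ : Δ.Ray) : Δ.Cone := ⟨{ρ.1}, ρ.2⟩

/-- The generic point of the codimension one orbit `O(ρ)` in the affine toric variety `U_ρ`. -/
noncomputable def orbitPoint (Δ : SmoothFan N) (k : Type u) [Field k] (ρ : Δ.Ray) :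
    Spec (CommRingCat.of (coneRing k ((Δ.rayCone ρ).1 : Set N))) :=
  (⟨RingHom.ker (orbitHom k (Finset.mem_coe.mpr (Finset.mem_singleton_self ρ.1))),
    RingHom.ker_isPrime _⟩ : PrimeSpectrum (coneRing k ((Δ.rayCone ρ).1 : Set N)))

/-- The torus-invariant prime divisor `D_ρ`, the closure of the orbit `O(ρ)`, given by its generic
point. -/
noncomputable def primeDivisor (Δ : SmoothFan N) (k : Type u) [Field k] (ρ : Δ.Ray) :
    {x : Δ.toricVariety k // Order.coheight x = 1} :=
  ⟨Δ.chart k (Δ.rayCone ρ) (Δ.orbitPoint k ρ), by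
    obtain ⟨ι, b, _, h⟩ := Δ.exists_basis ρ.2
    have h1 := coheight_eq_of_isOpenImmersion (U := (Δ.diagram k).obj (Δ.rayCone ρ))
      (x := Δ.orbitPoint k ρ) (Δ.chart k (Δ.rayCone ρ))
    have h2 := idealHeight_eq_coheight _ (Δ.orbitPoint k ρ)
    exact h1.trans (h2.symm.trans (height_ker_orbitHom _ b h))⟩

/-- The torus-invariant divisor `∑ a_ρ D_ρ`. -/
noncomputable def toricDivisor (Δ : SmoothFan N) (k : Type u) [Field k] (a : Δ.Ray → ℤ) :
    WeilDivisor (Δ.toricVariety k) :=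
  ∑ ρ, Finsupp.single (Δ.primeDivisor k ρ) (a ρ)

/-- The toric Frobenius morphism `F_ℓ : X_Δ → X_Δ` over `k`, induced by multiplication by `ℓ` on the
lattice: on each chart `U_σ` it is given by the `k`-algebra map `χ^m ↦ χ^{ℓ m}` of `k[S_σ]`. -/
noncomputable def toricFrobenius (Δ : SmoothFan N) (k : Type u) [Field k] (ℓ : ℕ) :
    Δ.toricVariety k ⟶ Δ.toricVariety k :=
  colimMap
    { app := fun σ => Spec.map (CommRingCat.ofHom
        (AddMonoidAlgebra.mapDomainRingHom k (nsmulAddMonoidHom (α := dualMonoid (σ.1 : Set N)) ℓ)))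
      naturality := fun σ τ f => by
        change Spec.map _ ≫ Spec.map _ = Spec.map _ ≫ Spec.map _
        rw [← Spec.map_comp, ← Spec.map_comp, ← CommRingCat.ofHom_comp, ← CommRingCat.ofHom_comp]
        congr 2
        apply AddMonoidAlgebra.ringHom_ext
        · intro r
          simp [coneRingMap]
        · intro m
          simp [coneRingMap] }

/-- The fan has no torus factor: its rays span `N_ℝ`. -/
def NoTorusFactor (Δ : SmoothFan N) : Prop :=
  Submodule.span ℝ (Set.range fun ρ : Δ.Ray => (1 : ℝ) ⊗ₜ[ℤ] ρ.1) = ⊤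

/-- The number `μ(E, D)` of torus-invariant divisors which are linearly equivalent to `D - ℓ E` and
have all coefficients in `{0, …, ℓ - 1}`. -/
noncomputable def multiplicity (Δ : SmoothFan N) (k : Type u) [Field k] (ℓ : ℕ)
    (E D : WeilDivisor (Δ.toricVariety k)) : ℕ :=
  Set.ncard {T : WeilDivisor (Δ.toricVariety k) |
    (∃ c : Δ.Ray → ℤ, (∀ ρ, 0 ≤ c ρ ∧ c ρ < ℓ) ∧ T = Δ.toricDivisor k c) ∧
      T.LinEquiv (D - ℓ • E)}

end SmoothFan

/-! The argument takes place in the function field `K` of `X`. Sections of `𝒪(D)` are elements of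
`K` with bounds on their orders at codimension one points, and the Frobenius induces an endomorphism
`φ` of `K` with `χ^m ↦ χ^(ℓm)`. Sorting exponents by their class modulo `ℓM` shows that `k[M]` is
free over its image under `φ` with basis `χ^(-s_c)`, `c ∈ M/ℓM`. Since `k[M]` is integrally closed,
the basis passes to fractions: every `f ∈ K` is uniquely `∑ φ(P_c f) χ^(-s_c)`
(`exists_frobenius_coordinates`). The decomposition of the pushforward is this one, once it is seen
to respect orders.

Let `D = ∑ a_ρ D_ρ` and `E = ∑ e_ρ D_ρ`. On the chart of a smooth cone there are characters `n`,
`n'` taking the values `a_ρ`, `e_ρ` at the generators, so `D` and `E` have the local equations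
`χ^n`, `χ^n'`. The chart rings are factorial, and a rational function without poles in codimension
one is therefore regular; order conditions become membership in `k[S_σ]`, which is checked on
monomials. One finds that `g ↦ χ^(-s) φ(g)` maps `𝒪(E)` into the pushforward of `𝒪(D)` if `ℓe ≤ a -
s` on rays (`character_mul_frobField_ord_ge`), and that the coordinate map goes back if `a - s < ℓe
+ ℓ` (`coordinate_ord_ge`). The floor of `(a - s)/ℓ` satisfies both, and the two families of maps
form a biproduct (`nonempty_pushforward_iso_sigma`). This is the third formula.

An arbitrary divisor is linearly equivalent to a torus-invariant one, because the coordinate ring of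
the torus is factorial (`exists_linEquiv_toricDivisor`). This gives the existence of a splitting,
and that all `𝒪(E)` are line bundles.

For the formula with multiplicities, write `a - s_c = T_c + ℓ E_c` by division with remainder. Then
`c ↦ ([E_c], T_c)` is a bijection from `M/ℓM` to the set counted by the multiplicities
(`NoTorusFactor.exists_equiv`). It rests on the fact that a principal torus-invariant divisor is the
divisor of a character, which holds because the units of `k[M]` are monomials. Spanning rays make
this character unique, hence the map injective. -/

namespace AlgebraicGeometry.Scheme

/-! ### Pullback of rational functions along dominant morphisms -/

section FunctionFieldMap

variable {X Y Z : Scheme.{u}} [IsIntegral X] [IsIntegral Y] [IsIntegral Z]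

/-- The map on function fields induced by a dominant morphism of integral schemes. -/
noncomputable def Hom.functionFieldMap (f : Y ⟶ X) (hf : f (genericPoint Y) = genericPoint X) :
    X.functionField →+* Y.functionField :=
  CommRingCat.Hom.hom (R := X.presheaf.stalk (genericPoint X))
    (S := Y.presheaf.stalk (genericPoint Y))
    (X.presheaf.stalkSpecializes (specializes_of_eq hf) ≫ f.stalkMap (genericPoint Y))

theorem Hom.functionFieldMap_germ (f : Y ⟶ X) (hf : f (genericPoint Y) = genericPoint X)
    (U : X.Opens) (hU : genericPoint X ∈ U) (hU' : genericPoint Y ∈ f ⁻¹ᵁ U) (s : Γ(X, U)) :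
    f.functionFieldMap hf (X.presheaf.germ U _ hU s) =
      Y.presheaf.germ (f ⁻¹ᵁ U) _ hU' (f.app U s) := by
  have h := X.presheaf.germ_stalkSpecializes_apply (U := U) (x := f (genericPoint Y))
    hU (specializes_of_eq hf) s
  have h' := f.germ_stalkMap_apply U (genericPoint Y) (hf ▸ hU) s
  rw [← h']
  exact congrArg (f.stalkMap (genericPoint Y)) h

theorem Hom.functionFieldMap_germToFunctionField (f : Y ⟶ X)
    (hf : f (genericPoint Y) = genericPoint X) (U : X.Opens) [Nonempty U] [Nonempty (f ⁻¹ᵁ U)]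
    (s : Γ(X, U)) :
    f.functionFieldMap hf (X.germToFunctionField U s) =
      Y.germToFunctionField (f ⁻¹ᵁ U) (f.app U s) :=
  f.functionFieldMap_germ hf U _ _ s

theorem Hom.functionFieldMap_comp (f : Y ⟶ X) (hf : f (genericPoint Y) = genericPoint X)
    (g : Z ⟶ Y) (hg : g (genericPoint Z) = genericPoint Y)
    (h : (g ≫ f) (genericPoint Z) = genericPoint X) (a : X.functionField) :
    (g ≫ f).functionFieldMap h a = g.functionFieldMap hg (f.functionFieldMap hf a) := by
  obtain ⟨U, hU, s, rfl⟩ := X.presheaf.exists_germ_eq a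
  have hU' : genericPoint Y ∈ f ⁻¹ᵁ U := by change f _ ∈ U; rwa [hf]
  have hU'' : genericPoint Z ∈ g ⁻¹ᵁ (f ⁻¹ᵁ U) := by change g _ ∈ f ⁻¹ᵁ U; rwa [hg]
  rw [Hom.functionFieldMap_germ f hf U hU hU', Hom.functionFieldMap_germ g hg _ hU' hU'',
    Hom.functionFieldMap_germ (g ≫ f) h U hU hU'']
  simp
  rfl

theorem Hom.functionFieldMap_congr {f g : Y ⟶ X} (e : f = g)
    (hf : f (genericPoint Y) = genericPoint X) (hg : g (genericPoint Y) = genericPoint X)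
    (a : X.functionField) :
    f.functionFieldMap hf a = g.functionFieldMap hg a := by
  subst e; rfl

/-- Naturality of the passage from stalks to function fields; checked on germs of sections, where
both sides are the germ of the pulled back section. -/
theorem Hom.functionFieldMap_algebraMap_stalk (f : Y ⟶ X)
    (hf : f (genericPoint Y) = genericPoint X) (y : Y) (t : X.presheaf.stalk (f y)) :
    f.functionFieldMap hf (algebraMap _ X.functionField t) =
      algebraMap _ Y.functionField (f.stalkMap y t) := by
  obtain ⟨U, hU, s, rfl⟩ := X.presheaf.exists_germ_eq t
  have : Nonempty U := ⟨⟨_, hU⟩⟩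
  have : Nonempty (f ⁻¹ᵁ U) := ⟨⟨y, hU⟩⟩
  rw [algebraMap_germ_eq_germToFunctionField X hU, functionFieldMap_germToFunctionField,
    f.germ_stalkMap_apply U y hU s]
  exact (algebraMap_germ_eq_germToFunctionField Y hU (f.app U s)).symm

theorem Hom.functionFieldMap_bijective (f : Y ⟶ X) [IsOpenImmersion f]
    (hf : f (genericPoint Y) = genericPoint X) :
    Function.Bijective (f.functionFieldMap hf) := by
  have h1 : IsIso (X.presheaf.stalkSpecializes (specializes_of_eq hf) ≫
    f.stalkMap (genericPoint Y)) := by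
    have : IsIso (X.presheaf.stalkSpecializes (specializes_of_eq hf)) :=
      (X.presheaf.stalkCongr (Inseparable.of_eq hf.symm)).isIso_hom
    infer_instance
  exact ConcreteCategory.bijective_of_isIso (X.presheaf.stalkSpecializes (specializes_of_eq hf) ≫
    f.stalkMap (genericPoint Y))

end FunctionFieldMap

/-! ### Local rings and function field of an affine scheme -/

section SpecToStalk

variable (R : CommRingCat.{u})

/-- The localization map from a ring to the local rings of its spectrum. -/
noncomputable def specToStalk (y : Spec R) : R ⟶ (Spec R).presheaf.stalk y :=
  StructureSheaf.toStalk R y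

variable {R}

theorem specToStalk_stalkMap {S : CommRingCat.{u}} (φ : R ⟶ S) (y : Spec S) :
    specToStalk R (Spec.map φ y) ≫ (Spec.map φ).stalkMap y = φ ≫ specToStalk S y :=
  stalkMap_toStalk φ y

theorem specToStalk_stalkSpecializes {x y : Spec R} (h : x ⤳ y) :
    specToStalk R y ≫ (Spec R).presheaf.stalkSpecializes h = specToStalk R x :=
  StructureSheaf.toStalk_stalkSpecializes h

theorem isLocalization_specToStalk (y : Spec R) :
    @IsLocalization.AtPrime R _ ((Spec R).presheaf.stalk y) _ (specToStalk R y).hom.toAlgebra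
      y.asIdeal (PrimeSpectrum.isPrime y) :=
  StructureSheaf.IsLocalization.to_stalk R y

theorem isUnit_specToStalk_iff (y : Spec R) (a : R) :
    IsUnit (specToStalk R y a) ↔ a ∉ y.asIdeal := by
  have := PrimeSpectrum.isPrime y
  let := (specToStalk R y).hom.toAlgebra
  have := isLocalization_specToStalk y
  exact IsLocalization.AtPrime.isUnit_to_map_iff ((Spec R).presheaf.stalk y) y.asIdeal a

theorem exists_specToStalk_mul_eq (y : Spec R) (t : (Spec R).presheaf.stalk y) :
    ∃ a b : R, b ∉ y.asIdeal ∧ specToStalk R y b * t = specToStalk R y a := by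
  have := PrimeSpectrum.isPrime y
  let := (specToStalk R y).hom.toAlgebra
  have := isLocalization_specToStalk y
  obtain ⟨⟨a, b⟩, h⟩ := IsLocalization.surj y.asIdeal.primeCompl t
  exact ⟨a, b, b.2, (mul_comm _ _).trans h⟩

/-- The embedding of a domain into the function field of its spectrum. -/
noncomputable def specToFunctionField [IsDomain R] : R →+* (Spec R).functionField :=
  CommRingCat.Hom.hom (R := R) (S := (Spec R).presheaf.stalk (genericPoint (Spec R)))
    (specToStalk R (genericPoint (Spec R)))

theorem algebraMap_specToStalk [IsDomain R] (y : Spec R) (a : R) :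
    algebraMap _ (Spec R).functionField (specToStalk R y a) = specToFunctionField a :=
  congrArg (fun φ : R ⟶ (Spec R).presheaf.stalk (genericPoint (Spec R)) => φ a)
    (specToStalk_stalkSpecializes ((genericPoint_spec (Spec R)).specializes trivial))

theorem specToFunctionField_injective [IsDomain R] :
    Function.Injective (specToFunctionField (R := R)) :=
  IsFractionRing.injective R (Spec R).functionField

theorem functionFieldMap_specToFunctionField {S : CommRingCat.{u}} [IsDomain R] [IsDomain S]
    (φ : R ⟶ S) (h : Spec.map φ (genericPoint (Spec S)) = genericPoint (Spec R)) (a : R) :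
    (Spec.map φ).functionFieldMap h (specToFunctionField a) = specToFunctionField (φ a) := by
  rw [← algebraMap_specToStalk (Spec.map φ (genericPoint (Spec S))) a,
    Hom.functionFieldMap_algebraMap_stalk, ← algebraMap_specToStalk (genericPoint (Spec S))]
  congr 1
  exact congrArg (fun ψ : R ⟶ (Spec S).presheaf.stalk (genericPoint (Spec S)) => ψ a)
    (specToStalk_stalkMap φ (genericPoint (Spec S)))

end SpecToStalk

/-! ### Coordinate rings of affine charts inside the function field -/

section AffineChart

variable {X : Scheme.{u}} {R : CommRingCat.{u}} (f : Spec R ⟶ X) [IsOpenImmersion f]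

/-- The ring of an affine open chart maps to the local rings at the points of the chart. -/
noncomputable def Hom.chartToStalk (y : Spec R) : R →+* X.presheaf.stalk (f y) :=
  (specToStalk R y ≫ inv (f.stalkMap y)).hom

theorem Hom.stalkMap_chartToStalk (y : Spec R) (a : R) :
    f.stalkMap y (f.chartToStalk y a) = specToStalk R y a := by
  have : (specToStalk R y ≫ inv (f.stalkMap y)) ≫ f.stalkMap y = specToStalk R y := by simp
  exact congrArg (fun φ : R ⟶ (Spec R).presheaf.stalk y => φ a) this

theorem Hom.isUnit_chartToStalk_iff (y : Spec R) (a : R) :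
    IsUnit (f.chartToStalk y a) ↔ a ∉ y.asIdeal := by
  rw [← isUnit_specToStalk_iff, ← stalkMap_chartToStalk f]
  exact (isUnit_map_iff (f.stalkMap y).hom _).symm

theorem Hom.exists_chartToStalk_mul_eq (y : Spec R) (t : X.presheaf.stalk (f y)) :
    ∃ a b : R, b ∉ y.asIdeal ∧ f.chartToStalk y b * t = f.chartToStalk y a := by
  obtain ⟨a, b, hb, h⟩ := exists_specToStalk_mul_eq y (f.stalkMap y t)
  refine ⟨a, b, hb, (ConcreteCategory.bijective_of_isIso (f.stalkMap y)).1 ?_⟩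
  rw [map_mul, stalkMap_chartToStalk, stalkMap_chartToStalk, h]

variable [IsIntegral X] [IsDomain R]

/-- The ring of an affine open chart, embedded into the function field. -/
noncomputable def Hom.chartEmbedding : R →+* X.functionField :=
  ((RingEquiv.ofBijective _ (f.functionFieldMap_bijective
    (genericPoint_eq_of_isOpenImmersion f))).symm : _ →+* X.functionField).comp
    specToFunctionField

theorem Hom.functionFieldMap_chartEmbedding (a : R)
    (hf : f (genericPoint _) = genericPoint X) :
    f.functionFieldMap hf (f.chartEmbedding a) = specToFunctionField a :=
  (RingEquiv.ofBijective _ (f.functionFieldMap_bijective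
    (genericPoint_eq_of_isOpenImmersion f))).apply_symm_apply _

theorem Hom.algebraMap_chartToStalk (y : Spec R) (a : R) :
    algebraMap _ X.functionField (f.chartToStalk y a) = f.chartEmbedding a := by
  have hf := genericPoint_eq_of_isOpenImmersion f
  apply (f.functionFieldMap_bijective hf).1
  rw [functionFieldMap_chartEmbedding, functionFieldMap_algebraMap_stalk, stalkMap_chartToStalk,
    algebraMap_specToStalk]

theorem Hom.chartEmbedding_injective : Function.Injective f.chartEmbedding :=
  (RingEquiv.ofBijective _ (f.functionFieldMap_bijective
    (genericPoint_eq_of_isOpenImmersion f))).symm.injective.comp specToFunctionField_injective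

theorem Hom.exists_chartEmbedding_mul_eq (g : X.functionField) :
    ∃ a b : R, b ≠ 0 ∧ f.chartEmbedding b * g = f.chartEmbedding a := by
  have hf := genericPoint_eq_of_isOpenImmersion f
  obtain ⟨⟨a, b⟩, h⟩ := IsLocalization.surj (nonZeroDivisors R) (f.functionFieldMap hf g)
  refine ⟨a, b, nonZeroDivisors.ne_zero b.2, (f.functionFieldMap_bijective hf).1 ?_⟩
  rw [map_mul, functionFieldMap_chartEmbedding, functionFieldMap_chartEmbedding, mul_comm]
  exact h

end AffineChart

end AlgebraicGeometry.Scheme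

/-! ### Orders of vanishing on affine charts -/

namespace AlgebraicGeometry.Scheme

theorem ord_one {X : Scheme.{u}} [IsIntegral X] [IsLocallyNoetherian X] (x : X) :
    ord (1 : X.functionField) x = 0 := by
  have h := ord_mul (x := x) (one_ne_zero (α := X.functionField)) one_ne_zero
  rw [mul_one] at h
  omega

theorem ord_inv {X : Scheme.{u}} [IsIntegral X] [IsLocallyNoetherian X] (x : X)
    (f : X.functionField) : ord f⁻¹ x = - ord f x := by
  by_cases hf : f = 0
  · simp [hf]
  have h := ord_mul (x := x) hf (inv_ne_zero hf)
  rw [mul_inv_cancel₀ hf, ord_one] at h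
  omega

theorem ord_pow {X : Scheme.{u}} [IsIntegral X] [IsLocallyNoetherian X] (x : X)
    {f : X.functionField} (hf : f ≠ 0) (n : ℕ) : ord (f ^ n) x = n * ord f x := by
  induction n with
  | zero => simp [ord_one]
  | succ n ih =>
    rw [pow_succ, ord_mul (pow_ne_zero n hf) hf, ih]
    push_cast
    ring

theorem ord_zpow {X : Scheme.{u}} [IsIntegral X] [IsLocallyNoetherian X] (x : X)
    {f : X.functionField} (hf : f ≠ 0) (n : ℤ) : ord (f ^ n) x = n * ord f x := by
  obtain ⟨n, rfl | rfl⟩ := n.eq_nat_or_neg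
  · rw [zpow_natCast, ord_pow x hf]
  · rw [zpow_neg, zpow_natCast, ord_inv, ord_pow x hf]
    ring

theorem ord_prod {X : Scheme.{u}} [IsIntegral X] [IsLocallyNoetherian X] (x : X)
    {ι : Type*} (s : Finset ι) (f : ι → X.functionField) (hf : ∀ i ∈ s, f i ≠ 0) :
    ord (∏ i ∈ s, f i) x = ∑ i ∈ s, ord (f i) x := by
  classical
  induction s using Finset.induction_on with
  | empty => simp [ord_one]
  | insert i s hi ih =>
    rw [Finset.prod_insert hi, Finset.sum_insert hi, ord_mul (hf i (Finset.mem_insert_self _ _))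
      (Finset.prod_ne_zero_iff.mpr fun j hj => hf j (Finset.mem_insert_of_mem hj)),
      ih fun j hj => hf j (Finset.mem_insert_of_mem hj)]

theorem coheight_chart {X : Scheme.{u}} {R : CommRingCat.{u}} (f : Spec R ⟶ X)
    [IsOpenImmersion f] (y : Spec R) : Order.coheight (f y) = y.asIdeal.height :=
  (coheight_eq_of_isOpenImmersion f).trans (idealHeight_eq_coheight R y).symm

/-- Krull's principal ideal theorem bounds the height above, and the ideal is nonzero in a domain.
-/
theorem height_span_singleton_prime {R : Type*} [CommRing R] [IsDomain R]
    [IsNoetherianRing R] {p : R} (hp : Prime p) :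
    (Ideal.span {p}).height = 1 := by
  have hP : (Ideal.span {p}).IsPrime := (Ideal.span_singleton_prime hp.ne_zero).mpr hp
  refine le_antisymm ?_ ?_
  · exact Ideal.height_le_one_of_isPrincipal_of_mem_minimalPrimes (Ideal.span {p}) _
      ⟨⟨hP, le_rfl⟩, fun q hq _ => hq.2⟩
  · rw [Order.one_le_iff_ne_zero, Ne, Ideal.height_eq_zero_iff_eq_bot]
    exact fun h => hp.ne_zero (by simpa using h)

section

variable {X : Scheme.{u}} [IsIntegral X] [IsLocallyNoetherian X] [RegularInCodimOne X]
  {R : CommRingCat.{u}} [IsDomain R] (f : Spec R ⟶ X) [IsOpenImmersion f]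

theorem ord_chartEmbedding_nonneg (y : Spec R) {a : R} (ha : a ≠ 0) :
    0 ≤ ord (f.chartEmbedding a) (f y) := by
  by_cases hy : Order.coheight (f y) = 1
  · have h0 : f.chartEmbedding a ≠ 0 := (map_ne_zero_iff _ f.chartEmbedding_injective).mpr ha
    have := RegularInCodimOne.isDVR _ hy
    rw [le_ord_iff hy h0, ← f.algebraMap_chartToStalk y a]
    refine Ring.ordFrac_ge_one_of_ne_zero fun h => h0 ?_
    rw [← f.algebraMap_chartToStalk y a, h, map_zero]
  · rw [ord_eq_zero_of_coheight_neq_one hy]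

theorem ord_chartEmbedding_eq_zero_iff (y : Spec R) (hy : Order.coheight (f y) = 1) {a : R}
    (ha : a ≠ 0) : ord (f.chartEmbedding a) (f y) = 0 ↔ a ∉ y.asIdeal := by
  have h0 : f.chartEmbedding a ≠ 0 := (map_ne_zero_iff _ f.chartEmbedding_injective).mpr ha
  have := RegularInCodimOne.isDVR _ hy
  rw [ord_eq_iff hy h0, ← f.algebraMap_chartToStalk y a, ← f.isUnit_chartToStalk_iff]
  exact (Ring.isUnit_iff_ordFrac_one_of_isDiscreteValuationRing).symm

/-- Elements outside the prime become units in the local ring, so a generator of the prime also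
generates the maximal ideal and is a uniformizer. -/
theorem ord_chartEmbedding_eq_one (y : Spec R) (hy : Order.coheight (f y) = 1) {p : R}
    (hp0 : p ≠ 0) (hp : y.asIdeal = Ideal.span {p}) : ord (f.chartEmbedding p) (f y) = 1 := by
  have h0 : f.chartEmbedding p ≠ 0 := (map_ne_zero_iff _ f.chartEmbedding_injective).mpr hp0
  have := RegularInCodimOne.isDVR _ hy
  rw [ord_eq_iff hy h0, ← f.algebraMap_chartToStalk y p]
  refine Ring.ordFrac_irreducible ((IsDiscreteValuationRing.irreducible_iff_uniformizer _).mpr ?_)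
  refine le_antisymm (fun t ht => ?_) ?_
  · obtain ⟨a, b, hb, h⟩ := f.exists_chartToStalk_mul_eq y t
    have hbu := (f.isUnit_chartToStalk_iff y b).mpr hb
    have ha : a ∈ y.asIdeal := by
      by_contra ha
      have hau := (f.isUnit_chartToStalk_iff y a).mpr ha
      rw [← h] at hau
      exact (IsLocalRing.mem_maximalIdeal _).mp ht (isUnit_of_mul_isUnit_right hau)
    rw [hp, Ideal.mem_span_singleton] at ha
    rw [Ideal.mem_span_singleton, ← hbu.dvd_mul_left, h]
    exact map_dvd _ ha
  · rw [Ideal.span_singleton_le_iff_mem, IsLocalRing.mem_maximalIdeal, mem_nonunits_iff,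
      f.isUnit_chartToStalk_iff, not_not, hp]
    exact Ideal.mem_span_singleton_self p

/-- Algebraic Hartogs: on a factorial affine chart, a rational function without poles in codimension
one through a point is regular at the point. -/
theorem exists_chartEmbedding_mul_eq_of_ord_nonneg [UniqueFactorizationMonoid R]
    [IsNoetherianRing R] (y : Spec R) (g : X.functionField)
    (hg : ∀ z : Spec R, z.asIdeal ≤ y.asIdeal → Order.coheight (f z) = 1 → 0 ≤ ord g (f z)) :
    ∃ a b : R, b ∉ y.asIdeal ∧ f.chartEmbedding b * g = f.chartEmbedding a := by
  have hy := PrimeSpectrum.isPrime y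
  by_cases hg0 : g = 0
  · exact ⟨0, 1, (Ideal.ne_top_iff_one _).mp hy.ne_top, by simp [hg0]⟩
  obtain ⟨a', b', hb', h'⟩ := f.exists_chartEmbedding_mul_eq g
  -- In lowest terms `g = a/b`, the denominator cannot vanish at `y`: a prime factor `p` of `b`
  -- through `y` would define a codimension one point at which `b` vanishes and `a` does not, hence
  -- a pole of `g`.
  obtain ⟨a, b, c, hab, rfl, rfl⟩ := UniqueFactorizationMonoid.exists_reduced_factors' a' b' hb'
  have hc : c ≠ 0 := left_ne_zero_of_mul hb'
  have hb : b ≠ 0 := right_ne_zero_of_mul hb'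
  have h : f.chartEmbedding b * g = f.chartEmbedding a := by
    have hc' : f.chartEmbedding c ≠ 0 := (map_ne_zero_iff _ f.chartEmbedding_injective).mpr hc
    rw [map_mul, map_mul] at h'
    apply mul_left_cancel₀ hc'
    rw [← mul_assoc, h']
  refine ⟨a, b, fun hby => ?_, h⟩
  obtain ⟨s, hs, u, hu⟩ := UniqueFactorizationMonoid.exists_prime_factors b hb
  have hby' : s.prod ∈ y.asIdeal := (Ideal.mul_unit_mem_iff_mem _ u.isUnit).mp (hu ▸ hby)
  obtain ⟨p, hps, hpy⟩ := (hy.multiset_prod_mem_iff_exists_mem s).mp hby'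
  have hp := hs p hps
  have hpb : p ∣ b := hu ▸ (Multiset.dvd_prod hps).mul_right _
  let z : Spec R := (⟨Ideal.span {p}, (Ideal.span_singleton_prime hp.ne_zero).mpr hp⟩ :
    PrimeSpectrum R)
  have hz : Order.coheight (f z) = 1 := by
    rw [coheight_chart]; exact_mod_cast height_span_singleton_prime hp
  have hle : z.asIdeal ≤ y.asIdeal := (Ideal.span_singleton_le_iff_mem _).mpr hpy
  have hι := f.chartEmbedding_injective
  have h0 := hg z hle hz
  have ha : a ≠ 0 := by
    rintro rfl
    rw [map_zero, mul_eq_zero] at h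
    exact h.elim ((map_ne_zero_iff _ hι).mpr hb) hg0
  have hoa : ord (f.chartEmbedding a) (f z) = 0 :=
    (ord_chartEmbedding_eq_zero_iff f z hz ha).mpr fun ha' =>
      hp.not_isUnit (hab (Ideal.mem_span_singleton.mp ha') hpb)
  have hob := ord_chartEmbedding_nonneg f z hb
  have hob' : ord (f.chartEmbedding b) (f z) ≠ 0 := fun h' =>
    (ord_chartEmbedding_eq_zero_iff f z hz hb).mp h' (Ideal.mem_span_singleton.mpr hpb)
  rw [← h, ord_mul ((map_ne_zero_iff _ hι).mpr hb) hg0] at hoa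
  omega

end

end AlgebraicGeometry.Scheme

/-! ### Factoriality and prime ideals of the rings of smooth cones -/

section ConeRing

variable {k : Type u} [Field k] {N : Type u} [AddCommGroup N]

/-- The cone is a face of the cone of a full basis, whose ring is a polynomial ring; passing to a
face inverts a monomial, and localization preserves factoriality. -/
theorem coneRing_uniqueFactorizationMonoid {ι : Type u} (b : Module.Basis ι ℤ N) [Finite ι]
    {τ : Set N} (hτ : τ ⊆ Set.range b) : UniqueFactorizationMonoid (coneRing k τ) := by
  have : Module.Free ℤ N := .of_basis b
  obtain ⟨m, -, -, hm⟩ := exists_isLocalizationAway (k := k) b hτ le_rfl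
  let := (coneRingMap k hτ).toAlgebra
  let e : MvPolynomial ι k ≃+* coneRing k (Set.range b) :=
    (AddMonoidAlgebra.mapDomainRingEquiv k (dualMonoidEquiv b)).symm
  have := e.toMulEquiv.uniqueFactorizationMonoid inferInstance
  exact UniqueFactorizationMonoid.of_isLocalization
    (.powers (AddMonoidAlgebra.single m (1 : k) : coneRing k (Set.range b))) _

/-- The dual basis vector of a generator of a smooth cone, as an element of the dual monoid. -/
noncomputable def dualCoord {ι : Type u} (b : Module.Basis ι ℤ N) {σ : Set N}
    (hσ : σ ⊆ Set.range b) (i : ι) : dualMonoid σ :=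
  ⟨b.coord i, fun u hu => by
    classical
    obtain ⟨j, rfl⟩ := hσ hu
    rw [Module.Basis.coord_apply, Module.Basis.repr_self, Finsupp.single_apply]
    split_ifs <;> omega⟩

/-- A function in the kernel involves only monomials with positive value at `b i`, and each of these
is divisible by the coordinate dual to `b i`. Thus the coordinate is an equation of the divisor on
the chart. -/
theorem ker_orbitHom_eq_span {ι : Type u} (b : Module.Basis ι ℤ N) {σ : Set N}
    (hσ : σ ⊆ Set.range b) {i : ι} (hi : b i ∈ σ) :
    RingHom.ker (orbitHom k hi) =
      Ideal.span {(AddMonoidAlgebra.single (dualCoord b hσ i) 1 : coneRing k σ)} := by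
  classical
  have hcoord : ∀ j, b.coord i (b j) = if j = i then 1 else 0 := fun j => by
    simp [Finsupp.single_apply]
  have hn : (dualCoord b hσ i).1 (b i) = 1 := (hcoord i).trans (if_pos rfl)
  refine le_antisymm (fun f hf => ?_) ?_
  · rw [Ideal.mem_span_singleton, ← AddMonoidAlgebra.sum_coeff_single f]
    refine Finset.dvd_sum fun m hm => ?_
    have hm0 : m.1 (b i) ≠ 0 := fun h => by
      have := orbitHom_coeff hi f m h
      rw [RingHom.mem_ker] at hf
      rw [hf] at this
      exact (Finsupp.mem_support_iff.mp hm) this.symm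
    have hmem : m.1 - (dualCoord b hσ i).1 ∈ dualMonoid σ := fun u hu => by
      have h1 := m.2 u hu
      obtain ⟨j, rfl⟩ := hσ hu
      rw [LinearMap.sub_apply]
      have h2 : (dualCoord b hσ i).1 (b j) = if j = i then 1 else 0 := hcoord j
      by_cases h3 : j = i
      · subst h3
        rw [h2, if_pos rfl]
        omega
      · rw [h2, if_neg h3]
        omega
    refine ⟨AddMonoidAlgebra.single ⟨m.1 - (dualCoord b hσ i).1, hmem⟩ (f.coeff m), ?_⟩
    rw [AddMonoidAlgebra.single_mul_single, one_mul]
    congr 1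
    exact Subtype.ext (add_sub_cancel _ _).symm
  · rw [Ideal.span_singleton_le_iff_mem, RingHom.mem_ker, orbitHom_single,
      if_neg (by rw [hn]; exact one_ne_zero)]

theorem orbitHom_comp_coneRingMap {σ τ : Set N} (h : τ ⊆ σ) {v : N} (hv : v ∈ τ)
    (a : coneRing k σ) : orbitHom k hv (coneRingMap k h a) = orbitHom k (h hv) a := by
  classical
  induction a using AddMonoidAlgebra.induction_linear with
  | zero => simp
  | add x y hx hy => simp [hx, hy]
  | single s r =>
    rw [coneRingMap_single, orbitHom_single, orbitHom_single]
    rfl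

/-- A prime ideal of the ring of a smooth cone either contains one of the coordinates of the cone, or
contains no monomial. -/
theorem exists_dualCoord_mem_or {ι : Type u} (b : Module.Basis ι ℤ N) [Finite ι] {σ : Set N}
    (hσ : σ ⊆ Set.range b) (P : Ideal (coneRing k σ)) [P.IsPrime] :
    (∃ i, b i ∈ σ ∧ (AddMonoidAlgebra.single (dualCoord b hσ i) 1 : coneRing k σ) ∈ P) ∨
      ∀ m : dualMonoid σ, (AddMonoidAlgebra.single m 1 : coneRing k σ) ∉ P := by
  classical
  have := Fintype.ofFinite ι
  refine or_iff_not_imp_left.mpr fun h => ?_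
  push Not at h
  -- The exponents of monomials outside a prime form a submonoid. It suffices to find in it the
  -- components of `m` along the dual basis: multiples of coordinates of the cone on the one hand,
  -- invertible monomials on the other.
  let S : AddSubmonoid (dualMonoid σ) :=
    { carrier := {m | (AddMonoidAlgebra.single m 1 : coneRing k σ) ∉ P}
      zero_mem' := (Ideal.ne_top_iff_one P).mp Ideal.IsPrime.ne_top'
      add_mem' := fun {m m'} hm hm' hmm' => by
        have : (AddMonoidAlgebra.single (m + m') 1 : coneRing k σ) =
          AddMonoidAlgebra.single m 1 * AddMonoidAlgebra.single m' 1 := by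
          rw [AddMonoidAlgebra.single_mul_single, one_mul]
        rw [this] at hmm'
        exact (Ideal.IsPrime.mem_or_mem inferInstance hmm').elim hm hm' }
  have hunit : ∀ m : dualMonoid σ, -m.1 ∈ dualMonoid σ → m ∈ S := fun m hm hmP => by
    refine (Ideal.ne_top_iff_one P).mp Ideal.IsPrime.ne_top' ?_
    have := P.mul_mem_left (AddMonoidAlgebra.single ⟨-m.1, hm⟩ 1) hmP
    rw [AddMonoidAlgebra.single_mul_single, one_mul] at this
    rw [AddMonoidAlgebra.one_def]
    convert this
    exact Subtype.ext (neg_add_cancel m.1).symm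
  intro m
  change m ∈ S
  have hcoord : ∀ i j, b.coord i (b j) = if j = i then 1 else 0 := fun i j => by
    simp [Finsupp.single_apply]
  have hmem : ∀ i, m.1 (b i) • b.coord i ∈ dualMonoid σ := fun i u hu => by
    obtain ⟨j, rfl⟩ := hσ hu
    have := m.2 _ hu
    rw [LinearMap.smul_apply, hcoord]
    by_cases hij : j = i
    · subst hij; simpa
    · simp [hij]
  have hS : ∀ i, (⟨m.1 (b i) • b.coord i, hmem i⟩ : dualMonoid σ) ∈ S := fun i => by
    by_cases hi : b i ∈ σ
    · have : (⟨m.1 (b i) • b.coord i, hmem i⟩ : dualMonoid σ) =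
          (m.1 (b i)).toNat • dualCoord b hσ i := Subtype.ext <| by
        change m.1 (b i) • b.coord i = (m.1 (b i)).toNat • b.coord i
        rw [← natCast_zsmul, Int.toNat_of_nonneg (m.2 _ hi)]
      rw [this]
      exact S.nsmul_mem (h i hi) _
    · refine hunit _ fun u hu => ?_
      obtain ⟨j, rfl⟩ := hσ hu
      have hij : j ≠ i := fun e => hi (e ▸ hu)
      change 0 ≤ -(m.1 (b i) • b.coord i (b j))
      rw [hcoord, if_neg hij]
      simp
  have hsum : m = ∑ i, (⟨m.1 (b i) • b.coord i, hmem i⟩ : dualMonoid σ) := Subtype.ext <| by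
    rw [AddSubmonoid.coe_finsetSum]
    refine b.ext fun j => ?_
    simp
  rw [hsum]
  exact S.sum_mem fun i _ => hS i

end ConeRing

/-! ### Characters as rational functions and their divisors -/

namespace SmoothFan

variable {N : Type u} [AddCommGroup N] [Module.Free ℤ N] [Module.Finite ℤ N] (Δ : SmoothFan N)
  (k : Type u) [Field k]

/-- The coordinate ring `k[S_σ]` of a chart. -/
noncomputable abbrev chartRing (σ : Δ.Cone) : CommRingCat.{u} := CommRingCat.of (coneRing k (σ.1 : Set N))

instance (σ : Δ.Cone) : IsDomain (Δ.chartRing k σ) :=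
  inferInstanceAs (IsDomain (coneRing k (σ.1 : Set N)))

instance (σ : Δ.Cone) : IsNoetherianRing (Δ.chartRing k σ) := by
  obtain ⟨ι, b, _, h⟩ := Δ.exists_basis σ.2
  exact (coneRing_noeth (k := k) b h).1

instance (σ : Δ.Cone) : UniqueFactorizationMonoid (Δ.chartRing k σ) := by
  obtain ⟨ι, b, _, h⟩ := Δ.exists_basis σ.2
  exact coneRing_uniqueFactorizationMonoid (k := k) b h

/-- The open immersion `Spec k[S_σ] → X_Δ`. -/
noncomputable abbrev specChart (σ : Δ.Cone) : Spec (Δ.chartRing k σ) ⟶ Δ.toricVariety k :=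
  Δ.chart k σ

instance (σ : Δ.Cone) : IsOpenImmersion (Δ.specChart k σ) :=
  inferInstanceAs (IsOpenImmersion (Δ.chart k σ))

/-- The embedding of `k[S_σ]` into the function field. -/
noncomputable def ringEmb (σ : Δ.Cone) :
    coneRing k (σ.1 : Set N) →+* (Δ.toricVariety k).functionField :=
  (Δ.specChart k σ).chartEmbedding

theorem ringEmb_injective (σ : Δ.Cone) : Function.Injective (Δ.ringEmb k σ) :=
  (Δ.specChart k σ).chartEmbedding_injective

theorem specChart_eq {σ τ : Δ.Cone} (h : τ ≤ σ) :
    Spec.map (CommRingCat.ofHom (coneRingMap k (Finset.coe_subset.mpr h))) ≫ Δ.specChart k σ =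
      Δ.specChart k τ :=
  colimit.w (Δ.diagram k) (homOfLE h)

/-- All chart rings sit compatibly in one function field, so that the character `χ^m` does not
depend on the chart on which it is considered. -/
theorem ringEmb_coneRingMap {σ τ : Δ.Cone} (h : τ ≤ σ) (a : coneRing k (σ.1 : Set N)) :
    Δ.ringEmb k τ (coneRingMap k (Finset.coe_subset.mpr h) a) = Δ.ringEmb k σ a := by
  have hτ := genericPoint_eq_of_isOpenImmersion (Δ.specChart k τ)
  have hσ := genericPoint_eq_of_isOpenImmersion (Δ.specChart k σ)
  have e := Δ.specChart_eq k h
  let φ : Δ.chartRing k σ ⟶ Δ.chartRing k τ :=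
    CommRingCat.ofHom (coneRingMap k (Finset.coe_subset.mpr h))
  have : IsOpenImmersion (Spec.map φ) :=
    inferInstanceAs (IsOpenImmersion ((Δ.diagram k).map (homOfLE h)))
  have hφ := genericPoint_eq_of_isOpenImmersion (Spec.map φ)
  apply ((Δ.specChart k τ).functionFieldMap_bijective hτ).1
  refine ((Δ.specChart k τ).functionFieldMap_chartEmbedding _ hτ).trans ?_
  rw [Scheme.Hom.functionFieldMap_congr e.symm hτ (e ▸ hτ),
    Scheme.Hom.functionFieldMap_comp _ hσ (Spec.map φ) hφ]
  refine Eq.trans ?_ (congrArg _ ((Δ.specChart k σ).functionFieldMap_chartEmbedding a hσ).symm)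
  exact (Scheme.functionFieldMap_specToFunctionField φ hφ a).symm

/-- The zero cone, whose chart is the torus. -/
def zeroCone : Δ.Cone := ⟨∅, Δ.empty_mem⟩

theorem zeroCone_le (σ : Δ.Cone) : Δ.zeroCone ≤ σ := Finset.empty_subset σ.1

/-- Every character belongs to the dual monoid of the zero cone. -/
def toTorus : Module.Dual ℤ N →+ dualMonoid ((Δ.zeroCone).1 : Set N) where
  toFun m := ⟨m, fun u hu => absurd hu (Finset.notMem_empty u)⟩
  map_zero' := rfl
  map_add' _ _ := rfl

/-- The character `χ^m` as a rational function. -/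
noncomputable def character (m : Module.Dual ℤ N) : (Δ.toricVariety k).functionField :=
  Δ.ringEmb k Δ.zeroCone (AddMonoidAlgebra.single (Δ.toTorus m) 1)

theorem ringEmb_single_one (σ : Δ.Cone) (m : dualMonoid (σ.1 : Set N)) :
    Δ.ringEmb k σ (AddMonoidAlgebra.single m 1) = Δ.character k m.1 := by
  rw [← Δ.ringEmb_coneRingMap k (Δ.zeroCone_le σ), coneRingMap_single]
  rfl

theorem character_zero : Δ.character k 0 = 1 := map_one (Δ.ringEmb k Δ.zeroCone)

theorem character_add (m m' : Module.Dual ℤ N) :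
    Δ.character k (m + m') = Δ.character k m * Δ.character k m' := by
  rw [character, character, character, ← map_mul, AddMonoidAlgebra.single_mul_single, one_mul]
  rfl

theorem character_ne_zero (m : Module.Dual ℤ N) : Δ.character k m ≠ 0 := by
  refine left_ne_zero_of_mul (b := Δ.character k (-m)) ?_
  rw [← character_add, add_neg_cancel, character_zero]
  exact one_ne_zero

theorem character_neg (m : Module.Dual ℤ N) : Δ.character k (-m) = (Δ.character k m)⁻¹ := by
  refine eq_inv_of_mul_eq_one_left ?_
  rw [← character_add, neg_add_cancel, character_zero]

/-- Scalars as rational functions. -/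
noncomputable def scalar : k →+* (Δ.toricVariety k).functionField :=
  (Δ.ringEmb k Δ.zeroCone).comp (algebraMap k (coneRing k _))

theorem ringEmb_single (σ : Δ.Cone) (m : dualMonoid (σ.1 : Set N)) (c : k) :
    Δ.ringEmb k σ (AddMonoidAlgebra.single m c) = Δ.scalar k c * Δ.character k m.1 := by
  rw [← Δ.ringEmb_coneRingMap k (Δ.zeroCone_le σ), coneRingMap_single, scalar, character,
    RingHom.comp_apply, ← map_mul, AddMonoidAlgebra.coe_algebraMap]
  simp [AddMonoidAlgebra.single_mul_single]
  rfl

theorem ord_character_add (m m' : Module.Dual ℤ N) (x : Δ.toricVariety k) :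
    Scheme.ord (Δ.character k (m + m')) x =
      Scheme.ord (Δ.character k m) x + Scheme.ord (Δ.character k m') x := by
  rw [character_add, Scheme.ord_mul (Δ.character_ne_zero k m) (Δ.character_ne_zero k m')]

theorem ord_character_neg (m : Module.Dual ℤ N) (x : Δ.toricVariety k) :
    Scheme.ord (Δ.character k (-m)) x = - Scheme.ord (Δ.character k m) x := by
  rw [character_neg, Scheme.ord_inv]

theorem ord_character_zsmul (n : ℤ) (m : Module.Dual ℤ N) (x : Δ.toricVariety k) :
    Scheme.ord (Δ.character k (n • m)) x = n * Scheme.ord (Δ.character k m) x := by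
  let φ : Module.Dual ℤ N →+ ℤ :=
    AddMonoidHom.mk' (fun m => Scheme.ord (Δ.character k m) x) fun m m' =>
      Δ.ord_character_add k m m' x
  exact (map_zsmul φ n m).trans (by simp [φ])

theorem ord_character_nonneg (σ : Δ.Cone) (y : Spec (Δ.chartRing k σ))
    (m : dualMonoid (σ.1 : Set N)) : 0 ≤ Scheme.ord (Δ.character k m.1) (Δ.specChart k σ y) := by
  rw [← Δ.ringEmb_single_one k σ]
  exact Scheme.ord_chartEmbedding_nonneg (Δ.specChart k σ) y
    (AddMonoidAlgebra.single_ne_zero.mpr one_ne_zero)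

/-- Both the character and its inverse are regular on the chart. -/
theorem ord_character_eq_zero (σ : Δ.Cone) (y : Spec (Δ.chartRing k σ)) (m : Module.Dual ℤ N)
    (hm : ∀ u ∈ σ.1, m u = 0) : Scheme.ord (Δ.character k m) (Δ.specChart k σ y) = 0 := by
  have h1 := Δ.ord_character_nonneg k σ y ⟨m, fun u hu => (hm u hu).ge⟩
  have h2 := Δ.ord_character_nonneg k σ y ⟨-m, fun u hu => by
    rw [LinearMap.neg_apply, hm u hu, neg_zero]⟩
  rw [ord_character_neg] at h2
  simp only at h1
  omega

theorem ord_character_torus (y : Spec (Δ.chartRing k Δ.zeroCone)) (m : Module.Dual ℤ N) :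
    Scheme.ord (Δ.character k m) (Δ.specChart k Δ.zeroCone y) = 0 :=
  Δ.ord_character_eq_zero k _ y m fun u hu => absurd hu (Finset.notMem_empty u)

/-- Complete `u_ρ` to a basis and split `m` into `⟨m, u_ρ⟩` times the dual coordinate, which is a
uniformizer along `D_ρ`, and a part vanishing on `u_ρ`, whose character is a unit there. -/
theorem ord_character_primeDivisor (ρ : Δ.Ray) (m : Module.Dual ℤ N) :
    Scheme.ord (Δ.character k m) (Δ.primeDivisor k ρ).1 = m ρ.1 := by
  obtain ⟨ι, b, _, h⟩ := Δ.exists_basis ρ.2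
  obtain ⟨i, hi⟩ := h (Finset.mem_coe.mpr (Finset.mem_singleton_self ρ.1))
  have hρ : ρ.1 ∈ (({ρ.1} : Finset N) : Set N) := Finset.mem_coe.mpr (Finset.mem_singleton_self ρ.1)
  have hi' : b i ∈ (({ρ.1} : Finset N) : Set N) := hi ▸ hρ
  have h1 : Scheme.ord (Δ.character k (b.coord i)) (Δ.primeDivisor k ρ).1 = 1 := by
    refine (congrArg (fun g => Scheme.ord g _)
      (Δ.ringEmb_single_one k (Δ.rayCone ρ) (dualCoord b h i)).symm).trans ?_
    refine Scheme.ord_chartEmbedding_eq_one (Δ.specChart k (Δ.rayCone ρ)) (Δ.orbitPoint k ρ)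
      (Δ.primeDivisor k ρ).2 (AddMonoidAlgebra.single_ne_zero.mpr one_ne_zero) ?_
    refine Eq.trans ?_ (ker_orbitHom_eq_span b h hi')
    change RingHom.ker (orbitHom k hρ) = _
    congr 2
    exact hi.symm
  have h2 : m = m ρ.1 • b.coord i + (m - m ρ.1 • b.coord i) := by abel
  have h3 : Scheme.ord (Δ.character k (m - m ρ.1 • b.coord i)) (Δ.primeDivisor k ρ).1 = 0 := by
    refine Δ.ord_character_eq_zero k (Δ.rayCone ρ) (Δ.orbitPoint k ρ) _ fun u hu => ?_
    rw [Finset.mem_singleton.mp hu, ← hi]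
    simp
  conv_lhs => rw [h2]
  rw [ord_character_add, h3, ord_character_zsmul, h1]
  simp

theorem dual_separates {N : Type u} [AddCommGroup N] [Module.Free ℤ N] {u v : N} (h : ∀ m : Module.Dual ℤ N, m u = m v) : u = v :=
  (Module.Free.chooseBasis ℤ N).ext_elem fun i => h ((Module.Free.chooseBasis ℤ N).coord i)

theorem primeDivisor_injective : Function.Injective (Δ.primeDivisor k) := fun ρ ρ' h =>
  Subtype.ext <| dual_separates fun m => by
    rw [← Δ.ord_character_primeDivisor k, ← Δ.ord_character_primeDivisor k, h]

theorem Ray.ne_zero (ρ : Δ.Ray) : ρ.1 ≠ 0 := by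
  obtain ⟨ι, b, _, h⟩ := Δ.exists_basis ρ.2
  obtain ⟨i, hi⟩ := h (Finset.mem_coe.mpr (Finset.mem_singleton_self ρ.1))
  exact hi ▸ b.ne_zero i

/-- All characters have order zero on the torus, but along `D_ρ` their orders are their values at
`u_ρ ≠ 0`. -/
theorem specChart_zeroCone_ne_primeDivisor (y : Spec (Δ.chartRing k Δ.zeroCone)) (ρ : Δ.Ray) :
    Δ.specChart k Δ.zeroCone y ≠ (Δ.primeDivisor k ρ).1 := fun h =>
  Ray.ne_zero Δ ρ <| dual_separates fun m => by
    rw [← Δ.ord_character_primeDivisor k, ← h, ord_character_torus, map_zero]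

/-- The divisor is defined in the chart of its own ray; here its generic point is located in the
chart of any cone containing the ray. -/
theorem primeDivisor_eq_specChart (σ : Δ.Cone) (ρ : Δ.Ray) (hρ : ρ.1 ∈ (σ.1 : Set N)) :
    (Δ.primeDivisor k ρ).1 = Δ.specChart k σ
      (⟨RingHom.ker (orbitHom k hρ), RingHom.ker_isPrime _⟩ :
        PrimeSpectrum (coneRing k (σ.1 : Set N))) := by
  have h : Δ.rayCone ρ ≤ σ := Finset.singleton_subset_iff.mpr hρ
  change Δ.specChart k (Δ.rayCone ρ) (Δ.orbitPoint k ρ) = _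
  rw [← Δ.specChart_eq k h]
  change Δ.specChart k σ _ = _
  congr 1
  apply PrimeSpectrum.ext
  ext a
  change orbitHom k _ (coneRingMap k (Finset.coe_subset.mpr h) a) = 0 ↔ orbitHom k hρ a = 0
  exact Eq.congr_left (orbitHom_comp_coneRingMap (Finset.coe_subset.mpr h)
    (Finset.mem_coe.mpr (Finset.mem_singleton_self ρ.1)) a)

/-- A point of codimension one in the chart of `σ` is a torus invariant prime divisor given by a
ray of `σ`, or it lies in the torus. -/
theorem exists_primeDivisor_or_torus (σ : Δ.Cone) (y : Spec (Δ.chartRing k σ))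
    (hy : Order.coheight (Δ.specChart k σ y) = 1) :
    (∃ ρ : Δ.Ray, ρ.1 ∈ σ.1 ∧ Δ.specChart k σ y = (Δ.primeDivisor k ρ).1) ∨
      ∃ z, Δ.specChart k σ y = Δ.specChart k Δ.zeroCone z := by
  obtain ⟨ι, b, _, h⟩ := Δ.exists_basis σ.2
  have hP : y.asIdeal.IsPrime := PrimeSpectrum.isPrime y
  rcases exists_dualCoord_mem_or b h y.asIdeal with ⟨i, hi, him⟩ | hm
  · left
    let ρ : Δ.Ray := ⟨b i, Δ.face_mem _ σ.2 _ (Finset.singleton_subset_iff.mpr hi)⟩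
    refine ⟨ρ, hi, ?_⟩
    rw [Δ.primeDivisor_eq_specChart k σ ρ hi]
    congr 1
    apply PrimeSpectrum.ext
    have hle : RingHom.ker (orbitHom k hi) ≤ y.asIdeal := by
      rw [ker_orbitHom_eq_span b h hi, Ideal.span_singleton_le_iff_mem]
      exact him
    have hfin : (RingHom.ker (orbitHom k hi)).height = 1 := height_ker_orbitHom hi b h
    have hpr : (RingHom.ker (orbitHom k hi)).IsPrime := RingHom.ker_isPrime _
    have hf : (RingHom.ker (orbitHom k hi)).FiniteHeight :=
      ⟨Or.inr (by rw [hfin]; exact ENat.one_ne_top)⟩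
    -- Nested primes of the same finite height coincide.
    refine (Ideal.eq_of_le_of_height_le _ hle ?_).symm
    rw [hfin, ← hy]
    exact (Scheme.coheight_chart (Δ.specChart k σ) y).ge
  · right
    -- The torus is the locus in the chart where one suitable monomial is invertible, and no
    -- monomial vanishes at `y`.
    obtain ⟨m, -, -, hloc⟩ := exists_isLocalizationAway (k := k) b
      (Finset.coe_subset.mpr (Δ.zeroCone_le σ)) h
    have r1 := @PrimeSpectrum.localization_away_comap_range _ _
      (coneRing k ((Δ.zeroCone).1 : Set N)) _ (coneRingMap k _).toAlgebra _ hloc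
    obtain ⟨z, hz⟩ := r1.ge (hm m : y ∈ (PrimeSpectrum.basicOpen
      (AddMonoidAlgebra.single m (1 : k) : coneRing k (σ.1 : Set N)) : Set (PrimeSpectrum _)))
    refine ⟨z, ?_⟩
    rw [← Δ.specChart_eq k (Δ.zeroCone_le σ), ← hz]
    rfl

end SmoothFan

/-! ### Local equations of torus-invariant divisors -/

namespace SmoothFan

variable {N : Type u} [AddCommGroup N] [Module.Free ℤ N] [Module.Finite ℤ N] (Δ : SmoothFan N)
  (k : Type u) [Field k]

theorem toricDivisor_apply_primeDivisor (a : Δ.Ray → ℤ) (ρ : Δ.Ray) :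
    Δ.toricDivisor k a (Δ.primeDivisor k ρ) = a ρ := by
  classical
  rw [toricDivisor, Finsupp.finsetSum_apply, Finset.sum_eq_single ρ]
  · simp
  · intro ρ' _ h
    exact Finsupp.single_eq_of_ne fun e => h (Δ.primeDivisor_injective k e.symm)
  · simp

theorem toricDivisor_apply_of_notMem (a : Δ.Ray → ℤ) {x : {x : Δ.toricVariety k // Order.coheight x = 1}}
    (hx : ∀ ρ, x ≠ Δ.primeDivisor k ρ) : Δ.toricDivisor k a x = 0 := by
  rw [toricDivisor, Finsupp.finsetSum_apply]
  exact Finset.sum_eq_zero fun ρ _ => Finsupp.single_eq_of_ne (hx ρ)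

/-- The generators of a smooth cone are part of a basis, so their values can be prescribed. This is
the Cartier datum of `∑ a_ρ D_ρ` on the chart. -/
theorem exists_dual_eq_on (σ : Δ.Cone) (a : Δ.Ray → ℤ) :
    ∃ n : Module.Dual ℤ N, ∀ ρ : Δ.Ray, ρ.1 ∈ σ.1 → n ρ.1 = a ρ := by
  classical
  obtain ⟨ι, b, _, h⟩ := Δ.exists_basis σ.2
  refine ⟨b.constr ℤ fun i => if hi : {b i} ∈ Δ.cones then a ⟨b i, hi⟩ else 0, fun ρ hρ => ?_⟩
  obtain ⟨i, hi⟩ := h hρ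
  obtain ⟨v, hv⟩ := ρ
  simp only at hi
  subst hi
  rw [Module.Basis.constr_basis, dif_pos hv]

theorem ord_character_eq_toricDivisor (σ : Δ.Cone) (a : Δ.Ray → ℤ) (n : Module.Dual ℤ N)
    (hn : ∀ ρ : Δ.Ray, ρ.1 ∈ σ.1 → n ρ.1 = a ρ) (y : Spec (Δ.chartRing k σ))
    (hy : Order.coheight (Δ.specChart k σ y) = 1) :
    Scheme.ord (Δ.character k n) (Δ.specChart k σ y) = Δ.toricDivisor k a ⟨_, hy⟩ := by
  rcases Δ.exists_primeDivisor_or_torus k σ y hy with ⟨ρ, hρ, h⟩ | ⟨z, hz⟩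
  · refine (congrArg (Scheme.ord (Δ.character k n)) h).trans ?_
    rw [ord_character_primeDivisor, hn ρ hρ, ← Δ.toricDivisor_apply_primeDivisor k a ρ]
    congr 1
    exact Subtype.ext h.symm
  · refine (congrArg (Scheme.ord (Δ.character k n)) hz).trans ?_
    rw [ord_character_torus, toricDivisor_apply_of_notMem]
    exact fun ρ h => Δ.specChart_zeroCone_ne_primeDivisor k z ρ
      (hz.symm.trans (congrArg Subtype.val h))

/-- The local description of `𝒪(D)` for a torus invariant divisor. -/
theorem exists_ringEmb_mul_eq (σ : Δ.Cone) (a : Δ.Ray → ℤ) (n : Module.Dual ℤ N)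
    (hn : ∀ ρ : Δ.Ray, ρ.1 ∈ σ.1 → n ρ.1 = a ρ) (y : Spec (Δ.chartRing k σ))
    (g : (Δ.toricVariety k).functionField)
    (hg : ∀ x : {x : Δ.toricVariety k // Order.coheight x = 1}, x.1 ⤳ Δ.specChart k σ y →
      g = 0 ∨ -Δ.toricDivisor k a x ≤ Scheme.ord g x.1) :
    ∃ p q : coneRing k (σ.1 : Set N), q ∉ y.asIdeal ∧
      Δ.ringEmb k σ q * (Δ.character k n * g) = Δ.ringEmb k σ p := by
  refine Scheme.exists_chartEmbedding_mul_eq_of_ord_nonneg (Δ.specChart k σ) y _ fun z hz hz1 => ?_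
  by_cases hg0 : g = 0
  · simp [hg0]
  have hzy : z ⤳ y := (PrimeSpectrum.le_iff_specializes z y).mp hz
  have h := (hg ⟨_, hz1⟩ (hzy.map (Δ.specChart k σ).continuous)).resolve_left hg0
  rw [Scheme.ord_mul (Δ.character_ne_zero k n) hg0,
    Δ.ord_character_eq_toricDivisor k σ a n hn z hz1]
  simp only at h
  omega

/-- Converse to `exists_ringEmb_mul_eq` at a codimension one point: `q` has order zero there and `p`
has nonnegative order, so `χ^n g` has no pole. -/
theorem ord_ge_of_ringEmb_mul_eq (σ : Δ.Cone) (a : Δ.Ray → ℤ) (n : Module.Dual ℤ N)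
    (hn : ∀ ρ : Δ.Ray, ρ.1 ∈ σ.1 → n ρ.1 = a ρ) (y : Spec (Δ.chartRing k σ))
    (hy : Order.coheight (Δ.specChart k σ y) = 1) (g : (Δ.toricVariety k).functionField)
    {p q : coneRing k (σ.1 : Set N)} (hq : q ∉ y.asIdeal)
    (h : Δ.ringEmb k σ q * (Δ.character k n * g) = Δ.ringEmb k σ p) :
    g = 0 ∨ -Δ.toricDivisor k a ⟨_, hy⟩ ≤ Scheme.ord g (Δ.specChart k σ y) := by
  refine or_iff_not_imp_left.mpr fun hg => ?_
  have hq0 : q ≠ 0 := fun h0 => hq (h0 ▸ y.asIdeal.zero_mem)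
  have hq0' : Δ.ringEmb k σ q ≠ 0 := (map_ne_zero_iff _ (Δ.ringEmb_injective k σ)).mpr hq0
  have hn0 := Δ.character_ne_zero k n
  have hp0 : p ≠ 0 := by
    rintro rfl
    rw [map_zero, mul_eq_zero, mul_eq_zero] at h
    tauto
  have h1 : 0 ≤ Scheme.ord (Δ.ringEmb k σ p) _ :=
    Scheme.ord_chartEmbedding_nonneg (Δ.specChart k σ) y hp0
  have h2 : Scheme.ord (Δ.ringEmb k σ q) _ = 0 :=
    (Scheme.ord_chartEmbedding_eq_zero_iff (Δ.specChart k σ) y hy hq0).mpr hq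
  rw [← h, Scheme.ord_mul hq0' (mul_ne_zero hn0 hg), Scheme.ord_mul hn0 hg, h2,
    Δ.ord_character_eq_toricDivisor k σ a n hn y hy] at h1
  omega

/-- If a rational function is regular at every point of a basic open subset of a chart, some power of
the equation clears its denominator. -/
theorem exists_pow_ringEmb_mul_eq (σ : Δ.Cone) (h : coneRing k (σ.1 : Set N))
    (g : (Δ.toricVariety k).functionField)
    (hg : ∀ y : Spec (Δ.chartRing k σ), h ∉ y.asIdeal → ∃ p q : coneRing k (σ.1 : Set N),
      q ∉ y.asIdeal ∧ Δ.ringEmb k σ q * g = Δ.ringEmb k σ p) :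
    ∃ (r : ℕ) (p : coneRing k (σ.1 : Set N)), Δ.ringEmb k σ (h ^ r) * g = Δ.ringEmb k σ p := by
  -- The ideal of denominators of `g`. A prime containing it must contain `h`, so `h` lies in its
  -- radical.
  let I : Ideal (coneRing k (σ.1 : Set N)) :=
    { carrier := {q | ∃ p, Δ.ringEmb k σ q * g = Δ.ringEmb k σ p}
      zero_mem' := ⟨0, by simp⟩
      add_mem' := by
        rintro q q' ⟨p, hp⟩ ⟨p', hp'⟩
        exact ⟨p + p', by rw [map_add, add_mul, hp, hp', map_add]⟩
      smul_mem' := by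
        rintro c q ⟨p, hp⟩
        exact ⟨c * p, by rw [smul_eq_mul, map_mul, mul_assoc, hp, map_mul]⟩ }
  have hI : h ∈ I.radical := by
    rw [Ideal.radical_eq_sInf, Ideal.mem_sInf]
    rintro J ⟨hIJ, hJ⟩
    by_contra hhJ
    obtain ⟨p, q, hq, hqp⟩ := hg (⟨J, hJ⟩ : PrimeSpectrum (coneRing k (σ.1 : Set N))) hhJ
    exact hq (hIJ ⟨p, hqp⟩)
  obtain ⟨r, hr⟩ := hI
  exact ⟨r, hr⟩

end SmoothFan

/-! ### Bases of fraction field extensions -/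

open nonZeroDivisors in
/-- A finite basis of an extension of domains gives coordinates on the extension of fraction
fields. -/
theorem exists_fractionField_coordinates {A B K L : Type*} [CommRing A] [IsDomain A] [CommRing B]
    [IsDomain B] [IsIntegrallyClosed B] [Field K] [Field L] [Algebra A K] [IsFractionRing A K] [Algebra B L]
    [IsFractionRing B L] (φ : A →+* B) (Φ : K →+* L)
    (comm : ∀ a, Φ (algebraMap A K a) = algebraMap B L (φ a)) {C : Type*} [Fintype C]
    (v : C → B) (π : C → B →+ A) (hπ : ∀ c a b, π c (φ a * b) = a * π c b)
    (hδ : ∀ c, π c (v c) = 1) (hδ' : ∀ c c', c ≠ c' → π c (v c') = 0)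
    (hsum : ∀ b, ∑ c, φ (π c b) * v c = b) (hφ : Function.Injective φ) :
    ∃ P : C → L →+ K, (∀ c x f, P c (Φ x * f) = x * P c f) ∧
      (∀ c b, P c (algebraMap B L b) = algebraMap A K (π c b)) ∧
      ∀ f, ∑ c, Φ (P c f) * algebraMap B L (v c) = f := by
  let := φ.toAlgebra
  let := Φ.toAlgebra
  let := ((algebraMap B L).comp φ).toAlgebra
  have : IsScalarTower A B L := .of_algebraMap_eq fun _ => rfl
  have : IsScalarTower A K L := .of_algebraMap_eq fun a => (comm a).symm
  let e : B ≃ₗ[A] (C → A) :=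
    { toFun := fun b c => π c b
      map_add' := fun b b' => funext fun c => map_add (π c) b b'
      map_smul' := fun a b => funext fun c => by
        rw [Algebra.smul_def]
        exact hπ c a b
      invFun := fun w => ∑ c, φ (w c) * v c
      left_inv := hsum
      right_inv := fun w => funext fun c => by
        change π c (∑ c', φ (w c') * v c') = w c
        rw [map_sum, Finset.sum_eq_single c]
        · rw [hπ, hδ, mul_one]
        · intro c' _ h
          rw [hπ, hδ' c c' h.symm, mul_zero]
        · simp }
  let b : Module.Basis C A B := .ofEquivFun e
  have : Module.Finite A B := .of_basis b
  have : Algebra.IsIntegral A B := inferInstance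
  have : FaithfulSMul A B := (faithfulSMul_iff_algebraMap_injective A B).mpr hφ
  -- Inverting the nonzero elements of `A` in `B` already gives all of `L`: `B` is integral over `A`
  -- and integrally closed, hence is the integral closure of `A` in `L`. So the basis of `B`
  -- localizes to one of `L` over `K`.
  have : IsLocalization (Algebra.algebraMapSubmonoid B A⁰) L := by
    have : IsIntegralClosure B A L := IsIntegralClosure.of_isIntegrallyClosed B A L
    have : Algebra.IsAlgebraic K L := isAlgebraic_of_isFractionRing A B K L
    exact IsIntegralClosure.isLocalization A K L B
  let b' : Module.Basis C K L := b.localizationLocalization K A⁰ L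
  refine ⟨fun c => (b'.coord c).toAddMonoidHom, fun c x f => ?_, fun c y => ?_, fun f => ?_⟩
  · change b'.coord c (x • f) = _
    rw [map_smul, smul_eq_mul]
    rfl
  · exact (b.localizationLocalization_repr_algebraMap K A⁰ L y c).trans rfl
  · conv_rhs => rw [← b'.sum_repr f]
    refine Finset.sum_congr rfl fun c _ => ?_
    have hv : b' c = algebraMap B L (v c) := by
      classical
      refine (b.localizationLocalization_apply K A⁰ L c).trans (congrArg _ ?_)
      rw [Module.Basis.coe_ofEquivFun]
      change ∑ c', φ ((Pi.single c 1 : C → A) c') * v c' = v c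
      rw [Finset.sum_eq_single c]
      · simp
      · intro c' _ h
        simp [h]
      · simp
    rw [Algebra.smul_def, hv]
    rfl

/-! ### Splitting a group algebra by exponents modulo ℓ -/

section GroupAlgebra

variable {k G : Type*} [Field k] [AddCommGroup G] {ℓ : ℕ}

/-- The component `g` of an element `f` of a group algebra in its decomposition into elements of the
form `χ^{-s} g(χ^ℓ)`. -/
noncomputable def frobeniusComponent (hℓ : Function.Injective fun g : G => ℓ • g) (s : G) :
    AddMonoidAlgebra k G →+ AddMonoidAlgebra k G where
  toFun := AddMonoidAlgebra.comapDomain (fun g : G => ℓ • g - s) fun _ _ h =>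
    hℓ (sub_left_injective h)
  map_zero' := AddMonoidAlgebra.comapDomain_zero _ _
  map_add' := AddMonoidAlgebra.comapDomain_add _ _

variable (hℓ : Function.Injective fun g : G => ℓ • g)

theorem coeff_frobeniusComponent (s : G) (f : AddMonoidAlgebra k G) (g : G) :
    (frobeniusComponent hℓ s f).coeff g = f.coeff (ℓ • g - s) := rfl

theorem frobeniusComponent_single (s g : G) (r : k) :
    frobeniusComponent hℓ s (AddMonoidAlgebra.single (ℓ • g - s) r) =
      AddMonoidAlgebra.single g r := by
  classical
  ext g'
  rw [coeff_frobeniusComponent, AddMonoidAlgebra.coeff_single, AddMonoidAlgebra.coeff_single,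
    Finsupp.single_apply, Finsupp.single_apply]
  refine if_congr ?_ rfl rfl
  rw [sub_left_inj]
  exact hℓ.eq_iff

theorem frobeniusComponent_single_of_ne {s g : G} (h : ∀ g', ℓ • g' - s ≠ g) (r : k) :
    frobeniusComponent hℓ s (AddMonoidAlgebra.single g r) = 0 := by
  ext g'
  rw [coeff_frobeniusComponent, AddMonoidAlgebra.coeff_single,
    Finsupp.single_eq_of_ne (h g')]
  rfl

/-- Multiplying by `χ^(ℓg)` preserves each class of exponents modulo `ℓ` and shifts the
corresponding component by `g`. -/
theorem frobeniusComponent_mul (s : G) (a f : AddMonoidAlgebra k G) :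
    frobeniusComponent hℓ s
        (AddMonoidAlgebra.mapDomainRingHom k (nsmulAddMonoidHom (α := G) ℓ) a * f) =
      a * frobeniusComponent hℓ s f := by
  induction a using AddMonoidAlgebra.induction_linear with
  | zero => simp
  | add x y hx hy => rw [map_add, add_mul, map_add, hx, hy, add_mul]
  | single g r =>
    ext g'
    rw [coeff_frobeniusComponent, AddMonoidAlgebra.mapDomainRingHom_apply,
      AddMonoidAlgebra.mapDomain_single, AddMonoidAlgebra.coeff_single_mul_apply,
      AddMonoidAlgebra.coeff_single_mul_apply, coeff_frobeniusComponent]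
    congr 2
    simp only [nsmulAddMonoidHom_apply, smul_add, smul_neg]
    abel

theorem sum_frobeniusComponent [Fintype (G ⧸ (nsmulAddMonoidHom ℓ : G →+ G).range)]
    (s : G ⧸ (nsmulAddMonoidHom ℓ : G →+ G).range → G) (hs : ∀ c, QuotientAddGroup.mk (s c) = c)
    (f : AddMonoidAlgebra k G) :
    ∑ c, AddMonoidAlgebra.mapDomainRingHom k (nsmulAddMonoidHom (α := G) ℓ)
      (frobeniusComponent hℓ (s c) f) * AddMonoidAlgebra.single (-s c) 1 = f := by
  classical
  induction f using AddMonoidAlgebra.induction_linear with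
  | zero => simp
  | add x y hx hy =>
    conv_rhs => rw [← hx, ← hy]
    simp only [map_add, add_mul, Finset.sum_add_distrib]
  | single g r =>
    -- A monomial `χ^g` has a single nonzero component. Since the basis elements are `χ^(-s c)`, its
    -- index is the class of `-g`.
    have h := hs (QuotientAddGroup.mk (-g))
    rw [QuotientAddGroup.eq] at h
    obtain ⟨g', hg'⟩ := h
    set c₀ : G ⧸ (nsmulAddMonoidHom ℓ : G →+ G).range := QuotientAddGroup.mk (-g)
    have hg : g = ℓ • (-g') - s c₀ := by
      rw [smul_neg, ← nsmulAddMonoidHom_apply, hg']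
      abel
    rw [Finset.sum_eq_single c₀]
    · conv_lhs => rw [hg]
      rw [frobeniusComponent_single, AddMonoidAlgebra.mapDomainRingHom_apply,
        AddMonoidAlgebra.mapDomain_single, AddMonoidAlgebra.single_mul_single, mul_one,
        nsmulAddMonoidHom_apply, ← sub_eq_add_neg, ← hg]
    · intro c _ hc
      rw [frobeniusComponent_single_of_ne hℓ, map_zero, zero_mul]
      intro g'' h
      refine hc ((hs c).symm.trans ?_)
      rw [QuotientAddGroup.eq, ← h]
      exact ⟨-g'', by rw [nsmulAddMonoidHom_apply, smul_neg]; abel⟩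
    · simp

theorem frobeniusComponent_single_neg (s : G) :
    frobeniusComponent hℓ s (AddMonoidAlgebra.single (-s) (1 : k)) = 1 := by
  have h : -s = ℓ • (0 : G) - s := by simp
  rw [h, frobeniusComponent_single]
  rfl

theorem frobeniusComponent_single_neg_of_ne
    (s : G ⧸ (nsmulAddMonoidHom ℓ : G →+ G).range → G) (hs : ∀ c, QuotientAddGroup.mk (s c) = c)
    {c c' : G ⧸ (nsmulAddMonoidHom ℓ : G →+ G).range} (hc : c ≠ c') :
    frobeniusComponent hℓ (s c) (AddMonoidAlgebra.single (-s c') (1 : k)) = 0 := by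
  refine frobeniusComponent_single_of_ne hℓ (fun g' h => hc ?_) 1
  rw [← hs c, ← hs c', QuotientAddGroup.eq]
  refine ⟨-g', ?_⟩
  rw [nsmulAddMonoidHom_apply, smul_neg, sub_eq_iff_eq_add.mp h]
  abel

end GroupAlgebra

/-- Remainders of the coordinates in a basis represent all classes. -/
theorem finite_quotient_range_nsmul (G : Type*) [AddCommGroup G] [Module.Free ℤ G]
    [Module.Finite ℤ G] {ℓ : ℕ} (hℓ : 0 < ℓ) :
    Finite (G ⧸ (nsmulAddMonoidHom ℓ : G →+ G).range) := by
  let b := Module.Free.chooseBasis ℤ G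
  refine Finite.of_surjective (fun w : Module.Free.ChooseBasisIndex ℤ G → Fin ℓ =>
    (QuotientAddGroup.mk (∑ i, (w i : ℤ) • b i) : G ⧸ (nsmulAddMonoidHom ℓ : G →+ G).range)) ?_
  intro c
  obtain ⟨g, rfl⟩ := QuotientAddGroup.mk_surjective c
  have hℓ' : (ℓ : ℤ) ≠ 0 := by omega
  have h0 := fun i => Int.emod_nonneg (b.repr g i) hℓ'
  have h1 := fun i => Int.emod_lt_of_pos (b.repr g i) (by omega : (0 : ℤ) < ℓ)
  refine ⟨fun i => ⟨(b.repr g i % ℓ).toNat, by have := h0 i; have := h1 i; omega⟩, ?_⟩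
  rw [QuotientAddGroup.eq]
  refine ⟨∑ i, (b.repr g i / ℓ) • b i, ?_⟩
  rw [nsmulAddMonoidHom_apply, eq_neg_add_iff_add_eq, Finset.smul_sum, ← Finset.sum_add_distrib]
  conv_rhs => rw [← b.sum_repr g]
  refine Finset.sum_congr rfl fun i _ => ?_
  rw [← natCast_zsmul, smul_smul, ← add_smul]
  congr 1
  simp only [Int.toNat_of_nonneg (h0 i)]
  exact Int.emod_add_mul_ediv _ _

/-! ### The toric Frobenius on the function field -/

namespace SmoothFan

instance {k N : Type u} [Field k] [AddCommGroup N] [Module.Free ℤ N] [Module.Finite ℤ N] :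
    IsIntegrallyClosed (AddMonoidAlgebra k (Module.Dual ℤ N)) := by
  let b := Module.Free.chooseBasis ℤ N
  have : Finite (Module.Free.ChooseBasisIndex ℤ N) := Module.Finite.finite_basis b
  have := (coneRing_noeth (k := k) b (Set.empty_subset _)).2
  let e : dualMonoid (∅ : Set N) ≃+ Module.Dual ℤ N :=
    { toFun := Subtype.val
      invFun := fun m => ⟨m, fun u hu => absurd hu (Set.notMem_empty u)⟩
      left_inv := fun _ => rfl
      right_inv := fun _ => rfl
      map_add' := fun _ _ => rfl }
  exact IsIntegrallyClosed.of_equiv (AddMonoidAlgebra.mapDomainRingEquiv k e)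

theorem nsmul_dual_injective {N : Type*} [AddCommGroup N] {ℓ : ℕ} (hℓ : 0 < ℓ) :
    Function.Injective fun m : Module.Dual ℤ N => ℓ • m :=
  fun m m' h => LinearMap.ext fun v => by
    have h' := congrArg (fun f : Module.Dual ℤ N => f v) h
    simp only [LinearMap.smul_apply, nsmul_eq_mul] at h'
    exact mul_left_cancel₀ (by exact_mod_cast hℓ.ne') h'

variable {N : Type u} [AddCommGroup N] [Module.Free ℤ N] [Module.Finite ℤ N] (Δ : SmoothFan N)
  (k : Type u) [Field k]

theorem toTorus_bijective : Function.Bijective Δ.toTorus :=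
  ⟨fun _ _ h => congrArg Subtype.val h, fun m => ⟨m.1, rfl⟩⟩

/-- The group algebra `k[M]`, embedded into the function field. -/
noncomputable def torusEmb :
    AddMonoidAlgebra k (Module.Dual ℤ N) →+* (Δ.toricVariety k).functionField :=
  (Δ.ringEmb k Δ.zeroCone).comp (AddMonoidAlgebra.mapDomainRingHom k Δ.toTorus)

theorem torusEmb_single (m : Module.Dual ℤ N) (r : k) :
    Δ.torusEmb k (AddMonoidAlgebra.single m r) = Δ.scalar k r * Δ.character k m := by
  rw [torusEmb, RingHom.comp_apply, AddMonoidAlgebra.mapDomainRingHom_apply,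
    AddMonoidAlgebra.mapDomain_single, ringEmb_single]
  rfl

theorem torusEmb_injective : Function.Injective (Δ.torusEmb k) :=
  (Δ.ringEmb_injective k _).comp (AddMonoidAlgebra.mapDomain_injective Δ.toTorus_bijective.1)

theorem exists_torusEmb_eq (a : coneRing k ((Δ.zeroCone).1 : Set N)) :
    ∃ a', Δ.torusEmb k a' = Δ.ringEmb k Δ.zeroCone a := by
  induction a using AddMonoidAlgebra.induction_linear with
  | zero => exact ⟨0, by simp⟩
  | add x y hx hy =>
    obtain ⟨x', hx⟩ := hx
    obtain ⟨y', hy⟩ := hy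
    exact ⟨x' + y', by rw [map_add, hx, hy, map_add]⟩
  | single m r => exact ⟨AddMonoidAlgebra.single m.1 r, by rw [torusEmb_single, ringEmb_single]⟩

/-- The torus is a dense open chart. Its ring is replaced by `k[M]` itself, where exponents may be
translated freely. -/
theorem isFractionRing_torusEmb :
    @IsFractionRing (AddMonoidAlgebra k (Module.Dual ℤ N)) _ (Δ.toricVariety k).functionField _
      (Δ.torusEmb k).toAlgebra := by
  let := (Δ.torusEmb k).toAlgebra
  have : FaithfulSMul (AddMonoidAlgebra k (Module.Dual ℤ N)) (Δ.toricVariety k).functionField :=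
    (faithfulSMul_iff_algebraMap_injective _ _).mpr (Δ.torusEmb_injective k)
  refine IsFractionRing.of_field _ _ fun g => ?_
  obtain ⟨a, b, hb, h⟩ := (Δ.specChart k Δ.zeroCone).exists_chartEmbedding_mul_eq g
  obtain ⟨a', ha'⟩ := Δ.exists_torusEmb_eq k a
  obtain ⟨b', hb'⟩ := Δ.exists_torusEmb_eq k b
  refine ⟨a', b', ?_⟩
  change g = Δ.torusEmb k a' / Δ.torusEmb k b'
  rw [ha', hb', eq_div_iff ((map_ne_zero_iff _ (Δ.ringEmb_injective k _)).mpr hb), mul_comm]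
  exact h

variable (ℓ : ℕ)

/-- The ring homomorphism of the toric Frobenius morphism on a chart. -/
noncomputable def frobHom (σ : Δ.Cone) : coneRing k (σ.1 : Set N) →+* coneRing k (σ.1 : Set N) :=
  AddMonoidAlgebra.mapDomainRingHom k (nsmulAddMonoidHom (α := dualMonoid (σ.1 : Set N)) ℓ)

theorem specChart_toricFrobenius (σ : Δ.Cone) :
    Δ.specChart k σ ≫ Δ.toricFrobenius k ℓ =
      Spec.map (CommRingCat.ofHom (Δ.frobHom k ℓ σ)) ≫ Δ.specChart k σ :=
  ι_colimMap _ _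

theorem toricFrobenius_specChart (σ : Δ.Cone) (y : Spec (Δ.chartRing k σ)) :
    Δ.toricFrobenius k ℓ (Δ.specChart k σ y) =
      Δ.specChart k σ (Spec.map (CommRingCat.ofHom (Δ.frobHom k ℓ σ)) y) := by
  rw [← Scheme.Hom.comp_apply, specChart_toricFrobenius, Scheme.Hom.comp_apply]

variable {ℓ} (hℓ : 0 < ℓ)

include hℓ in
theorem frobHom_injective (σ : Δ.Cone) : Function.Injective (Δ.frobHom k ℓ σ) :=
  AddMonoidAlgebra.mapDomain_injective fun _ _ h =>
    Subtype.ext (nsmul_dual_injective hℓ (congrArg Subtype.val h))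

-- Dominance of the Frobenius on a chart: the ring map is injective, so the zero ideal pulls back to
-- itself.
include hℓ in
theorem specMap_frobHom_genericPoint (σ : Δ.Cone) :
    Spec.map (CommRingCat.ofHom (Δ.frobHom k ℓ σ)) (genericPoint (Spec (Δ.chartRing k σ))) =
      genericPoint (Spec (Δ.chartRing k σ)) := by
  rw [genericPoint_eq_bot_of_affine]
  apply PrimeSpectrum.ext
  exact (RingHom.ker_eq_bot_iff_eq_zero (Δ.frobHom k ℓ σ)).mpr fun a ha =>
    Δ.frobHom_injective k hℓ σ (ha.trans (map_zero _).symm)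

include hℓ in
theorem toricFrobenius_genericPoint :
    Δ.toricFrobenius k ℓ (genericPoint (Δ.toricVariety k)) = genericPoint (Δ.toricVariety k) := by
  have h := genericPoint_eq_of_isOpenImmersion (Δ.specChart k Δ.zeroCone)
  rw [← h, toricFrobenius_specChart]
  exact congrArg _ (Δ.specMap_frobHom_genericPoint k hℓ _)

/-- The toric Frobenius morphism on the function field. -/
noncomputable def frobField :
    (Δ.toricVariety k).functionField →+* (Δ.toricVariety k).functionField :=
  (Δ.toricFrobenius k ℓ).functionFieldMap (Δ.toricFrobenius_genericPoint k hℓ)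

theorem frobField_ringEmb (σ : Δ.Cone) (a : coneRing k (σ.1 : Set N)) :
    Δ.frobField k hℓ (Δ.ringEmb k σ a) = Δ.ringEmb k σ (Δ.frobHom k ℓ σ a) := by
  have h := genericPoint_eq_of_isOpenImmersion (Δ.specChart k σ)
  have hF := Δ.toricFrobenius_genericPoint k hℓ
  have hs := Δ.specMap_frobHom_genericPoint k hℓ σ
  have e := Δ.specChart_toricFrobenius k ℓ σ
  have hc : (Δ.specChart k σ ≫ Δ.toricFrobenius k ℓ) (genericPoint _) = genericPoint _ := by
    rw [Scheme.Hom.comp_apply, h, hF]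
  apply ((Δ.specChart k σ).functionFieldMap_bijective h).1
  refine ((Scheme.Hom.functionFieldMap_comp _ hF _ h hc _).symm.trans ?_).trans
    ((Δ.specChart k σ).functionFieldMap_chartEmbedding _ h).symm
  rw [Scheme.Hom.functionFieldMap_congr e hc (e ▸ hc),
    Scheme.Hom.functionFieldMap_comp _ h _ hs]
  refine (congrArg _ ((Δ.specChart k σ).functionFieldMap_chartEmbedding a h)).trans ?_
  exact Scheme.functionFieldMap_specToFunctionField _ hs a

theorem frobField_character (m : Module.Dual ℤ N) :
    Δ.frobField k hℓ (Δ.character k m) = Δ.character k (ℓ • m) := by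
  rw [character, frobField_ringEmb, frobHom, AddMonoidAlgebra.mapDomainRingHom_apply,
    AddMonoidAlgebra.mapDomain_single]
  rfl

theorem frobField_scalar (r : k) : Δ.frobField k hℓ (Δ.scalar k r) = Δ.scalar k r := by
  rw [scalar, RingHom.comp_apply, frobField_ringEmb, frobHom]
  congr 1
  rw [AddMonoidAlgebra.coe_algebraMap]
  simp

theorem frobField_torusEmb (a : AddMonoidAlgebra k (Module.Dual ℤ N)) :
    Δ.frobField k hℓ (Δ.torusEmb k a) = Δ.torusEmb k
      (AddMonoidAlgebra.mapDomainRingHom k (nsmulAddMonoidHom (α := Module.Dual ℤ N) ℓ) a) := by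
  induction a using AddMonoidAlgebra.induction_linear with
  | zero => simp
  | add x y hx hy => rw [map_add, map_add, map_add, map_add, hx, hy]
  | single m r =>
    rw [torusEmb_single, map_mul, frobField_scalar, frobField_character,
      AddMonoidAlgebra.mapDomainRingHom_apply, AddMonoidAlgebra.mapDomain_single, torusEmb_single]
    rfl

/-- The coordinates of the function field over its image under the toric Frobenius, with respect to
the basis `χ^{-s_c}`, `c ∈ M/ℓM`. -/
theorem exists_frobenius_coordinates
    [Fintype (Module.Dual ℤ N ⧸ (nsmulAddMonoidHom ℓ : Module.Dual ℤ N →+ Module.Dual ℤ N).range)]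
    (s : (Module.Dual ℤ N ⧸ (nsmulAddMonoidHom ℓ : Module.Dual ℤ N →+ Module.Dual ℤ N).range) →
        Module.Dual ℤ N) (hs : ∀ c, QuotientAddGroup.mk (s c) = c) :
    ∃ P : (Module.Dual ℤ N ⧸ (nsmulAddMonoidHom ℓ : Module.Dual ℤ N →+ Module.Dual ℤ N).range) →
        (Δ.toricVariety k).functionField →+ (Δ.toricVariety k).functionField,
      (∀ c x f, P c (Δ.frobField k hℓ x * f) = x * P c f) ∧
      (∀ c b, P c (Δ.torusEmb k b) =
        Δ.torusEmb k (frobeniusComponent (nsmul_dual_injective hℓ) (s c) b)) ∧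
      ∀ f, ∑ c, Δ.frobField k hℓ (P c f) * Δ.character k (-s c) = f := by
  let := (Δ.torusEmb k).toAlgebra
  have := Δ.isFractionRing_torusEmb k
  -- Source and target are the same rings, and the module structure is through the endomorphism `χ^m
  -- ↦ χ^(ℓm)`.
  obtain ⟨P, h1, h2, h3⟩ := exists_fractionField_coordinates
    (A := AddMonoidAlgebra k (Module.Dual ℤ N)) (B := AddMonoidAlgebra k (Module.Dual ℤ N))
    (K := (Δ.toricVariety k).functionField) (L := (Δ.toricVariety k).functionField)
    (AddMonoidAlgebra.mapDomainRingHom k (nsmulAddMonoidHom (α := Module.Dual ℤ N) ℓ))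
    (Δ.frobField k hℓ) (Δ.frobField_torusEmb k hℓ)
    (fun c => AddMonoidAlgebra.single (-s c) 1)
    (fun c => frobeniusComponent (nsmul_dual_injective hℓ) (s c))
    (fun c a b => frobeniusComponent_mul _ _ _ _)
    (fun c => frobeniusComponent_single_neg _ _)
    (fun c c' h => frobeniusComponent_single_neg_of_ne _ s hs h)
    (sum_frobeniusComponent _ s hs)
    (AddMonoidAlgebra.mapDomain_injective (nsmul_dual_injective hℓ))
  refine ⟨P, h1, h2, fun f => ?_⟩
  conv_rhs => rw [← h3 f]
  refine Finset.sum_congr rfl fun c _ => ?_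
  congr 1
  refine Eq.trans ?_ (Δ.torusEmb_single k (-s c) 1).symm
  rw [map_one, one_mul]

end SmoothFan

/-! ### Morphisms between the sheaves 𝒪(D) -/

namespace AlgebraicGeometry.Scheme.Modules

variable {X : Scheme.{u}}

/-- A morphism of sheaves of modules, from linear maps on sections that commute with restriction. -/
noncomputable def homMk {M N : X.Modules} (φ : ∀ U : X.Opens, Γ(M, U) →+ Γ(N, U))
    (hsmul : ∀ (U : X.Opens) (r : Γ(X, U)) (s : Γ(M, U)), φ U (r • s) = r • φ U s)
    (hnat : ∀ (U V : X.Opens) (i : V ⟶ U) (s : Γ(M, U)),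
      φ V (M.presheaf.map i.op s) = N.presheaf.map i.op (φ U s)) : M ⟶ N where
  val := PresheafOfModules.homMk
    { app := fun U => AddCommGrpCat.ofHom (φ U.unop)
      naturality := fun U V i => by
        ext s
        exact hnat U.unop V.unop i.unop s } fun U r s => hsmul U.unop r s

end AlgebraicGeometry.Scheme.Modules

namespace WeilDivisor

/-- Germs determine a section, and stalks embed into the function field. The form with all `x : U`
also covers the empty open set. -/
theorem section_eq_of_algebraMap_germ_eq {X : Scheme.{u}} [IsIntegral X] {U : X.Opens} (r r' : Γ(X, U))
    (h : ∀ x : U, algebraMap (X.presheaf.stalk x.1) X.functionField (X.presheaf.germ U x.1 x.2 r) =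
      algebraMap _ _ (X.presheaf.germ U x.1 x.2 r')) : r = r' := by
  refine TopCat.Presheaf.section_ext X.sheaf U r r' fun x hx => ?_
  exact IsFractionRing.injective (X.presheaf.stalk x) X.functionField (h ⟨x, hx⟩)

variable {X : Scheme.{u}} [IsIntegral X] [IsLocallyNoetherian X] [RegularInCodimOne X]

/-- Multiplication by a rational function, as a map between sections of sheaves of divisors. -/
noncomputable def mulSections (D D' : WeilDivisor X) (U : X.Opens) (g : X.functionField) (hg : g ≠ 0)
    (h : ∀ x : {x : X // Order.coheight x = 1}, x.1 ∈ U → D x ≤ D' x + Scheme.ord g x.1) :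
    D.sections U →+ D'.sections U where
  toFun s := ⟨fun x => g * s.1 x, fun x y => congrArg (g * ·) (s.2.1 x y), fun x hx => by
    rcases s.2.2 x hx with h0 | h1
    · exact Or.inl (mul_eq_zero_of_right g h0)
    · by_cases h0 : s.1 x = 0
      · exact Or.inl (mul_eq_zero_of_right g h0)
      · right
        change _ ≤ Scheme.ord (g * s.1 x) x.1
        rw [Scheme.ord_mul hg h0]
        have := h ⟨x.1, hx⟩ x.2
        simp only at this
        omega⟩
  map_zero' := Subtype.ext (funext fun x => mul_zero g)
  map_add' s t := Subtype.ext (funext fun x => mul_add g _ _)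

/-- Multiplication by a rational function, as a morphism of sheaves. -/
noncomputable def mulHom (D D' : WeilDivisor X) (g : X.functionField) (hg : g ≠ 0)
    (h : ∀ x : {x : X // Order.coheight x = 1}, D x ≤ D' x + Scheme.ord g x.1) :
    D.sheaf ⟶ D'.sheaf :=
  Scheme.Modules.homMk (fun U => mulSections D D' U g hg fun x _ => h x)
    (fun U r s => Subtype.ext (funext fun x => mul_smul_comm (X.presheaf.germ U x.1 x.2 r) g (s.1 x)))
    (fun _ _ _ _ => rfl)

/-- Linearly equivalent divisors have isomorphic sheaves. -/
theorem LinEquiv.nonempty_iso {D D' : WeilDivisor X} (h : D.LinEquiv D') :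
    Nonempty (D.sheaf ≅ D'.sheaf) := by
  obtain ⟨g, hg, h⟩ := h
  have h1 : ∀ x, D x ≤ D' x + Scheme.ord g x.1 := fun x => by
    rw [← h x, Finsupp.sub_apply]; omega
  have h2 : ∀ x, D' x ≤ D x + Scheme.ord g⁻¹ x.1 := fun x => by
    rw [Scheme.ord_inv, ← h x, Finsupp.sub_apply]; omega
  exact ⟨{
    hom := mulHom D D' g hg h1
    inv := mulHom D' D g⁻¹ (inv_ne_zero hg) h2
    hom_inv_id := Scheme.Modules.hom_ext _ _ fun U => by
      ext s
      exact Subtype.ext (funext fun x => inv_mul_cancel_left₀ hg (s.1 x))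
    inv_hom_id := Scheme.Modules.hom_ext _ _ fun U => by
      ext s
      exact Subtype.ext (funext fun x => mul_inv_cancel_left₀ hg (s.1 x)) }⟩

/-- A divisor that is principal on an open subset has a sheaf that is isomorphic to the structure
sheaf there. -/
theorem nonempty_restrict_iso (D D' : WeilDivisor X) (U : X.Opens) (g : X.functionField) (hg : g ≠ 0)
    (h : ∀ x : {x : X // Order.coheight x = 1}, x.1 ∈ U → D x = D' x + Scheme.ord g x.1) :
    Nonempty (D.sheaf.restrict U.ι ≅ D'.sheaf.restrict U.ι) := by
  have hU : ∀ V : U.toScheme.Opens, ∀ x ∈ U.ι ''ᵁ V, x ∈ U := fun V x hx => by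
    obtain ⟨y, -, rfl⟩ := hx
    exact y.2
  have h1 := fun (V : U.toScheme.Opens) (x : {x : X // Order.coheight x = 1})
    (hx : x.1 ∈ U.ι ''ᵁ V) => (h x (hU V _ hx)).le
  have h2 := fun (V : U.toScheme.Opens) (x : {x : X // Order.coheight x = 1})
    (hx : x.1 ∈ U.ι ''ᵁ V) =>
    show D' x ≤ D x + Scheme.ord g⁻¹ x.1 by rw [Scheme.ord_inv, h x (hU V _ hx)]; omega
  exact ⟨{
    hom := Scheme.Modules.homMk (M := D.sheaf.restrict U.ι) (N := D'.sheaf.restrict U.ι)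
      (fun V => mulSections D D' (U.ι ''ᵁ V) g hg (h1 V))
      (fun V r s => Subtype.ext (funext fun x =>
        mul_smul_comm (X.presheaf.germ _ x.1 x.2 ((U.ι.appIso V).inv r)) g (s.1 x)))
      (fun _ _ _ _ => rfl)
    inv := Scheme.Modules.homMk (M := D'.sheaf.restrict U.ι) (N := D.sheaf.restrict U.ι)
      (fun V => mulSections D' D (U.ι ''ᵁ V) g⁻¹ (inv_ne_zero hg) (h2 V))
      (fun V r s => Subtype.ext (funext fun x =>
        mul_smul_comm (X.presheaf.germ _ x.1 x.2 ((U.ι.appIso V).inv r)) g⁻¹ (s.1 x)))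
      (fun _ _ _ _ => rfl)
    hom_inv_id := Scheme.Modules.hom_ext _ _ fun V => by
      ext s
      exact Subtype.ext (funext fun x => inv_mul_cancel_left₀ hg (s.1 x))
    inv_hom_id := Scheme.Modules.hom_ext _ _ fun V => by
      ext s
      exact Subtype.ext (funext fun x => mul_inv_cancel_left₀ hg (s.1 x)) }⟩

/-- Regular functions are sections of `𝒪(0)`. -/
noncomputable def unitSections (U : X.Opens) : Γ(X, U) →+ (0 : WeilDivisor X).sections U where
  toFun r := ⟨fun x => algebraMap (X.presheaf.stalk x.1) _ (X.presheaf.germ U x.1 x.2 r),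
    fun x y => by
      have := germ_smul_eq r x y 1
      rwa [Algebra.smul_def, Algebra.smul_def, mul_one, mul_one] at this,
    fun x hx => by
      have := (0 : WeilDivisor X).ord_smul_ge ⟨x.1, hx⟩ (X.presheaf.germ U x.1 x.2 r)
        (f := 1) (Or.inr (by rw [Scheme.ord_one]; rfl))
      rwa [Algebra.smul_def, mul_one] at this⟩
  map_zero' := Subtype.ext (funext fun x => by simp)
  map_add' r r' := Subtype.ext (funext fun x => by simp)

variable (X) in
/-- The structure sheaf as a sheaf of modules. -/
noncomputable def structureModule : X.Modules := SheafOfModules.unit X.ringCatSheaf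

variable (X) in
/-- The morphism from the structure sheaf to `𝒪(0)`. -/
noncomputable def unitHom :
    structureModule X ⟶ (0 : WeilDivisor X).sheaf :=
  Scheme.Modules.homMk (M := structureModule X) (fun U => unitSections U)
    (fun U r (s : Γ(X, U)) => Subtype.ext (funext fun x => by
      change algebraMap _ _ (X.presheaf.germ U x.1 x.2 (r * s)) =
        X.presheaf.germ U x.1 x.2 r • algebraMap _ _ (X.presheaf.germ U x.1 x.2 s)
      rw [map_mul, map_mul, Algebra.smul_def]))
    (fun U V i s => Subtype.ext (funext fun x =>
      congrArg (algebraMap _ _) (X.presheaf.germ_res_apply i x.1 x.2 s)))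

/-- If rational functions without poles at the points of codimension one are regular, then `𝒪(0)` is
the structure sheaf. -/
theorem isIso_unitHom (H : ∀ (x : X) (g : X.functionField),
    (∀ z : X, Order.coheight z = 1 → z ⤳ x → g = 0 ∨ 0 ≤ Scheme.ord g z) →
      ∃ t : X.presheaf.stalk x, algebraMap _ X.functionField t = g) : IsIso (unitHom X) := by
  rw [Scheme.Modules.Hom.isIso_iff_isIso_app]
  intro U
  rw [ConcreteCategory.isIso_iff_bijective]
  change Function.Bijective (unitSections U)
  refine ⟨fun r r' h => section_eq_of_algebraMap_germ_eq r r' fun x =>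
    congrFun (congrArg Subtype.val h) x, fun s => ?_⟩
  -- By `H` the rational function comes from the stalk at each point of `U`, hence from regular
  -- functions on a cover; these agree on overlaps because they agree in the function field.
  have hloc : ∀ x : U, ∃ (V : X.Opens) (hxV : x.1 ∈ V) (hVU : V ≤ U) (r : Γ(X, V)),
      ∀ z (hz : z ∈ V), algebraMap (X.presheaf.stalk z) X.functionField
        (X.presheaf.germ V z hz r) = s.1 ⟨z, hVU hz⟩ := fun x => by
    obtain ⟨t, ht⟩ := H x.1 (s.1 x) fun z hz hzx => by
      have hzU : z ∈ U := hzx.mem_open U.isOpen x.2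
      have := s.2.2 ⟨z, hzU⟩ hz
      rwa [s.2.1 ⟨z, hzU⟩ x, Finsupp.zero_apply, neg_zero] at this
    obtain ⟨V, hxV, r, rfl⟩ := X.presheaf.exists_germ_eq t
    refine ⟨V ⊓ U, ⟨hxV, x.2⟩, inf_le_right, X.presheaf.map (homOfLE inf_le_left).op r,
      fun z hz => ?_⟩
    have : Nonempty V := ⟨⟨x, hxV⟩⟩
    rw [X.presheaf.germ_res_apply, s.2.1 _ x, ← ht,
      Scheme.algebraMap_germ_eq_germToFunctionField X hz.1,
      Scheme.algebraMap_germ_eq_germToFunctionField X hxV]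
  choose V hxV hVU r hr using hloc
  obtain ⟨r', hr', -⟩ := X.sheaf.existsUnique_gluing' V U (fun x => homOfLE (hVU x))
    (fun x hx => TopologicalSpace.Opens.mem_iSup.mpr ⟨⟨x, hx⟩, hxV ⟨x, hx⟩⟩) r fun x y => by
      refine section_eq_of_algebraMap_germ_eq _ _ fun z => ?_
      change algebraMap _ _ (X.presheaf.germ _ z.1 z.2 (X.presheaf.map _ _)) =
        algebraMap _ _ (X.presheaf.germ _ z.1 z.2 (X.presheaf.map _ _))
      rw [X.presheaf.germ_res_apply, X.presheaf.germ_res_apply, hr, hr]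
  refine ⟨r', Subtype.ext (funext fun x => ?_)⟩
  change algebraMap _ _ (X.presheaf.germ U x.1 x.2 r') = _
  rw [← hr x x.1 (hxV x), ← hr' x]
  congr 1
  exact (X.presheaf.germ_res_apply (homOfLE (hVU x)) x.1 (hxV x) r').symm

end WeilDivisor

/-! ### Units of group algebras -/

theorem AddMonoidAlgebra.exists_eq_single_of_mul_eq_one {k G : Type*} [Field k] [AddCommGroup G]
    [TwoUniqueSums G] {p q : AddMonoidAlgebra k G} (h : p * q = 1) :
    ∃ m r, r ≠ 0 ∧ p = AddMonoidAlgebra.single m r := by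
  classical
  have hp : p ≠ 0 := left_ne_zero_of_mul_eq_one h
  have hq : q ≠ 0 := right_ne_zero_of_mul_eq_one h
  have hp' : p.coeff.support.card ≠ 0 := by simpa using hp
  have hq' : q.coeff.support.card ≠ 0 := by simpa using hq
  have hcard : p.coeff.support.card * q.coeff.support.card ≤ 1 := by
    by_contra! hlt
    -- Two different pairs of exponents would have uniquely attained sums. No cancellation occurs at
    -- such a sum, so it must be the exponent `0` of `1`; two pairs with the same unique sum are
    -- equal.
    obtain ⟨x, hx, y, hy, hxy, hux, huy⟩ := TwoUniqueSums.uniqueAdd_of_one_lt_card hlt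
    rw [Finset.mem_product] at hx hy
    have key : ∀ z : G × G, z.1 ∈ p.coeff.support → z.2 ∈ q.coeff.support →
        UniqueAdd p.coeff.support q.coeff.support z.1 z.2 → z.1 + z.2 = 0 := fun z h1 h2 hz => by
      by_contra hne
      have h3 := AddMonoidAlgebra.coeff_mul_add_of_uniqueAdd hz
      rw [h, AddMonoidAlgebra.one_def, AddMonoidAlgebra.coeff_single,
        Finsupp.single_eq_of_ne hne] at h3
      exact mul_ne_zero (Finsupp.mem_support_iff.mp h1) (Finsupp.mem_support_iff.mp h2) h3.symm
    have h1 := hux hy.1 hy.2 ((key y hy.1 hy.2 huy).trans (key x hx.1 hx.2 hux).symm)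
    exact hxy (Prod.ext h1.1.symm h1.2.symm)
  have hone : p.coeff.support.card = 1 := by
    have := Nat.pos_of_ne_zero hq'
    have := Nat.pos_of_ne_zero hp'
    nlinarith
  obtain ⟨m, r, hr, hm⟩ := Finsupp.card_support_eq_one'.mp hone
  exact ⟨m, r, hr, AddMonoidAlgebra.coeff_injective hm⟩

instance {N : Type u} [AddCommGroup N] [Module.Free ℤ N] : TwoUniqueSums (Module.Dual ℤ N) := by
  let b := Module.Free.chooseBasis ℤ N
  let f : Module.Dual ℤ N →+ (Module.Free.ChooseBasisIndex ℤ N → ℤ) :=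
    { toFun := fun m i => m (b i), map_zero' := rfl, map_add' := fun _ _ => rfl }
  exact TwoUniqueSums.of_injective_addHom f.toAddHom
    (fun _ _ h => b.ext fun i => congrFun h i) inferInstance

/-! ### Line bundles and linear equivalence on the toric variety -/

namespace SmoothFan

variable {N : Type u} [AddCommGroup N] [Module.Free ℤ N] [Module.Finite ℤ N] (Δ : SmoothFan N)
  (k : Type u) [Field k]

theorem exists_specChart (x : Δ.toricVariety k) :
    ∃ (σ : Δ.Cone) (y : Spec (Δ.chartRing k σ)), Δ.specChart k σ y = x :=
  Δ.exists_chart k x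

theorem toricDivisor_zero : Δ.toricDivisor k 0 = 0 := by
  simp [toricDivisor]

/-- A rational function without poles in codimension one near a point is regular at the point. -/
theorem exists_algebraMap_stalk_eq (x : Δ.toricVariety k) (g : (Δ.toricVariety k).functionField)
    (hg : ∀ z : Δ.toricVariety k, Order.coheight z = 1 → z ⤳ x → g = 0 ∨ 0 ≤ Scheme.ord g z) :
    ∃ t : (Δ.toricVariety k).presheaf.stalk x,
      algebraMap _ (Δ.toricVariety k).functionField t = g := by
  obtain ⟨σ, y, rfl⟩ := Δ.exists_specChart k x
  -- The local description of `𝒪(D)` is applied with `D = 0`, whose local equation is `χ^0 = 1`.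
  obtain ⟨p, q, hq, h⟩ := Δ.exists_ringEmb_mul_eq k σ 0 0 (fun _ _ => rfl) y g fun z hz => by
    rw [toricDivisor_zero]
    exact hg z.1 z.2 hz
  rw [character_zero, one_mul] at h
  obtain ⟨u, hu⟩ := ((Δ.specChart k σ).isUnit_chartToStalk_iff y q).mpr hq
  have hq0 : Δ.ringEmb k σ q ≠ 0 := (map_ne_zero_iff _ (Δ.ringEmb_injective k σ)).mpr fun h0 =>
    hq (h0 ▸ y.asIdeal.zero_mem)
  refine ⟨(Δ.specChart k σ).chartToStalk y p * (u⁻¹ : Units _), mul_left_cancel₀ hq0 ?_⟩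
  refine Eq.trans ?_ h.symm
  have e1 := (Δ.specChart k σ).algebraMap_chartToStalk y p
  have e2 := (Δ.specChart k σ).algebraMap_chartToStalk y q
  refine (congrArg (· * _) e2.symm).trans (Eq.trans ?_ e1)
  rw [← map_mul, ← hu, mul_comm, mul_assoc, Units.inv_mul, mul_one]

theorem nonempty_structureModule_iso : Nonempty
    (WeilDivisor.structureModule (Δ.toricVariety k) ≅
      (0 : WeilDivisor (Δ.toricVariety k)).sheaf) := by
  have := WeilDivisor.isIso_unitHom (Δ.exists_algebraMap_stalk_eq k)
  exact ⟨asIso (WeilDivisor.unitHom (Δ.toricVariety k))⟩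

/-- On each chart the divisor has a character as equation, so multiplication by it identifies the
sheaf with `𝒪(0)`, which is the structure sheaf. -/
theorem isLineBundle_toricDivisor (a : Δ.Ray → ℤ) : IsLineBundle (Δ.toricDivisor k a).sheaf := by
  intro x
  obtain ⟨σ, y, rfl⟩ := Δ.exists_specChart k x
  obtain ⟨n, hn⟩ := Δ.exists_dual_eq_on σ a
  let U := (Δ.specChart k σ).opensRange
  refine ⟨U, ⟨y, rfl⟩, ?_⟩
  obtain ⟨e⟩ := WeilDivisor.nonempty_restrict_iso (Δ.toricDivisor k a) 0 U (Δ.character k n)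
    (Δ.character_ne_zero k n) fun x hx => by
      obtain ⟨x, hx1⟩ := x
      obtain ⟨y, rfl⟩ := hx
      rw [Finsupp.zero_apply, zero_add]
      exact (Δ.ord_character_eq_toricDivisor k σ a n hn y hx1).symm
  obtain ⟨e'⟩ := Δ.nonempty_structureModule_iso k
  exact ⟨e ≪≫ (Scheme.Modules.restrictFunctor U.ι).mapIso e'.symm ≪≫
    Scheme.Modules.restrictUnitIso U.ι⟩

/-- A codimension one point of a factorial chart is cut out by a rational function in the chart. -/
theorem exists_ord_eq_ite (σ : Δ.Cone) (y : Spec (Δ.chartRing k σ))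
    (hy : Order.coheight (Δ.specChart k σ y) = 1) : ∃ g : (Δ.toricVariety k).functionField, g ≠ 0 ∧
      Scheme.ord g (Δ.specChart k σ y) = 1 ∧ ∀ z : Spec (Δ.chartRing k σ),
        Order.coheight (Δ.specChart k σ z) = 1 → Δ.specChart k σ z ≠ Δ.specChart k σ y →
          Scheme.ord g (Δ.specChart k σ z) = 0 := by
  have hP : y.asIdeal.IsPrime := PrimeSpectrum.isPrime y
  have hy' := (Scheme.coheight_chart (Δ.specChart k σ) y).symm.trans hy
  have hy0 : y.asIdeal ≠ ⊥ := fun h => by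
    rw [Ideal.height_eq_zero_iff_eq_bot.mpr h] at hy'
    exact zero_ne_one hy'
  -- In a factorial ring a nonzero prime ideal contains a prime element; by height one it is
  -- generated by it, as is every other height one prime containing `p`.
  obtain ⟨p, hpy, hp⟩ := hP.exists_mem_prime_of_ne_bot hy0
  have hpr : (Ideal.span {p}).IsPrime := (Ideal.span_singleton_prime hp.ne_zero).mpr hp
  have h1 := Scheme.height_span_singleton_prime hp
  have hf : (Ideal.span {p}).FiniteHeight := ⟨Or.inr (by rw [h1]; exact ENat.one_ne_top)⟩
  have key : ∀ z : Spec (Δ.chartRing k σ), Order.coheight (Δ.specChart k σ z) = 1 →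
      p ∈ z.asIdeal → Ideal.span {p} = z.asIdeal := fun z hz hpz =>
    Ideal.eq_of_le_of_height_le _ ((Ideal.span_singleton_le_iff_mem _).mpr hpz) <| by
      rw [h1, ← hz]
      exact (Scheme.coheight_chart (Δ.specChart k σ) z).ge
  refine ⟨(Δ.specChart k σ).chartEmbedding p,
    (map_ne_zero_iff _ (Δ.specChart k σ).chartEmbedding_injective).mpr hp.ne_zero,
    Scheme.ord_chartEmbedding_eq_one (Δ.specChart k σ) y hy hp.ne_zero (key y hy hpy).symm,
    fun z hz hzy => ?_⟩
  refine (Scheme.ord_chartEmbedding_eq_zero_iff (Δ.specChart k σ) z hz hp.ne_zero).mpr fun hpz =>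
    hzy ?_
  congr 1
  exact PrimeSpectrum.ext ((key z hz hpz).symm.trans (key y hy hpy))

theorem exists_primeDivisor_or_zeroCone (x : {x : Δ.toricVariety k // Order.coheight x = 1}) :
    (∃ ρ, x = Δ.primeDivisor k ρ) ∨ ∃ z, x.1 = Δ.specChart k Δ.zeroCone z := by
  obtain ⟨x, hx⟩ := x
  obtain ⟨σ, y, rfl⟩ := Δ.exists_specChart k x
  rcases Δ.exists_primeDivisor_or_torus k σ y hx with ⟨ρ, -, h⟩ | h
  · exact Or.inl ⟨ρ, Subtype.ext h⟩
  · exact Or.inr h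

/-- Every divisor is linearly equivalent to a torus invariant one. -/
theorem exists_linEquiv_toricDivisor (D : WeilDivisor (Δ.toricVariety k)) :
    ∃ a, D.LinEquiv (Δ.toricDivisor k a) := by
  classical
  let T : Set {x : Δ.toricVariety k // Order.coheight x = 1} :=
    {x | ∃ z, x.1 = Δ.specChart k Δ.zeroCone z}
  have hT : ∀ x : {x : Δ.toricVariety k // Order.coheight x = 1}, ∃ g : (Δ.toricVariety k).functionField,
      g ≠ 0 ∧ ∀ x' ∈ T, x ∈ T → Scheme.ord g x'.1 = if x = x' then 1 else 0 := by
    rintro ⟨x, hx⟩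
    by_cases hxT : ∃ z, x = Δ.specChart k Δ.zeroCone z
    · obtain ⟨y, rfl⟩ := hxT
      obtain ⟨g, hg, h1, h0⟩ := Δ.exists_ord_eq_ite k _ y hx
      refine ⟨g, hg, ?_⟩
      rintro ⟨_, hx'⟩ ⟨y', rfl⟩ -
      split_ifs with h
      · rw [← h1]
        exact congrArg (Scheme.ord g) (congrArg Subtype.val h).symm
      · exact h0 y' hx' fun e => h (Subtype.ext e.symm)
    · exact ⟨1, one_ne_zero, fun _ _ h => absurd h hxT⟩
  choose g hg0 hg using hT
  -- Each prime divisor meeting the torus has an equation there, without further zeros or poles on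
  -- the torus. The product has the same divisor as `D` on the torus, so that `D - div f` is
  -- supported on the `D_ρ`.
  let f := ∏ x ∈ D.support with x ∈ T, g x ^ D x
  have hf0 : f ≠ 0 := Finset.prod_ne_zero_iff.mpr fun x _ => zpow_ne_zero _ (hg0 x)
  refine ⟨fun ρ => D (Δ.primeDivisor k ρ) - Scheme.ord f (Δ.primeDivisor k ρ).1, f, hf0, fun x => ?_⟩
  rw [Finsupp.sub_apply]
  rcases Δ.exists_primeDivisor_or_zeroCone k x with ⟨ρ, rfl⟩ | hx
  · rw [toricDivisor_apply_primeDivisor]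
    ring
  · rw [toricDivisor_apply_of_notMem, sub_zero, Scheme.ord_prod _ _ _ fun x _ => zpow_ne_zero _ (hg0 x)]
    · have h1 : ∀ x' ∈ D.support.filter (· ∈ T), Scheme.ord (g x' ^ D x') x.1 =
          if x' = x then D x' else 0 := fun x' hx' => by
        rw [Scheme.ord_zpow _ (hg0 x'), hg x' x hx (Finset.mem_filter.mp hx').2]
        split_ifs <;> simp
      rw [Finset.sum_congr rfl h1, Finset.sum_ite_eq']
      split_ifs with h
      · rfl
      · by_contra hD
        exact h (Finset.mem_filter.mpr ⟨Finsupp.mem_support_iff.mpr hD, hx⟩)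
    · rintro ρ rfl
      obtain ⟨z, hz⟩ := hx
      exact Δ.specChart_zeroCone_ne_primeDivisor k z ρ hz.symm

theorem isLineBundle_sheaf (E : WeilDivisor (Δ.toricVariety k)) : IsLineBundle E.sheaf := by
  obtain ⟨a, ha⟩ := Δ.exists_linEquiv_toricDivisor k E
  obtain ⟨e⟩ := ha.nonempty_iso
  intro x
  obtain ⟨U, hxU, ⟨e'⟩⟩ := Δ.isLineBundle_toricDivisor k a x
  exact ⟨U, hxU, ⟨(Scheme.Modules.restrictFunctor U.ι).mapIso e ≪≫ e'⟩⟩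

/-- A rational function that is regular on the torus belongs to `k[M]`. -/
theorem exists_torusEmb_eq_of_ord_nonneg (g : (Δ.toricVariety k).functionField)
    (hg : ∀ z : Spec (Δ.chartRing k Δ.zeroCone),
      Order.coheight (Δ.specChart k Δ.zeroCone z) = 1 →
        0 ≤ Scheme.ord g (Δ.specChart k Δ.zeroCone z)) : ∃ a, Δ.torusEmb k a = g := by
  obtain ⟨r, p, h⟩ := Δ.exists_pow_ringEmb_mul_eq k Δ.zeroCone 1 g fun y _ => by
    obtain ⟨p, q, hq, h⟩ := Scheme.exists_chartEmbedding_mul_eq_of_ord_nonneg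
      (Δ.specChart k Δ.zeroCone) y g fun z _ hz => hg z hz
    exact ⟨p, q, hq, h⟩
  rw [one_pow, map_one, one_mul] at h
  obtain ⟨a, ha⟩ := Δ.exists_torusEmb_eq k p
  exact ⟨a, ha.trans h.symm⟩

theorem ord_scalar {r : k} (hr : r ≠ 0) (x : Δ.toricVariety k) :
    Scheme.ord (Δ.scalar k r) x = 0 := by
  obtain ⟨σ, y, rfl⟩ := Δ.exists_specChart k x
  have key : ∀ r : k, r ≠ 0 → 0 ≤ Scheme.ord (Δ.scalar k r) (Δ.specChart k σ y) := fun r hr => by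
    have h := Δ.ringEmb_single k σ 0 r
    rw [ZeroMemClass.coe_zero, character_zero, mul_one] at h
    rw [← h]
    exact Scheme.ord_chartEmbedding_nonneg (Δ.specChart k σ) y
      (AddMonoidAlgebra.single_ne_zero.mpr hr)
  have h1 := key r hr
  have h2 := key r⁻¹ (inv_ne_zero hr)
  rw [map_inv₀, Scheme.ord_inv] at h2
  omega

/-- Torus invariant principal divisors are divisors of characters. -/
theorem toricDivisor_mem_principal_iff (a : Δ.Ray → ℤ) :
    Δ.toricDivisor k a ∈ WeilDivisor.principal (Δ.toricVariety k) ↔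
      ∃ m : Module.Dual ℤ N, ∀ ρ : Δ.Ray, a ρ = m ρ.1 := by
  constructor
  · rintro ⟨f, hf, h⟩
    -- A function with torus-invariant divisor has no zeros or poles on the torus; it and its
    -- inverse then lie in `k[M]`, so it is a scalar times a character.
    have hz : ∀ z : Spec (Δ.chartRing k Δ.zeroCone),
      Order.coheight (Δ.specChart k Δ.zeroCone z) = 1 →
        Scheme.ord f (Δ.specChart k Δ.zeroCone z) = 0 := fun z hz => by
      rw [← h ⟨_, hz⟩, toricDivisor_apply_of_notMem]
      exact fun ρ hρ => Δ.specChart_zeroCone_ne_primeDivisor k z ρ (congrArg Subtype.val hρ)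
    obtain ⟨p, hp⟩ := Δ.exists_torusEmb_eq_of_ord_nonneg k f fun z h => (hz z h).ge
    obtain ⟨q, hq⟩ := Δ.exists_torusEmb_eq_of_ord_nonneg k f⁻¹ fun z h => by
      rw [Scheme.ord_inv, hz z h, neg_zero]
    have hpq : p * q = 1 := Δ.torusEmb_injective k (by
      rw [map_mul, hp, hq, mul_inv_cancel₀ hf, map_one])
    obtain ⟨m, r, hr, rfl⟩ : ∃ m r, r ≠ 0 ∧ p = AddMonoidAlgebra.single m r :=
      AddMonoidAlgebra.exists_eq_single_of_mul_eq_one hpq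
    rw [torusEmb_single] at hp
    refine ⟨m, fun ρ => ?_⟩
    rw [← Δ.toricDivisor_apply_primeDivisor k a ρ, h, ← hp, Scheme.ord_mul
      ((map_ne_zero_iff _ (Δ.scalar k).injective).mpr hr) (Δ.character_ne_zero k m),
      ord_character_primeDivisor, Δ.ord_scalar k hr, zero_add]
  · rintro ⟨m, hm⟩
    refine ⟨Δ.character k m, Δ.character_ne_zero k m, fun x => ?_⟩
    rcases Δ.exists_primeDivisor_or_zeroCone k x with ⟨ρ, rfl⟩ | ⟨z, hz⟩
    · rw [toricDivisor_apply_primeDivisor, ord_character_primeDivisor, hm]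
    · rw [hz, ord_character_torus, toricDivisor_apply_of_notMem]
      rintro ρ rfl
      exact Δ.specChart_zeroCone_ne_primeDivisor k z ρ hz.symm

end SmoothFan

/-! ### Compatibility of the Frobenius decomposition with divisors -/

namespace SmoothFan

variable {N : Type u} [AddCommGroup N] [Module.Free ℤ N] [Module.Finite ℤ N] (Δ : SmoothFan N)
  (k : Type u) [Field k] {ℓ : ℕ} (hℓ : 0 < ℓ)

/-- If `χ^n' g` is regular at the image point, its pullback `χ^(ℓn') φ(g)` is regular at `x`. It
differs from `χ^n χ^(-s) φ(g)` by `χ^(n-s-ℓn')`, which is regular on the chart because `a - s - ℓe ≥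
0` on rays. -/
theorem character_mul_frobField_ord_ge (a e : Δ.Ray → ℤ) (s : Module.Dual ℤ N)
    (he : ∀ ρ, ℓ * e ρ ≤ a ρ - s ρ.1) (x : {x : Δ.toricVariety k // Order.coheight x = 1})
    (g : (Δ.toricVariety k).functionField)
    (hg : ∀ z : {x : Δ.toricVariety k // Order.coheight x = 1}, z.1 ⤳ Δ.toricFrobenius k ℓ x.1 →
      g = 0 ∨ -Δ.toricDivisor k e z ≤ Scheme.ord g z.1) :
    Δ.character k (-s) * Δ.frobField k hℓ g = 0 ∨
      -Δ.toricDivisor k a x ≤ Scheme.ord (Δ.character k (-s) * Δ.frobField k hℓ g) x.1 := by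
  obtain ⟨x, hx⟩ := x
  obtain ⟨σ, y, rfl⟩ := Δ.exists_specChart k x
  obtain ⟨n, hn⟩ := Δ.exists_dual_eq_on σ a
  obtain ⟨n', hn'⟩ := Δ.exists_dual_eq_on σ e
  simp only [toricFrobenius_specChart] at hg
  obtain ⟨p, q, hq, h⟩ := Δ.exists_ringEmb_mul_eq k σ e n' hn' _ g hg
  have hm : n - s - ℓ • n' ∈ dualMonoid (σ.1 : Set N) := fun u hu => by
    have hu' : {u} ∈ Δ.cones := Δ.face_mem _ σ.2 _ (Finset.singleton_subset_iff.mpr hu)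
    have h1 := hn ⟨u, hu'⟩ hu
    have h2 := hn' ⟨u, hu'⟩ hu
    have h3 := he ⟨u, hu'⟩
    simp only [LinearMap.sub_apply, LinearMap.smul_apply, nsmul_eq_mul] at h1 h2 h3 ⊢
    rw [h1, h2]
    linarith
  refine Δ.ord_ge_of_ringEmb_mul_eq k σ a n hn y hx _ (q := Δ.frobHom k ℓ σ q)
    (p := AddMonoidAlgebra.single ⟨_, hm⟩ 1 * Δ.frobHom k ℓ σ p) hq ?_
  have h' := congrArg (Δ.frobField k hℓ) h
  rw [map_mul, map_mul, frobField_ringEmb, frobField_ringEmb, frobField_character] at h'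
  rw [map_mul, ← h', ringEmb_single_one]
  have : Δ.character k n * Δ.character k (-s) =
      Δ.character k (n - s - ℓ • n') * Δ.character k (ℓ • n') := by
    rw [← character_add, ← character_add]
    congr 1
    abel
  linear_combination (Δ.ringEmb k σ (Δ.frobHom k ℓ σ q) * Δ.frobField k hℓ g) * this

/-- The case of the full chart, where `χ^(-n) k[S_σ]` is spanned by monomials. A coordinate sends
`χ^(m-n)` to `0`, or to `χ^g'` with `ℓg' = m - n + s`. -/
theorem coordinate_ringEmb_mem (a e : Δ.Ray → ℤ) (s : Module.Dual ℤ N)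
    (he : ∀ ρ, a ρ - s ρ.1 < ℓ * e ρ + ℓ)
    (P : (Δ.toricVariety k).functionField →+ (Δ.toricVariety k).functionField)
    (hP : ∀ b, P (Δ.torusEmb k b) =
      Δ.torusEmb k (frobeniusComponent (nsmul_dual_injective hℓ) s b)) (σ : Δ.Cone)
    (n n' : Module.Dual ℤ N) (hn : ∀ ρ : Δ.Ray, ρ.1 ∈ σ.1 → n ρ.1 = a ρ)
    (hn' : ∀ ρ : Δ.Ray, ρ.1 ∈ σ.1 → n' ρ.1 = e ρ) (p : coneRing k (σ.1 : Set N)) :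
    ∃ p', Δ.character k n' * P (Δ.character k (-n) * Δ.ringEmb k σ p) = Δ.ringEmb k σ p' := by
  induction p using AddMonoidAlgebra.induction_linear with
  | zero => exact ⟨0, by simp⟩
  | add x y hx hy =>
    obtain ⟨x', hx⟩ := hx
    obtain ⟨y', hy⟩ := hy
    exact ⟨x' + y', by rw [map_add, mul_add, map_add, mul_add, hx, hy, map_add]⟩
  | single m r =>
    have h0 : Δ.character k (-n) * Δ.ringEmb k σ (AddMonoidAlgebra.single m r) =
        Δ.torusEmb k (AddMonoidAlgebra.single (m.1 - n) r) := by
      rw [ringEmb_single, torusEmb_single, sub_eq_add_neg, character_add]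
      ring
    rw [h0, hP]
    by_cases h : ∃ g', ℓ • g' - s = m.1 - n
    · obtain ⟨g', h⟩ := h
      have hm : g' + n' ∈ dualMonoid (σ.1 : Set N) := fun u hu => by
        have hu' : {u} ∈ Δ.cones := Δ.face_mem _ σ.2 _ (Finset.singleton_subset_iff.mpr hu)
        have h1 := hn ⟨u, hu'⟩ hu
        have h2 := hn' ⟨u, hu'⟩ hu
        have h3 := he ⟨u, hu'⟩
        have h4 := m.2 u hu
        have h5 := congrArg (fun f : Module.Dual ℤ N => f u) h
        simp only [LinearMap.sub_apply, LinearMap.add_apply, LinearMap.smul_apply,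
          nsmul_eq_mul] at h1 h2 h3 h5 ⊢
        rw [h2]
        -- On a generator, `ℓg' ≥ s - a > -ℓe - ℓ`, so `g' + e > -1`; as an integer it is
        -- nonnegative.
        by_contra! hlt
        have : (ℓ : ℤ) * (g' u + e ⟨u, hu'⟩) ≤ ℓ * (-1) :=
          mul_le_mul_of_nonneg_left (by omega) (by omega)
        rw [mul_add] at this
        omega
      refine ⟨AddMonoidAlgebra.single ⟨_, hm⟩ r, ?_⟩
      rw [← h, frobeniusComponent_single, torusEmb_single, ringEmb_single, character_add]
      ring
    · exact ⟨0, by rw [frobeniusComponent_single_of_ne _ (fun g' hg' => h ⟨g', hg'⟩), map_zero,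
        map_zero, mul_zero]⟩

/-- Reduction to the full chart: denominators on a Frobenius preimage can be chosen to be pullbacks,
and the coordinate map is linear over pullbacks. -/
theorem coordinate_ord_ge (a e : Δ.Ray → ℤ) (s : Module.Dual ℤ N)
    (he : ∀ ρ, a ρ - s ρ.1 < ℓ * e ρ + ℓ)
    (P : (Δ.toricVariety k).functionField →+ (Δ.toricVariety k).functionField)
    (hPmul : ∀ x f, P (Δ.frobField k hℓ x * f) = x * P f)
    (hP : ∀ b, P (Δ.torusEmb k b) =
      Δ.torusEmb k (frobeniusComponent (nsmul_dual_injective hℓ) s b))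
    (U : (Δ.toricVariety k).Opens) (x : {x : Δ.toricVariety k // Order.coheight x = 1})
    (hxU : x.1 ∈ U) (f : (Δ.toricVariety k).functionField)
    (hf : ∀ z : {x : Δ.toricVariety k // Order.coheight x = 1}, Δ.toricFrobenius k ℓ z.1 ∈ U →
      f = 0 ∨ -Δ.toricDivisor k a z ≤ Scheme.ord f z.1) :
    P f = 0 ∨ -Δ.toricDivisor k e x ≤ Scheme.ord (P f) x.1 := by
  obtain ⟨x, hx⟩ := x
  obtain ⟨σ, y, rfl⟩ := Δ.exists_specChart k x
  obtain ⟨n, hn⟩ := Δ.exists_dual_eq_on σ a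
  obtain ⟨n', hn'⟩ := Δ.exists_dual_eq_on σ e
  -- A basic neighbourhood of `y` where `h` is invertible. Its Frobenius preimage is the locus where
  -- `φ(h)` is invertible, so a power `φ(h)^r` clears the denominator of `χ^n f`; after applying `P`
  -- it becomes `h^r`, which is invertible at `y`.
  obtain ⟨_, ⟨_, ⟨h, rfl⟩, rfl⟩, hyh, hhU⟩ :=
    (PrimeSpectrum.isBasis_basic_opens (R := coneRing k (σ.1 : Set N))).exists_subset_of_mem_open
      (show y ∈ ((Δ.specChart k σ) ⁻¹ᵁ U : Set _) from hxU) ((Δ.specChart k σ) ⁻¹ᵁ U).isOpen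
  have hreg : ∀ z : Spec (Δ.chartRing k σ), Δ.frobHom k ℓ σ h ∉ z.asIdeal →
      ∃ p q : coneRing k (σ.1 : Set N), q ∉ z.asIdeal ∧
        Δ.ringEmb k σ q * (Δ.character k n * f) = Δ.ringEmb k σ p := fun z hz =>
    Δ.exists_ringEmb_mul_eq k σ a n hn z f fun w hw => hf w <| by
      have hzU : Δ.toricFrobenius k ℓ (Δ.specChart k σ z) ∈ U := by
        rw [toricFrobenius_specChart]
        exact hhU (show Spec.map (CommRingCat.ofHom (Δ.frobHom k ℓ σ)) z ∈ PrimeSpectrum.basicOpen h from hz)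
      exact hw.mem_open ((Δ.toricFrobenius k ℓ) ⁻¹ᵁ U).isOpen hzU
  obtain ⟨r, p, hp⟩ := Δ.exists_pow_ringEmb_mul_eq k σ _ _ hreg
  obtain ⟨p', hp'⟩ := Δ.coordinate_ringEmb_mem k hℓ a e s he P hP σ n n' hn hn' p
  refine Δ.ord_ge_of_ringEmb_mul_eq k σ e n' hn' y hx _ (q := h ^ r) (p := p')
    (fun hq => hyh ((PrimeSpectrum.isPrime y).mem_of_pow_mem r hq)) ?_
  rw [← hp', ← hp, ← map_pow, ← Δ.frobField_ringEmb k hℓ]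
  have : Δ.character k (-n) * (Δ.frobField k hℓ (Δ.ringEmb k σ (h ^ r)) * (Δ.character k n * f)) =
      Δ.frobField k hℓ (Δ.ringEmb k σ (h ^ r)) * f := by
    have h1 : Δ.character k (-n) * Δ.character k n = 1 := by
      rw [← character_add, neg_add_cancel, character_zero]
    linear_combination Δ.frobField k hℓ (Δ.ringEmb k σ (h ^ r)) * f * h1
  rw [this, hPmul]
  ring

end SmoothFan

/-- Evaluation of morphisms of sheaves of modules at a section. -/
noncomputable def AlgebraicGeometry.Scheme.Modules.evalHom {X : Scheme.{u}} (M N : X.Modules)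
    (U : X.Opens) (s : Γ(M, U)) : (M ⟶ N) →+ Γ(N, U) where
  toFun φ := φ.app U s
  map_zero' := rfl
  map_add' _ _ := rfl

/-! ### Splitting a pushforward by coordinates on function fields -/

namespace WeilDivisor

variable {X Y : Scheme.{u}} [IsIntegral X] [IsIntegral Y] (f : Y ⟶ X)
  (hf : f (genericPoint Y) = genericPoint X)

/-- The points `x` and `y` need not be related, since all germs of a section have the same image in
the function field. -/
theorem algebraMap_germ_app (U : X.Opens) (r : Γ(X, U)) (y : Y) (hy : y ∈ f ⁻¹ᵁ U) (x : X) (hx : x ∈ U) :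
    algebraMap (Y.presheaf.stalk y) Y.functionField (Y.presheaf.germ (f ⁻¹ᵁ U) y hy (f.app U r)) =
      f.functionFieldMap hf (algebraMap (X.presheaf.stalk x) X.functionField
        (X.presheaf.germ U x hx r)) := by
  have : Nonempty U := ⟨⟨x, hx⟩⟩
  have : Nonempty (f ⁻¹ᵁ U) := ⟨⟨y, hy⟩⟩
  rw [Scheme.algebraMap_germ_eq_germToFunctionField X hx,
    Scheme.algebraMap_germ_eq_germToFunctionField Y hy,
    Scheme.Hom.functionFieldMap_germToFunctionField]

theorem germ_app_smul (U : X.Opens) (r : Γ(X, U)) (y : Y) (hy : y ∈ f ⁻¹ᵁ U) (x : X) (hx : x ∈ U)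
    (g : Y.functionField) : Y.presheaf.germ (f ⁻¹ᵁ U) y hy (f.app U r) • g =
      f.functionFieldMap hf (algebraMap (X.presheaf.stalk x) X.functionField
        (X.presheaf.germ U x hx r)) * g := by
  rw [Algebra.smul_def, algebraMap_germ_app f hf U r y hy x hx]

include hf in
theorem genericPoint_mem_preimage {U : X.Opens} (x : U) : genericPoint Y ∈ f ⁻¹ᵁ U := by
  have : f (genericPoint Y) ∈ U := hf ▸ (genericPoint_specializes x.1).mem_open U.isOpen x.2
  exact this

variable [IsLocallyNoetherian X] [RegularInCodimOne X] [IsLocallyNoetherian Y]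
  [RegularInCodimOne Y]

/-- The morphism `𝒪(E) ⟶ f_* 𝒪(D)` that maps `g` to the pullback of `g` multiplied by `c`. -/
noncomputable def pullbackHom (D : WeilDivisor Y) (E : WeilDivisor X) (c : Y.functionField)
    (h : ∀ (x : {x : Y // Order.coheight x = 1}) (g : X.functionField),
      (∀ z : {x : X // Order.coheight x = 1}, z.1 ⤳ f x.1 → g = 0 ∨ -E z ≤ Scheme.ord g z.1) →
      c * f.functionFieldMap hf g = 0 ∨ -D x ≤ Scheme.ord (c * f.functionFieldMap hf g) x.1) :
    E.sheaf ⟶ (Scheme.Modules.pushforward f).obj D.sheaf :=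
  Scheme.Modules.homMk (M := E.sheaf) (N := (Scheme.Modules.pushforward f).obj D.sheaf)
    (fun U => show E.sections U →+ D.sections (f ⁻¹ᵁ U) from
      { toFun s := ⟨fun x => c * f.functionFieldMap hf (s.1 ⟨f x.1, x.2⟩),
          fun x y => congrArg (fun g => c * f.functionFieldMap hf g) (s.2.1 _ _),
          fun x hx => h ⟨x.1, hx⟩ _ fun z hz => by
            have hzU := hz.mem_open U.isOpen x.2
            rw [s.2.1 _ ⟨z.1, hzU⟩]
            exact s.2.2 ⟨z.1, hzU⟩ z.2⟩
        map_zero' := Subtype.ext (funext fun x => by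
          change c * f.functionFieldMap hf 0 = 0
          rw [map_zero, mul_zero])
        map_add' s t := Subtype.ext (funext fun x => by
          change c * f.functionFieldMap hf (_ + _) = c * _ + c * _
          rw [map_add, mul_add]) })
    (fun U r s => Subtype.ext (funext fun x => by
      change c * f.functionFieldMap hf (X.presheaf.germ U (f x.1) x.2 r • s.1 ⟨f x.1, x.2⟩) =
        Y.presheaf.germ (f ⁻¹ᵁ U) x.1 x.2 (f.app U r) •
          (c * f.functionFieldMap hf (s.1 ⟨f x.1, x.2⟩))
      rw [Algebra.smul_def, Algebra.smul_def, map_mul,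
        algebraMap_germ_app f hf U r x.1 x.2 (f x.1) x.2]
      ring))
    (fun _ _ _ _ => rfl)

/-- The map from sections of `f_* 𝒪(D)` to sections of `𝒪(E)` induced by an additive map on function
fields. -/
noncomputable def coordinateSections (D : WeilDivisor Y) (E : WeilDivisor X)
    (P : Y.functionField →+ X.functionField) (U : X.Opens)
    (h : ∀ (x : {x : X // Order.coheight x = 1}) (_ : x.1 ∈ U) (g : Y.functionField),
      (∀ z : {x : Y // Order.coheight x = 1}, f z.1 ∈ U → g = 0 ∨ -D z ≤ Scheme.ord g z.1) →
      P g = 0 ∨ -E x ≤ Scheme.ord (P g) x.1) :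
    D.sections (f ⁻¹ᵁ U) →+ E.sections U where
  -- A point of `U` need not be given with a preimage; the generic point of `Y` always lies over a
  -- nonempty `U`, and the section is constant.
  toFun s := ⟨fun x => P (s.1 ⟨genericPoint Y, genericPoint_mem_preimage f hf x⟩), fun _ _ => rfl,
    fun x hx => h ⟨x.1, hx⟩ x.2 _ fun z hz => by
      rw [s.2.1 _ ⟨z.1, hz⟩]
      exact s.2.2 ⟨z.1, hz⟩ z.2⟩
  map_zero' := Subtype.ext (funext fun x => map_zero P)
  map_add' s t := Subtype.ext (funext fun x => map_add P _ _)

/-- The morphism `f_* 𝒪(D) ⟶ 𝒪(E)` induced by a linear map on function fields. -/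
noncomputable def coordinateHom (D : WeilDivisor Y) (E : WeilDivisor X)
    (P : Y.functionField →+ X.functionField)
    (hP : ∀ x g, P (f.functionFieldMap hf x * g) = x * P g)
    (h : ∀ (U : X.Opens) (x : {x : X // Order.coheight x = 1}) (_ : x.1 ∈ U) (g : Y.functionField),
      (∀ z : {x : Y // Order.coheight x = 1}, f z.1 ∈ U → g = 0 ∨ -D z ≤ Scheme.ord g z.1) →
      P g = 0 ∨ -E x ≤ Scheme.ord (P g) x.1) :
    (Scheme.Modules.pushforward f).obj D.sheaf ⟶ E.sheaf :=
  Scheme.Modules.homMk (M := (Scheme.Modules.pushforward f).obj D.sheaf) (N := E.sheaf)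
    (fun U => coordinateSections f hf D E P U (h U))
    (fun U r s => Subtype.ext (funext fun x => by
      have hη := genericPoint_mem_preimage f hf x
      refine (congrArg P (germ_app_smul f hf U r _ hη x.1 x.2 (s.1 ⟨_, hη⟩))).trans ?_
      rw [hP]
      exact (Algebra.smul_def _ _).symm))
    (fun U V i s => Subtype.ext (funext fun x => rfl))

/-- A decomposition of function fields that is compatible with divisors gives a decomposition of
the pushforward of a sheaf `𝒪(D)`. -/
theorem nonempty_pushforward_iso_sigma {C : Type u} [Fintype C] (D : WeilDivisor Y)
    (E : C → WeilDivisor X) (v : C → Y.functionField) (P : C → Y.functionField →+ X.functionField)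
    (hP : ∀ c x g, P c (f.functionFieldMap hf x * g) = x * P c g)
    (hv : ∀ c, P c (v c) = 1) (hv' : ∀ c c', c ≠ c' → P c (v c') = 0)
    (hsum : ∀ g, ∑ c, f.functionFieldMap hf (P c g) * v c = g)
    (h : ∀ c (x : {x : Y // Order.coheight x = 1}) (g : X.functionField),
      (∀ z : {x : X // Order.coheight x = 1}, z.1 ⤳ f x.1 → g = 0 ∨ -E c z ≤ Scheme.ord g z.1) →
      v c * f.functionFieldMap hf g = 0 ∨ -D x ≤ Scheme.ord (v c * f.functionFieldMap hf g) x.1)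
    (h' : ∀ c (U : X.Opens) (x : {x : X // Order.coheight x = 1}) (_ : x.1 ∈ U)
      (g : Y.functionField),
      (∀ z : {x : Y // Order.coheight x = 1}, f z.1 ∈ U → g = 0 ∨ -D z ≤ Scheme.ord g z.1) →
      P c g = 0 ∨ -E c x ≤ Scheme.ord (P c g) x.1) :
    Nonempty ((Scheme.Modules.pushforward f).obj D.sheaf ≅ ∐ fun c => (E c).sheaf) := by
  classical
  let B : Bicone fun c => (E c).sheaf :=
    { pt := (Scheme.Modules.pushforward f).obj D.sheaf
      π := fun c => coordinateHom f hf D (E c) (P c) (hP c) (h' c)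
      ι := fun c => pullbackHom f hf D (E c) (v c) (h c)
      ι_π := fun c' c => by
        split_ifs with hc
        · subst hc
          rw [eqToHom_refl]
          refine Scheme.Modules.hom_ext _ _ fun U => ?_
          ext s
          refine Subtype.ext (funext fun x => ?_)
          change P c' (v c' * f.functionFieldMap hf (s.1 _)) = s.1 x
          rw [mul_comm, hP, hv, mul_one]
          exact s.2.1 _ _
        · refine Scheme.Modules.hom_ext _ _ fun U => ?_
          ext s
          refine Subtype.ext (funext fun x => ?_)
          change P c (v c' * f.functionFieldMap hf (s.1 _)) = 0
          rw [mul_comm, hP, hv' _ _ (Ne.symm hc), mul_zero] }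
  have hB : B.IsBilimit := by
    -- The biproduct identity is the reconstruction formula `hsum`, read on sections.
    refine isBilimitOfTotal B ?_
    refine Scheme.Modules.hom_ext _ _ fun U => ?_
    ext s
    refine (map_sum (Scheme.Modules.evalHom B.pt B.pt U s) _ _).trans ?_
    refine Subtype.ext (funext fun x => ?_)
    refine (congrFun (map_sum (D.sections (f ⁻¹ᵁ U)).subtype _ _) x).trans ?_
    rw [Finset.sum_apply]
    refine Eq.trans (Finset.sum_congr rfl fun c _ => ?_) (hsum (s.1 x))
    change v c * f.functionFieldMap hf (P c (s.1 _)) = _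
    rw [mul_comm, s.2.1 _ x]
  exact ⟨hB.isColimit.coconePointUniqueUpToIso (coproductIsCoproduct _)⟩

end WeilDivisor

/-! ### Pushforward of torus-invariant divisors -/

namespace SmoothFan

variable {N : Type u} [AddCommGroup N] [Module.Free ℤ N] [Module.Finite ℤ N] (Δ : SmoothFan N)
  (k : Type u) [Field k] {ℓ : ℕ} (hℓ : 0 < ℓ)

include hℓ in
/-- The pushforward of the sheaf of a torus-invariant divisor under the toric Frobenius. -/
theorem nonempty_pushforward_toricDivisor_iso (a : Δ.Ray → ℤ)
    (s : (Module.Dual ℤ N ⧸ (nsmulAddMonoidHom ℓ : Module.Dual ℤ N →+ Module.Dual ℤ N).range) →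
      Module.Dual ℤ N) (hs : ∀ c, QuotientAddGroup.mk (s c) = c) :
    Nonempty ((Scheme.Modules.pushforward (Δ.toricFrobenius k ℓ)).obj
        (Δ.toricDivisor k a).sheaf ≅
      ∐ fun c => (Δ.toricDivisor k fun ρ => (a ρ - s c ρ.1) / ℓ).sheaf) := by
  have := finite_quotient_range_nsmul (Module.Dual ℤ N) hℓ
  have := Fintype.ofFinite
    (Module.Dual ℤ N ⧸ (nsmulAddMonoidHom ℓ : Module.Dual ℤ N →+ Module.Dual ℤ N).range)
  have hℓ' : (0 : ℤ) < ℓ := by exact_mod_cast hℓ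
  obtain ⟨P, hmul, hP, hsum⟩ := Δ.exists_frobenius_coordinates k hℓ s hs
  have hchar : ∀ c, Δ.character k (-s c) = Δ.torusEmb k (AddMonoidAlgebra.single (-s c) 1) :=
    fun c => by rw [torusEmb_single, map_one, one_mul]
  -- With `e = ⌊(a - s)/ℓ⌋` both requirements hold: `ℓe ≤ a - s` for the inclusions and `a - s < ℓe
  -- + ℓ` for the coordinates.
  refine WeilDivisor.nonempty_pushforward_iso_sigma _ (Δ.toricFrobenius_genericPoint k hℓ) _ _
    (fun c => Δ.character k (-s c)) P hmul (fun c => ?_) (fun c c' h => ?_) hsum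
    (fun c x g hg => Δ.character_mul_frobField_ord_ge k hℓ a _ (s c)
      (fun ρ => Int.mul_ediv_self_le hℓ'.ne') x g hg)
    (fun c U x hx g hg => Δ.coordinate_ord_ge k hℓ a _ (s c)
      (fun ρ => Int.lt_mul_ediv_self_add hℓ') (P c) (hmul c) (hP c) U x hx g hg)
  · rw [hchar, hP, frobeniusComponent_single_neg, map_one]
  · rw [hchar, hP, frobeniusComponent_single_neg_of_ne _ s hs h, map_zero]

theorem toricDivisor_add (a b : Δ.Ray → ℤ) :
    Δ.toricDivisor k (a + b) = Δ.toricDivisor k a + Δ.toricDivisor k b := by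
  simp [toricDivisor, Finset.sum_add_distrib]

theorem toricDivisor_neg (a : Δ.Ray → ℤ) : Δ.toricDivisor k (-a) = -Δ.toricDivisor k a := by
  simp [toricDivisor]

theorem toricDivisor_sub (a b : Δ.Ray → ℤ) :
    Δ.toricDivisor k (a - b) = Δ.toricDivisor k a - Δ.toricDivisor k b := by
  rw [sub_eq_add_neg, toricDivisor_add, toricDivisor_neg, sub_eq_add_neg]

theorem toricDivisor_nsmul (n : ℕ) (a : Δ.Ray → ℤ) :
    Δ.toricDivisor k (n • a) = n • Δ.toricDivisor k a := by
  simp [toricDivisor, Finset.smul_sum]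

theorem toricDivisor_injective : Function.Injective (Δ.toricDivisor k) := fun a b h =>
  funext fun ρ => by
    rw [← Δ.toricDivisor_apply_primeDivisor k a, h, toricDivisor_apply_primeDivisor]

/-- If the rays span, a linear form is determined by its values on the rays. -/
theorem NoTorusFactor.dual_ext {Δ : SmoothFan N} (h : Δ.NoTorusFactor) {m m' : Module.Dual ℤ N}
    (hm : ∀ ρ : Δ.Ray, m ρ.1 = m' ρ.1) : m = m' := by
  -- Extension of scalars to `ℝ`, where the rays span; `ℤ → ℝ` is injective, so nothing is lost.
  let g : Module.Dual ℤ N → (ℝ ⊗[ℤ] N →ₗ[ℝ] ℝ) := fun m =>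
    TensorProduct.AlgebraTensorModule.lift
      ((LinearMap.toSpanSingleton ℝ (N →ₗ[ℤ] ℝ) ((Algebra.linearMap ℤ ℝ).comp m)))
  have hg : ∀ m v, g m (1 ⊗ₜ v) = (m v : ℝ) := fun m v => by simp [g]
  have heq : g m = g m' := LinearMap.ext_on_range (v := fun ρ : Δ.Ray => (1 : ℝ) ⊗ₜ[ℤ] ρ.1) h
    fun ρ => by rw [hg, hg, hm]
  refine LinearMap.ext fun v => ?_
  have := congrArg (fun f => f ((1 : ℝ) ⊗ₜ[ℤ] v)) heq
  simp only [hg] at this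
  exact_mod_cast this

end SmoothFan

/-! ### Counting summands by division with remainder -/

namespace WeilDivisor

theorem linEquiv_iff_mk_eq {X : Scheme.{u}} [IsIntegral X] [IsLocallyNoetherian X]
    {D E : WeilDivisor X} :
    D.LinEquiv E ↔ (QuotientAddGroup.mk D : ClassGroup X) = QuotientAddGroup.mk E :=
  QuotientAddGroup.eq_iff_sub_mem.symm

end WeilDivisor

namespace SmoothFan

variable {N : Type u} [AddCommGroup N] [Module.Free ℤ N] [Module.Finite ℤ N] (Δ : SmoothFan N)
  (k : Type u) [Field k] {ℓ : ℕ} (hℓ : 0 < ℓ)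

theorem toricDivisor_linEquiv_iff (a b : Δ.Ray → ℤ) :
    (Δ.toricDivisor k a).LinEquiv (Δ.toricDivisor k b) ↔
      ∃ m : Module.Dual ℤ N, ∀ ρ : Δ.Ray, a ρ - b ρ = m ρ.1 := by
  rw [WeilDivisor.LinEquiv, ← toricDivisor_sub, toricDivisor_mem_principal_iff]
  rfl

theorem finite_setOf_toricDivisor (ℓ : ℕ) : {T : WeilDivisor (Δ.toricVariety k) |
    ∃ c : Δ.Ray → ℤ, (∀ ρ, 0 ≤ c ρ ∧ c ρ < ℓ) ∧ T = Δ.toricDivisor k c}.Finite := by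
  refine ((Set.Finite.pi fun _ : Δ.Ray => Set.finite_Ico (0 : ℤ) ℓ).image
    (Δ.toricDivisor k)).subset ?_
  rintro _ ⟨c, hc, rfl⟩
  exact ⟨c, fun ρ _ => hc ρ, rfl⟩

variable {Δ}

include hℓ in
/-- Division by `ℓ` with remainder identifies `M/ℓM` with the pairs consisting of a divisor class
and a divisor counted by the multiplicity. -/
theorem NoTorusFactor.exists_equiv (h : Δ.NoTorusFactor) (D : WeilDivisor (Δ.toricVariety k))
    (rep : WeilDivisor.ClassGroup (Δ.toricVariety k) → WeilDivisor (Δ.toricVariety k))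
    (hrep : ∀ γ, (QuotientAddGroup.mk (rep γ) : WeilDivisor.ClassGroup (Δ.toricVariety k)) = γ)
    (a : Δ.Ray → ℤ) (ha : D.LinEquiv (Δ.toricDivisor k a))
    (s : (Module.Dual ℤ N ⧸ (nsmulAddMonoidHom ℓ : Module.Dual ℤ N →+ Module.Dual ℤ N).range) →
      Module.Dual ℤ N) (hs : ∀ c, QuotientAddGroup.mk (s c) = c) :
    ∃ e : (Module.Dual ℤ N ⧸ (nsmulAddMonoidHom ℓ : Module.Dual ℤ N →+ Module.Dual ℤ N).range) ≃
        Σ γ : WeilDivisor.ClassGroup (Δ.toricVariety k), Fin (Δ.multiplicity k ℓ (rep γ) D),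
      ∀ c, (Δ.toricDivisor k fun ρ => (a ρ - s c ρ.1) / ℓ).LinEquiv (rep (e c).1) := by
  have hℓ' : (0 : ℤ) < ℓ := by exact_mod_cast hℓ
  let S (γ : WeilDivisor.ClassGroup (Δ.toricVariety k)) : Set (WeilDivisor (Δ.toricVariety k)) :=
    {T | (∃ c : Δ.Ray → ℤ, (∀ ρ, 0 ≤ c ρ ∧ c ρ < ℓ) ∧ T = Δ.toricDivisor k c) ∧
      T.LinEquiv (D - ℓ • rep γ)}
  have hS (γ) : Finite (S γ) := (Δ.finite_setOf_toricDivisor k ℓ).subset fun _ hT => hT.1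
  let E (c) := Δ.toricDivisor k fun ρ => (a ρ - s c ρ.1) / ℓ
  let T (c) := Δ.toricDivisor k fun ρ => (a ρ - s c ρ.1) % ℓ
  have hT (c) : T c ∈ S (QuotientAddGroup.mk (E c)) := by
    refine ⟨⟨_, fun ρ => ⟨Int.emod_nonneg _ hℓ'.ne', Int.emod_lt_of_pos _ hℓ'⟩, rfl⟩, ?_⟩
    have h1 : (T c).LinEquiv (Δ.toricDivisor k a - ℓ • E c) := by
      rw [← toricDivisor_nsmul, ← toricDivisor_sub, toricDivisor_linEquiv_iff]
      -- Since `a - s c = T + ℓE`, the divisors `T` and `a - ℓE` differ by the divisor of `χ^(-s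
      -- c)`.
      refine ⟨-s c, fun ρ => ?_⟩
      have := Int.emod_add_mul_ediv (a ρ - s c ρ.1) ℓ
      simp only [Pi.sub_apply, nsmul_eq_mul, Pi.mul_apply, Pi.natCast_apply, LinearMap.neg_apply]
      linarith
    rw [WeilDivisor.linEquiv_iff_mk_eq] at h1 ha ⊢
    rw [h1, QuotientAddGroup.mk_sub, QuotientAddGroup.mk_sub, QuotientAddGroup.mk_nsmul,
      QuotientAddGroup.mk_nsmul, hrep, ha]
  let φ (c) : Σ γ, S γ := ⟨QuotientAddGroup.mk (E c), T c, hT c⟩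
  have hφ : Function.Bijective φ := by
    constructor
    · intro c c' hcc
      have h1 : (E c).LinEquiv (E c') := WeilDivisor.linEquiv_iff_mk_eq.mpr (congrArg Sigma.fst hcc)
      have h2 := Δ.toricDivisor_injective k (congrArg (fun p : Σ γ, S γ => p.2.1) hcc)
      obtain ⟨m, hm⟩ := (Δ.toricDivisor_linEquiv_iff k _ _).mp h1
      rw [← hs c, ← hs c', QuotientAddGroup.eq]
      -- Equal remainders, and quotients differing by the character `m`, give `s c' - s c = ℓm` on
      -- rays. Spanning turns this into an equality in `M`.
      refine ⟨m, h.dual_ext fun ρ => ?_⟩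
      have h3 := Int.emod_add_mul_ediv (a ρ - s c ρ.1) ℓ
      have h4 := Int.emod_add_mul_ediv (a ρ - s c' ρ.1) ℓ
      have h5 : (a ρ - s c ρ.1) % ℓ = (a ρ - s c' ρ.1) % ℓ := congrFun h2 ρ
      simp only [nsmulAddMonoidHom_apply, LinearMap.smul_apply, nsmul_eq_mul, LinearMap.add_apply,
        LinearMap.neg_apply, ← hm ρ]
      linarith
    · rintro ⟨γ, _, ⟨t, ht, rfl⟩, hlin⟩
      obtain ⟨b, hb⟩ := Δ.exists_linEquiv_toricDivisor k (rep γ)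
      have h1 : (Δ.toricDivisor k t).LinEquiv (Δ.toricDivisor k (a - ℓ • b)) := by
        rw [toricDivisor_sub, toricDivisor_nsmul]
        rw [WeilDivisor.linEquiv_iff_mk_eq] at hlin ha hb ⊢
        rw [hlin, QuotientAddGroup.mk_sub, QuotientAddGroup.mk_sub, QuotientAddGroup.mk_nsmul,
          QuotientAddGroup.mk_nsmul, hb, ha]
      obtain ⟨m, hm⟩ := (Δ.toricDivisor_linEquiv_iff k _ _).mp h1
      -- Here `t = a - ℓb + m` on rays, so the preimage is the class of `-m`. Its representative is
      -- `-m - ℓn` for some `n`, whence `a - s = t + ℓ(b + n)`, with remainder `t` and quotient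
      -- linearly equivalent to `b`.
      have h2 := hs (QuotientAddGroup.mk (-m))
      rw [QuotientAddGroup.eq] at h2
      obtain ⟨n, hn⟩ := h2
      refine ⟨QuotientAddGroup.mk (-m), ?_⟩
      have h3 : ∀ ρ : Δ.Ray, a ρ - s (QuotientAddGroup.mk (-m)) ρ.1 = t ρ + ℓ * (b ρ + n ρ.1) :=
        fun ρ => by
          have h4 := congrArg (fun f : Module.Dual ℤ N => f ρ.1) hn
          have h5 := hm ρ
          simp only [nsmulAddMonoidHom_apply, LinearMap.smul_apply, nsmul_eq_mul,
            LinearMap.add_apply, LinearMap.neg_apply, Pi.sub_apply, Pi.mul_apply, Pi.natCast_apply] at h4 h5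
          linarith
      have hE : (QuotientAddGroup.mk (E (QuotientAddGroup.mk (-m))) :
          WeilDivisor.ClassGroup (Δ.toricVariety k)) = γ := by
        rw [← hrep γ, WeilDivisor.linEquiv_iff_mk_eq.mp hb, ← WeilDivisor.linEquiv_iff_mk_eq]
        refine (Δ.toricDivisor_linEquiv_iff k _ _).mpr ⟨n, fun ρ => ?_⟩
        rw [h3, Int.add_mul_ediv_left _ _ hℓ'.ne', Int.ediv_eq_zero_of_lt (ht ρ).1 (ht ρ).2]
        ring
      have hT' : T (QuotientAddGroup.mk (-m)) = Δ.toricDivisor k t := by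
        refine congrArg (Δ.toricDivisor k) (funext fun ρ => ?_)
        rw [h3, Int.add_mul_emod_self_left, Int.emod_eq_of_lt (ht ρ).1 (ht ρ).2]
      exact Sigma.subtype_ext hE hT'
  let e := (Equiv.ofBijective φ hφ).trans
    (Equiv.sigmaCongrRight fun γ => Finite.equivFin (S γ))
  refine ⟨e, fun c => ?_⟩
  exact WeilDivisor.linEquiv_iff_mk_eq.mpr (hrep _).symm

end SmoothFan

theorem theorem4p1 {k N : Type u} [Field k] [IsAlgClosed k] [AddCommGroup N] [Module.Free ℤ N]
    [Module.Finite ℤ N] (Δ : SmoothFan N) (ℓ : ℕ) (hℓ : 0 < ℓ) :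
    (∀ E : WeilDivisor (Δ.toricVariety k), IsLineBundle E.sheaf) ∧
    (∀ D : WeilDivisor (Δ.toricVariety k),
      ∃ (ι : Type u) (_ : Finite ι) (E : ι → WeilDivisor (Δ.toricVariety k)),
        Nonempty ((Scheme.Modules.pushforward (Δ.toricFrobenius k ℓ)).obj D.sheaf ≅
          ∐ fun i => (E i).sheaf)) ∧
    (Δ.NoTorusFactor → ∀ (D : WeilDivisor (Δ.toricVariety k))
      (rep : WeilDivisor.ClassGroup (Δ.toricVariety k) → WeilDivisor (Δ.toricVariety k)),
      (∀ c, (QuotientAddGroup.mk (rep c) : WeilDivisor.ClassGroup (Δ.toricVariety k)) = c) →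
      Nonempty ((Scheme.Modules.pushforward (Δ.toricFrobenius k ℓ)).obj D.sheaf ≅
        ∐ fun p : (Σ c : WeilDivisor.ClassGroup (Δ.toricVariety k),
            Fin (Δ.multiplicity k ℓ (rep c) D)) => (rep p.1).sheaf)) ∧
    (∀ (a : Δ.Ray → ℤ)
      (s : (Module.Dual ℤ N ⧸ (nsmulAddMonoidHom ℓ : Module.Dual ℤ N →+ Module.Dual ℤ N).range) →
        Module.Dual ℤ N),
      (∀ c, QuotientAddGroup.mk (s c) = c) →
      Nonempty ((Scheme.Modules.pushforward (Δ.toricFrobenius k ℓ)).obj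
          (Δ.toricDivisor k a).sheaf ≅
        ∐ fun c => (Δ.toricDivisor k fun ρ => ⌊((a ρ - s c ρ.1 : ℤ) : ℚ) / ℓ⌋).sheaf)) := by
  have hout (c : Module.Dual ℤ N ⧸
      (nsmulAddMonoidHom ℓ : Module.Dual ℤ N →+ Module.Dual ℤ N).range) :
    QuotientAddGroup.mk c.out = c := Quotient.out_eq' c
  refine ⟨Δ.isLineBundle_sheaf k, fun D => ?_, fun h D rep hrep => ?_, fun a s hs => ?_⟩
  · obtain ⟨a, ha⟩ := Δ.exists_linEquiv_toricDivisor k D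
    obtain ⟨i⟩ := ha.nonempty_iso
    obtain ⟨j⟩ := Δ.nonempty_pushforward_toricDivisor_iso k hℓ a _ hout
    exact ⟨_, finite_quotient_range_nsmul (Module.Dual ℤ N) hℓ, _,
      ⟨(Scheme.Modules.pushforward _).mapIso i ≪≫ j⟩⟩
  · obtain ⟨a, ha⟩ := Δ.exists_linEquiv_toricDivisor k D
    obtain ⟨i⟩ := ha.nonempty_iso
    obtain ⟨j⟩ := Δ.nonempty_pushforward_toricDivisor_iso k hℓ a _ hout
    obtain ⟨e, he⟩ := h.exists_equiv k hℓ D rep hrep a ha _ hout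
    exact ⟨(Scheme.Modules.pushforward _).mapIso i ≪≫ j ≪≫
      Sigma.whiskerEquiv e fun c => (he c).nonempty_iso.some.symm⟩
  -- The floor of the rational quotient is integer division.
  · simp only [Rat.floor_intCast_div_natCast]
    exact Δ.nonempty_pushforward_toricDivisor_iso k hℓ a s hs
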